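/- **Proposition 4.1.** Let $G\subset \mathrm{SL}_3(\mathbb C)$ be a finite subgroup whose action on $\mathbb C^3$ is not irreducible, and let $\bar G\subset \mathrm{PGL}_3(\mathbb C)=\mathrm{Aut}(\mathbb P^2)$ be its image. *Definitions.* A $\bar G$-surface is a nonsingular projective irreducible surface over $\mathbb C$ with a faithful action $\rho$ of $\bar G$; a $\bar G$-morphism (or birational $\bar G$-map) $f\colon (S,\rho)\to (S',\rho')$ is one with $\rho'(\bar G)=f\circ\rho(\bar G)\circ f^{-1}$. A $\bar G$-conic bundle is a morphism $\varphi\colon S\to\mathbb P^1$ that is equivariant for automorphisms of $\mathbb P^1$ and all of whose fibres over closed points are isomorphic to plane conics. A $\bar G$-surface is minimal if every birational $\bar G$-morphism from it to a $\bar G$-surface is an isomorphism; a $\bar G$-conic bundle is relatively minimal if this holds for the birational $\bar G$-morphisms over $\mathbb P^1$. A del Pezzo surface is $\mathbb P^1\times\mathbb P^1$ or a blowup of $\mathbb P^2$ at a set of at most $8$ closed points in general position (no three on a line, no six on a conic, no eight on a cubic singular at one of them). A link $\chi\colon S\dashrightarrow S'$ of Type I is a birational $\bar G$-map of $\bar G$-surfaces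 such that $S'$ is a del Pezzo surface, $\chi=\pi^{-1}$ for a $\bar G$-morphism $\pi\colon S'\to S$ that is the blowup of the $\bar G$-orbit of a closed point, and $S'$ has a relatively minimal $\bar G$-conic bundle $\varphi'\colon S'\to\mathbb P^1$. The plane is $\bar G$-rigid if for every birational $\bar G$-map $\Psi\colon\mathbb P^2\dashrightarrow S'$ to a $\bar G$-surface $S'$ that is minimal or has a relatively minimal $\bar G$-conic bundle structure over $\mathbb P^1$, there is a birational $\bar G$-automorphism $\alpha$ of $\mathbb P^2$ such that $\Psi\circ\alpha$ is an isomorphism of $\bar G$-surfaces. *Claim.* There is a closed point $p\in\mathbb P^2$ fixed by $\bar G$, a $\bar G$-surface $S'$ not isomorphic to $\mathbb P^2$ over $\mathbb C$, and a link $\mathbb P^2\dashrightarrow S'$ of Type I whose blowup $\pi\colon S'\to\mathbb P^2$ is the blowup of $p$. Moreover, $\mathbb P^2$ is not $\bar G$-rigid. -/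

import Mathlib

open CategoryTheory AlgebraicGeometry

noncomputable section

namespace GLink

/-! ### Varieties over the complex numbers and projective space -/

/-- The base scheme `Spec ℂ`. All varieties are objects of `Over SpecC`, so that their morphisms
and automorphisms are those of schemes over `ℂ`. -/
abbrev SpecC : Scheme.{0} := Spec (CommRingCat.of ℂ)

/-- The standard grading of `ℂ[x₀, …, xₙ]`. -/
abbrev grading (n : ℕ) : ℕ → Submodule ℂ (MvPolynomial (Fin (n + 1)) ℂ) :=
  MvPolynomial.homogeneousSubmodule (Fin (n + 1)) ℂ

instance (n : ℕ) : GradedAlgebra (grading n) := MvPolynomial.gradedAlgebra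

/-- Projective space `ℙⁿ = Proj ℂ[x₀, …, xₙ]` over `ℂ`. -/
def projSpace (n : ℕ) : Over SpecC :=
  Over.mk (Proj.toSpecZero (grading n) ≫
    Spec.map (CommRingCat.ofHom (algebraMap ℂ (grading n 0))))

/-- The homogeneous ideal of polynomials vanishing at a point of `ℙⁿ`. -/
def vanishingPolys {n : ℕ} (p : (projSpace n).left) : HomogeneousIdeal (grading n) :=
  ProjectiveSpectrum.asHomogeneousIdeal (show ProjectiveSpectrum (grading n) from p)

/-- The product `ℙ¹ × ℙ¹`. -/
def quadric : Over SpecC :=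
  Over.mk (Limits.pullback.fst (projSpace 1).hom (projSpace 1).hom ≫ (projSpace 1).hom)

/-- A nonsingular projective (irreducible) surface over `ℂ`. -/
structure IsSmoothProjectiveSurface (X : Over SpecC) : Prop where
  integral : IsIntegral X.left
  smooth : SmoothOfRelativeDimension 2 X.hom
  projective : ∃ (n : ℕ) (i : X ⟶ projSpace n), IsClosedImmersion i.left

/-! ### The linear action on projective space -/

/-- The substitution `xᵢ ↦ ∑ⱼ Mᵢⱼ xⱼ`, i.e. `F ↦ F ∘ M`. -/
def subst {n : ℕ} (M : Matrix (Fin (n + 1)) (Fin (n + 1)) ℂ) :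
    MvPolynomial (Fin (n + 1)) ℂ →ₐ[ℂ] MvPolynomial (Fin (n + 1)) ℂ :=
  MvPolynomial.aeval fun i => ∑ j, MvPolynomial.C (M i j) * MvPolynomial.X j

lemma subst_isHomogeneous {n : ℕ} (M : Matrix (Fin (n + 1)) (Fin (n + 1)) ℂ) {d : ℕ}
    {F : MvPolynomial (Fin (n + 1)) ℂ} (hF : F ∈ grading n d) : subst M F ∈ grading n d := by
  have h := MvPolynomial.IsHomogeneous.aeval (n := 1)
    ((MvPolynomial.mem_homogeneousSubmodule _ _).1 hF)
    (fun i => ∑ j, MvPolynomial.C (M i j) * MvPolynomial.X j) (fun i => by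
      refine MvPolynomial.IsHomogeneous.sum _ _ _ fun j _ => ?_
      simpa using (MvPolynomial.isHomogeneous_C (Fin (n + 1)) (M i j)).mul
        (MvPolynomial.isHomogeneous_X ℂ j))
  rw [one_mul] at h
  exact h

lemma subst_mul {n : ℕ} (M N : Matrix (Fin (n + 1)) (Fin (n + 1)) ℂ) :
    subst (M * N) = (subst N).comp (subst M) := by
  ext i : 1
  simp only [subst, MvPolynomial.aeval_X, AlgHom.comp_apply, map_sum, map_mul,
    MvPolynomial.algHom_C, Matrix.mul_apply, Finset.sum_mul, Finset.mul_sum,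
    MvPolynomial.algebraMap_eq]
  rw [Finset.sum_comm]
  simp only [mul_assoc]

lemma subst_one {n : ℕ} :
    subst (1 : Matrix (Fin (n + 1)) (Fin (n + 1)) ℂ) = AlgHom.id ℂ _ := by
  ext i : 1
  simp [subst, Matrix.one_apply]

/-- The substitution as a graded ring homomorphism. -/
def gradedSubst {n : ℕ} (M : Matrix (Fin (n + 1)) (Fin (n + 1)) ℂ) :
    GradedRingHom (grading n) (grading n) where
  toRingHom := (subst M).toRingHom
  map_mem hF := subst_isHomogeneous M hF

lemma irrelevant_le_map {n : ℕ} (M : Matrix.SpecialLinearGroup (Fin (n + 1)) ℂ) :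
    HomogeneousIdeal.irrelevant (grading n) ≤
      (HomogeneousIdeal.irrelevant (grading n)).map (gradedSubst M.1) := by
  rw [HomogeneousIdeal.irrelevant_le]
  intro i hi F hF
  have e : F = subst M.1 (subst (M⁻¹).1 F) := by
    have h := subst_mul (M⁻¹).1 M.1
    rw [← Matrix.SpecialLinearGroup.coe_mul, inv_mul_cancel,
      Matrix.SpecialLinearGroup.coe_one, subst_one] at h
    exact congrArg (fun f => f F) h
  rw [e]
  exact Ideal.mem_map_of_mem _ (HomogeneousIdeal.mem_irrelevant_of_mem _ hi
    (subst_isHomogeneous _ hF))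

/-- The morphism of `Proj` induced by a graded ring homomorphism that fixes the constants is a
morphism over `ℂ`. -/
lemma map_comp_structure {n : ℕ} (f : GradedRingHom (grading n) (grading n))
    (hf : HomogeneousIdeal.irrelevant (grading n) ≤
      (HomogeneousIdeal.irrelevant (grading n)).map f)
    (hC : ∀ c : ℂ, f (MvPolynomial.C c) = MvPolynomial.C c) :
    Proj.map f hf ≫ (projSpace n).hom = (projSpace n).hom := by
  have key (i : ℕ) (hi : 0 < i) (s : MvPolynomial (Fin (n + 1)) ℂ) (hs : s ∈ grading n i) :
      Proj.awayι (grading n) (f s) (f.2 hs) hi ≫ Proj.map f hf ≫ Proj.toSpecZero (grading n) ≫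
        Spec.map (CommRingCat.ofHom (algebraMap ℂ (grading n 0))) =
      Proj.awayι (grading n) (f s) (f.2 hs) hi ≫ Proj.toSpecZero (grading n) ≫
        Spec.map (CommRingCat.ofHom (algebraMap ℂ (grading n 0))) := by
    rw [Proj.awayι_comp_map_assoc f hf hi s hs, Proj.awayι_toSpecZero_assoc,
      Proj.awayι_toSpecZero_assoc, ← Spec.map_comp, ← Spec.map_comp, ← Spec.map_comp]
    congr 1
    ext c
    change Localization.mk (f (MvPolynomial.C c)) ⟨f 1, _⟩ = Localization.mk (MvPolynomial.C c) 1
    congr 1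
    · exact hC c
    · exact Subtype.ext (map_one f)
  exact (Proj.mapAffineOpenCover f hf).openCover.hom_ext _ _ fun s =>
    key s.1 s.1.2 s.2 s.2.2

/-- The automorphism of the scheme `ℙⁿ` given on points by `v ↦ M v`. -/
def linearMap {n : ℕ} (M : Matrix.SpecialLinearGroup (Fin (n + 1)) ℂ) :
    projSpace n ⟶ projSpace n :=
  Over.homMk (Proj.map (gradedSubst M.1) (irrelevant_le_map M)) (by
    exact map_comp_structure _ _ fun c => (subst M.1).commutes c)

/-- The action of `SLₙ₊₁(ℂ)` on `ℙⁿ`, as a homomorphism to `Aut(ℙⁿ)`. Its kernel consists of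
the scalar matrices. -/
def linearAction (n : ℕ) :
    Matrix.SpecialLinearGroup (Fin (n + 1)) ℂ →* Aut (projSpace n) :=
  (Aut.unitsEndEquivAut (projSpace n)).toMonoidHom.comp
    (MonoidHom.toHomUnits
      { toFun := fun M => End.of (linearMap M)
        map_one' := by
          refine Over.OverMorphism.ext ?_
          have h : gradedSubst (n := n) (1 : Matrix.SpecialLinearGroup (Fin (n + 1)) ℂ).1
              = .id (grading n) := by
            refine DFunLike.ext _ _ fun F => ?_
            exact congrArg (fun f => f F) (subst_one (n := n))
          change Proj.map _ _ = 𝟙 _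
          simp only [h]
          exact Proj.map_id
        map_mul' := fun M N => by
          refine Over.OverMorphism.ext ?_
          have h : gradedSubst (M * N).1 = (gradedSubst N.1).comp (gradedSubst M.1) := by
            refine DFunLike.ext _ _ fun F => ?_
            exact congrArg (fun f => f F) (subst_mul M.1 N.1)
          change Proj.map _ _ = Proj.map _ _ ≫ Proj.map _ _
          simp only [h]
          exact Proj.map_comp _ _ _ _ })

/-! ### `G`-surfaces and their maps -/

/-- A scheme over `ℂ` together with an action of the group `H` by automorphisms over `ℂ`. -/
structure GVariety (H : Type) [Group H] where
  X : Over SpecC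
  ρ : H →* Aut X

variable {H : Type} [Group H]

/-- An `H`-surface: a nonsingular projective surface with a faithful action of `H`. -/
structure IsGSurface (S : GVariety H) : Prop where
  surface : IsSmoothProjectiveSurface S.X
  faithful : Function.Injective S.ρ

/-- Morphisms `f : S ⟶ S'` with `ρ'(H) = f ∘ ρ(H) ∘ f⁻¹`. -/
def IsGMorphism (S S' : GVariety H) (f : S.X ⟶ S'.X) : Prop :=
  (∀ h, ∃ h', (S.ρ h).hom ≫ f = f ≫ (S'.ρ h').hom) ∧
    ∀ h', ∃ h, (S.ρ h).hom ≫ f = f ≫ (S'.ρ h').hom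

/-- A birational map of varieties over `ℂ`, given by an isomorphism over `ℂ` between dense open
subschemes. Two of these define the same birational map if and only if their
`toRationalMap`s agree. -/
structure BirMap (X Y : Over SpecC) where
  toPartialIso : X.left.PartialIso Y.left
  isOver : toPartialIso.IsOver X.hom Y.hom

/-- The underlying rational map of a birational map. -/
def BirMap.rat {X Y : Over SpecC} (f : BirMap X Y) : X.left ⤏ Y.left :=
  f.toPartialIso.toRationalMap

/-- The composition `g ∘ f`. -/
def BirMap.trans {X Y Z : Over SpecC} (f : BirMap X Y) (g : BirMap Y Z) : BirMap X Z :=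
  ⟨f.toPartialIso.trans g.toPartialIso, f.isOver.trans g.isOver⟩

/-- An isomorphism as a birational map. -/
def BirMap.ofIso {X Y : Over SpecC} (e : X ≅ Y) : BirMap X Y where
  toPartialIso := .ofIso ((Over.forget _).mapIso e)
  isOver := by
    change ((X.left.topIso.hom ≫ e.hom.left ≫ Y.left.topIso.inv) ≫ (⊤ : Y.left.Opens).ι ≫ Y.hom)
      = (⊤ : X.left.Opens).ι ≫ X.hom
    have h : Y.left.topIso.inv ≫ (⊤ : Y.left.Opens).ι = 𝟙 _ := Y.left.topIso.inv_hom_id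
    rw [Category.assoc, Category.assoc, reassoc_of% h, Over.w]
    rfl

/-- Birational maps `f : S ⇢ S'` with `ρ'(H) = f ∘ ρ(H) ∘ f⁻¹`. -/
def IsGBirMap (S S' : GVariety H) (f : BirMap S.X S'.X) : Prop :=
  (∀ h, ∃ h', ((BirMap.ofIso (S.ρ h)).trans f).rat = (f.trans (BirMap.ofIso (S'.ρ h'))).rat) ∧
    ∀ h', ∃ h, ((BirMap.ofIso (S.ρ h)).trans f).rat = (f.trans (BirMap.ofIso (S'.ρ h'))).rat

/-- A morphism of varieties that is birational. -/
def IsBirationalMorphism {X Y : Over SpecC} (f : X ⟶ Y) : Prop :=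
  ∃ e : BirMap X Y, e.rat = f.left.toRationalMap

/-! ### Blowups, general position, del Pezzo surfaces -/

/-- The ideal sheaf `I` is locally generated by one nonzerodivisor. -/
def IsEffectiveCartier {Y : Scheme.{0}} (I : Y.IdealSheafData) : Prop :=
  ∀ y : Y, ∃ U : Y.affineOpens, y ∈ U.1 ∧
    ∃ t ∈ nonZeroDivisors Γ(Y, U.1), I.ideal U = Ideal.span {t}

/-- `π : Z ⟶ Y` is the blowup of `Y` along the closed subscheme defined by `I`: the inverse image
ideal sheaf on `Z` is an effective Cartier divisor, and `π` is universal with this property. -/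
def IsBlowup {Z Y : Scheme.{0}} (π : Z ⟶ Y) (I : Y.IdealSheafData) : Prop :=
  IsEffectiveCartier (I.comap π) ∧
    ∀ (T : Scheme.{0}) (f : T ⟶ Y), IsEffectiveCartier (I.comap f) → ∃! g : T ⟶ Z, g ≫ π = f

/-- The blowup of a set of points (in use: finite sets of closed points, which are closed), with
the reduced structure. -/
def IsBlowupOfPoints {Z Y : Scheme.{0}} (π : Z ⟶ Y) (P : Set Y) : Prop :=
  IsBlowup π (.vanishingIdeal (.closure P))

/-- Points of the plane in general position: no three on a line, no six on a conic, no eight on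
a cubic that is singular at one of them. -/
structure InGeneralPosition (P : Set (projSpace 2).left) : Prop where
  line : ∀ F ∈ grading 2 1, F ≠ 0 → {p ∈ P | F ∈ vanishingPolys p}.ncard < 3
  conic : ∀ F ∈ grading 2 2, F ≠ 0 → {p ∈ P | F ∈ vanishingPolys p}.ncard < 6
  cubic : ∀ F ∈ grading 2 3, F ≠ 0 →
    (∃ p ∈ P, F ∈ vanishingPolys p ∧ ∀ i, MvPolynomial.pderiv i F ∈ vanishingPolys p) →
      {p ∈ P | F ∈ vanishingPolys p}.ncard < 8

/-- Del Pezzo surfaces: `ℙ¹ × ℙ¹` and the blowups of `ℙ²` in at most eight closed points in general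
position. -/
def IsDelPezzo (X : Over SpecC) : Prop :=
  Nonempty (X ≅ quadric) ∨
    ∃ P : Set (projSpace 2).left, P.Finite ∧ P.ncard ≤ 8 ∧ (∀ p ∈ P, IsClosed {p}) ∧
      InGeneralPosition P ∧ ∃ π : X ⟶ projSpace 2, IsBlowupOfPoints π.left P

/-! ### Conic bundles -/

/-- The dehomogenization `q / x_k²` of a quadratic form as a function on `{x_k ≠ 0} ⊆ ℙ²`. -/
def dehomogenize (q : MvPolynomial (Fin 3) ℂ) (hq : q ∈ grading 2 2) (k : Fin 3) :
    Γ(Proj (grading 2), Proj.basicOpen (grading 2) (MvPolynomial.X k)) :=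
  (Proj.awayToSection (grading 2) (MvPolynomial.X k)).hom
    (HomogeneousLocalization.Away.mk (grading 2) (MvPolynomial.isHomogeneous_X ℂ k) 2 q hq)

/-- The standard affine charts of `ℙ²`. -/
def chart (k : Fin 3) : (Proj (grading 2)).affineOpens :=
  ⟨Proj.basicOpen (grading 2) (MvPolynomial.X k),
    Proj.isAffineOpen_basicOpen (grading 2) _ (MvPolynomial.isHomogeneous_X ℂ k) one_pos⟩

/-- `C` is isomorphic to a conic: the closed subscheme of `ℙ²` defined by a nonzero quadratic
form. -/
def IsConic (C : Over SpecC) : Prop :=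
  ∃ (q : MvPolynomial (Fin 3) ℂ) (hq : q ∈ grading 2 2) (i : C ⟶ projSpace 2), q ≠ 0 ∧
    IsClosedImmersion i.left ∧
      ∀ k, (Scheme.Hom.ker (Y := Proj (grading 2)) i.left).ideal (chart k) =
        Ideal.span {dehomogenize q hq k}

/-- `φ : S ⟶ ℙ¹` is an `H`-equivariant conic bundle: `H` permutes the fibres through automorphisms
of `ℙ¹`, and every scheme-theoretic fibre over a closed point is a conic. -/
structure IsGConicBundle (S : GVariety H) (φ : S.X ⟶ projSpace 1) : Prop where
  equivariant : ∀ h, ∃ τ : Aut (projSpace 1), (S.ρ h).hom ≫ φ = φ ≫ τ.hom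
  conic : ∀ t : (projSpace 1).left, IsClosed {t} →
    IsConic (Over.mk (φ.left.fiberι t ≫ S.X.hom))

/-! ### Minimality, rigidity and links -/

/-- An `H`-surface is minimal if every birational `H`-morphism from it to an `H`-surface is an
isomorphism. -/
def IsMinimal (S : GVariety H) : Prop :=
  ∀ (S' : GVariety H) (f : S.X ⟶ S'.X), IsGSurface S' → IsGMorphism S S' f →
    IsBirationalMorphism f → IsIso f

/-- Relative minimality over `ℙ¹`: every birational `H`-morphism over `ℙ¹` to an `H`-surface is
an isomorphism. -/
def IsRelativelyMinimal (S : GVariety H) (φ : S.X ⟶ projSpace 1) : Prop :=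
  ∀ (S' : GVariety H) (f : S.X ⟶ S'.X) (ψ : S'.X ⟶ projSpace 1), IsGSurface S' →
    IsGMorphism S S' f → IsBirationalMorphism f → f ≫ ψ = φ → IsIso f

/-- The surfaces compared in the definition of rigidity: minimal `H`-surfaces and relatively
minimal `H`-conic bundles. -/
def IsMinimalModel (S : GVariety H) : Prop :=
  IsGSurface S ∧
    (IsMinimal S ∨ ∃ φ : S.X ⟶ projSpace 1, IsGConicBundle S φ ∧ IsRelativelyMinimal S φ)

/-- `S` is `H`-rigid: for every birational `H`-map `Ψ : S ⇢ S'` to a minimal model there is a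
birational `H`-automorphism `α` of `S` such that `Ψ ∘ α` is an isomorphism of `H`-surfaces. -/
def IsGRigid (S : GVariety H) : Prop :=
  ∀ (S' : GVariety H) (Ψ : BirMap S.X S'.X), IsMinimalModel S' → IsGBirMap S S' Ψ →
    ∃ (α : BirMap S.X S.X) (e : S.X ≅ S'.X), IsGBirMap S S α ∧ IsGMorphism S S' e.hom ∧
      (α.trans Ψ).rat = (BirMap.ofIso e).rat

/-- The orbit of a point. -/
def orbit (S : GVariety H) (p : S.X.left) : Set S.X.left :=
  Set.range fun h => (S.ρ h).hom.left p

/-- An elementary link `χ : S ⇢ S'` of Type I: `S'` is a del Pezzo surface, `π : S' ⟶ S` is an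
equivariant blowup of the orbit of a closed point, `χ = π⁻¹`, and `φ' : S' ⟶ ℙ¹` is
an `H`-conic bundle. -/
structure TypeILink (S S' : GVariety H) where
  center : S.X.left
  π : S'.X ⟶ S.X
  φ' : S'.X ⟶ projSpace 1
  χ : BirMap S.X S'.X
  source_surface : IsGSurface S
  target_surface : IsGSurface S'
  isClosed_center : IsClosed {center}
  π_equivariant : IsGMorphism S' S π
  π_blowup : IsBlowupOfPoints π.left (orbit S center)
  χ_equivariant : IsGBirMap S S' χ
  χ_comp_π : χ.rat.compHom π.left = .id S.X.left
  delPezzo : IsDelPezzo S'.X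
  conicBundle : IsGConicBundle S' φ'
  relativelyMinimal : IsRelativelyMinimal S' φ'

/-! ### The projective plane -/

/-- The natural representation of a subgroup of `SL₃(ℂ)` on `ℂ³`. -/
def natRep (G : Subgroup (Matrix.SpecialLinearGroup (Fin 3) ℂ)) :
    Representation ℂ G (Fin 3 → ℂ) where
  toFun g := Matrix.toLin' g.1.1
  map_one' := by simp; rfl
  map_mul' g h := by simp [Matrix.toLin'_mul]; rfl

/-- The image `Ḡ` of `G ⊆ SL₃(ℂ)` in `PGL₃(ℂ) = Aut(ℙ²)`. -/
def bar (G : Subgroup (Matrix.SpecialLinearGroup (Fin 3) ℂ)) : Subgroup (Aut (projSpace 2)) :=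
  G.map (linearAction 2)

/-- The plane as a `Ḡ`-surface, the action being the inclusion `Ḡ ⊆ Aut(ℙ²)`. -/
def plane (G : Subgroup (Matrix.SpecialLinearGroup (Fin 3) ℂ)) : GVariety (bar G) where
  X := projSpace 2
  ρ := (bar G).subtype

end GLink

end

/-!
# The plane is not rigid for a reducible finite group

A reducible representation of a finite group on `ℂ³` splits by Maschke's theorem, so it has an
invariant line (`exists_eigenvector`), that is, the group fixes a closed point `p` of the plane. Let
`S'` be the blowup of the plane at `p`. The group acts on `S'` by the universal property of the
blowup (`blowupAction`), and the projection from `p` extends to a morphism `φ : S' ⟶ ℙ¹` whose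
fibres are the strict transforms of the lines through `p`. A linear change of coordinates moves `p`
to `[0 : 0 : 1]`.

The surface `S'` is the ruled surface `𝔽₁`. It is realized as a closed subscheme of `ℙ⁴`, the
closure of the torus embedded by `(β, γ) ↦ [1 : β : β² : γ : βγ]`, so that it is projective, and it
is covered by four affine planes (`Scroll.κ`), which give smoothness and explicit formulas for the
contraction `π` and for `φ`. Morphisms out of `S'` are glued from these charts, the compatibility
being a computation on the torus, which is scheme-theoretically dense. The universal property of the
blowup is `Scroll.isBlowup_π`: where the inverse image of the ideal `(x₀, x₁)` of the point is
generated by a nonzerodivisor `t`, the affine coordinates of a point of the plane are locally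
`(t, t b)` or `(t b, t)`, and `(b, t)` are the coordinates of its lift. A fibre of `φ` is glued from two
affine lines in the same way as the conic `x₁² = x₀x₂`, hence is isomorphic to it
(`Scroll.isConic_fibre`). The action permutes the fibres through the block of its matrices that acts
on the lines through `p` (`Scroll.exists_comp_φ_eq`).

The ruling is relatively minimal, even without the group action: a birational morphism `f : S' ⟶ Y`
over the line to a nonsingular projective surface is an isomorphism
(`Scroll.isIso_of_isBirationalMorphism`). Indeed the fibres of `φ` are irreducible curves, so `f`
either has finite fibres or contracts a whole fibre of `φ` to a point `y`. In the second case `y` is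
set theoretically a fibre of `Y ⟶ ℙ¹`, so its local ring has dimension at most one by Krull's
theorem, which is not the case (`Scroll.exists_apply_ne`). In the first case `f` is finite and
birational, hence an isomorphism because `Y` is normal (`isIso_of_isFinite_of_birational`).

Finally `S'` is not isomorphic to the plane, as the fibres of `φ` are disjoint curves, while any two
curves in the plane meet (`Plane.exists_le`, `Scroll.isEmpty_iso_plane`). Since `S'` is a relatively
minimal conic bundle, the inverse of the blowup is one of the maps that rigidity would turn into an
isomorphism of the plane with `S'`; so the plane is not rigid.
-/

open CategoryTheory AlgebraicGeometry

noncomputable section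

namespace GLink

/-! ### Points of projective space with values in a ring -/

section Points

open HomogeneousLocalization

variable {n : ℕ} {B B' : Type} [CommRing B] [CommRing B']

/-- For a ring homomorphism `f` out of the homogeneous coordinate ring with `f s` invertible, the
induced homomorphism on the degree zero part of the localization at `s`. -/
def awayHom (f : MvPolynomial (Fin (n + 1)) ℂ →+* B) (s : MvPolynomial (Fin (n + 1)) ℂ)
    (hs : IsUnit (f s)) : Away (grading n) s →+* B :=
  (IsLocalization.Away.lift (S := Localization.Away s) s hs).comp
    (algebraMap (Away (grading n) s) (Localization.Away s))

lemma awayHom_mk (f : MvPolynomial (Fin (n + 1)) ℂ →+* B) {s : MvPolynomial (Fin (n + 1)) ℂ}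
    (hs : IsUnit (f s)) {m : ℕ} (hm : s ∈ grading n m) (k : ℕ)
    (a : MvPolynomial (Fin (n + 1)) ℂ) (ha : a ∈ grading n (k • m)) :
    awayHom f s hs (Away.mk (grading n) hm k a ha) * f s ^ k = f a := by
  have h1 : (Away.mk (grading n) hm k a ha).val *
      algebraMap _ (Localization.Away s) (s ^ k) = algebraMap _ _ a := by
    rw [Away.val_mk, Localization.mk_eq_mk']
    exact IsLocalization.mk'_spec _ a _
  have h2 := congrArg (IsLocalization.Away.lift (S := Localization.Away s) s hs) h1
  rw [map_mul, IsLocalization.Away.lift_eq, IsLocalization.Away.lift_eq, map_pow] at h2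
  exact h2

lemma awayHom_ext {s : MvPolynomial (Fin (n + 1)) ℂ} {m : ℕ} (hm : s ∈ grading n m)
    {f : MvPolynomial (Fin (n + 1)) ℂ →+* B} (hs : IsUnit (f s))
    {φ : Away (grading n) s →+* B}
    (h : ∀ k a ha, φ (Away.mk (grading n) hm k a ha) * f s ^ k = f a) :
    awayHom f s hs = φ := by
  ext x
  obtain ⟨k, a, ha, rfl⟩ := Away.mk_surjective _ hm x
  exact (hs.pow k).mul_left_injective ((awayHom_mk f hs hm k a ha).trans (h k a ha).symm)

/-- The `B`-valued point of `ℙⁿ` with homogeneous coordinates `f x₀, …, f xₙ`, where `f` is a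
homomorphism from `ℂ[x₀, …, xₙ]` to `B` which makes the form `s` of positive degree invertible. -/
def pt (f : MvPolynomial (Fin (n + 1)) ℂ →+* B) {s : MvPolynomial (Fin (n + 1)) ℂ} {m : ℕ}
    (hm : s ∈ grading n m) (h0 : 0 < m) (hs : IsUnit (f s)) :
    Spec (CommRingCat.of B) ⟶ Proj (grading n) :=
  Spec.map (CommRingCat.ofHom (awayHom f s hs)) ≫ Proj.awayι (grading n) s hm h0

variable (f : MvPolynomial (Fin (n + 1)) ℂ →+* B) {s t : MvPolynomial (Fin (n + 1)) ℂ}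
  {m m' : ℕ} (hm : s ∈ grading n m) (h0 : 0 < m) (hs : IsUnit (f s))
  (hm' : t ∈ grading n m') (h0' : 0 < m') (ht : IsUnit (f t))

lemma SpecMap_pt (g : B →+* B') :
    Spec.map (CommRingCat.ofHom g) ≫ pt f hm h0 hs =
      pt (g.comp f) hm h0 (hs.map g) := by
  rw [pt, pt, ← Category.assoc, ← Spec.map_comp, ← CommRingCat.ofHom_comp]
  congr 3
  refine (awayHom_ext hm _ fun k a ha => ?_).symm
  rw [RingHom.comp_apply, RingHom.comp_apply, ← map_pow, ← map_mul, awayHom_mk,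
    RingHom.comp_apply]

lemma pt_eq_of_scale (g : MvPolynomial (Fin (n + 1)) ℂ →+* B) (hs' : IsUnit (g s)) (u : Bˣ)
    (h : ∀ d, ∀ F ∈ grading n d, g F = u ^ d * f F) :
    pt f hm h0 hs = pt g hm h0 hs' := by
  rw [pt, pt]
  congr 3
  refine awayHom_ext hm _ fun k a ha => ?_
  have h1 := awayHom_mk g hs' hm k a ha
  rw [h _ _ ha, h _ _ hm, mul_pow, ← pow_mul, smul_eq_mul, mul_comm k m, mul_left_comm] at h1
  exact (u.isUnit.pow (m * k)).mul_right_injective h1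

lemma pt_mul (hst : IsUnit (f (s * t))) :
    pt f hm h0 hs = pt f (SetLike.mul_mem_graded hm hm') (Nat.add_pos_left h0 _) hst := by
  rw [pt, pt, ← Proj.SpecMap_awayMap_awayι (𝒜 := grading n) hm h0 hm' rfl, ← Category.assoc,
    ← Spec.map_comp, ← CommRingCat.ofHom_comp]
  congr 3
  refine awayHom_ext hm _ fun k a ha => ?_
  rw [RingHom.comp_apply]
  have h1 : awayMap (grading n) hm' rfl (Away.mk (grading n) hm k a ha) =
      Away.mk (grading n) (SetLike.mul_mem_graded hm hm') k (a * t ^ k)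
        (by simpa [mul_add] using SetLike.mul_mem_graded ha (SetLike.pow_mem_graded k hm')) := by
    apply HomogeneousLocalization.val_injective
    rw [Away.val_mk]
    exact val_awayMap_mk ..
  have h2 := awayHom_mk f hst (SetLike.mul_mem_graded hm hm') k (a * t ^ k)
    (by simpa [mul_add] using SetLike.mul_mem_graded ha (SetLike.pow_mem_graded k hm'))
  rw [h1]
  have ht : IsUnit (f t) := isUnit_of_mul_isUnit_right (by simpa using hst)
  refine (ht.pow k).mul_left_injective ?_
  simp only [map_mul, map_pow, mul_pow] at h2 ⊢
  rw [mul_assoc, h2]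

/-- The point does not depend on the form used to define it. -/
lemma pt_indep : pt f hm h0 hs = pt f hm' h0' ht := by
  have hst : IsUnit (f (s * t)) := by rw [map_mul]; exact hs.mul ht
  have hts : IsUnit (f (t * s)) := by rw [mul_comm]; exact hst
  rw [pt_mul f hm h0 hs hm' hst, pt_mul f hm' h0' ht hm hts]
  congr 1
  · exact mul_comm _ _
  · exact add_comm _ _

/-- Composing a point with the morphism of `Proj` defined by a graded homomorphism substitutes
this homomorphism into the coordinates. -/
lemma pt_comp_map (g : GradedRingHom (grading n) (grading n))
    (hg : HomogeneousIdeal.irrelevant (grading n) ≤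
      (HomogeneousIdeal.irrelevant (grading n)).map g)
    (ht : IsUnit (f (g t))) :
    pt f hm h0 hs ≫ Proj.map g hg = pt (f.comp g.toRingHom) hm' h0' ht := by
  rw [pt_indep f hm h0 hs (g.2 hm') h0' ht, pt, pt, Category.assoc]
  change _ ≫ (Proj.awayι (grading n) (g t) (g.2 hm') h0' ≫ Proj.map g hg) = _
  rw [Proj.awayι_comp_map g hg h0' t hm', ← Category.assoc, ← Spec.map_comp,
    ← CommRingCat.ofHom_comp]
  congr 3
  refine (awayHom_ext hm' _ fun k a ha => ?_).symm
  rw [RingHom.comp_apply, Away.map_mk]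
  exact awayHom_mk f ht (g.2 hm') k (g a) (g.2 ha)

/-- The point is a morphism over `ℂ` for the `ℂ`-algebra structure that `f` induces on `B`. -/
lemma pt_comp_structure :
    pt f hm h0 hs ≫ (projSpace n).hom =
      Spec.map (CommRingCat.ofHom (f.comp MvPolynomial.C)) := by
  change _ ≫ Proj.toSpecZero (grading n) ≫ _ = _
  rw [pt, Category.assoc, Proj.awayι_toSpecZero_assoc, ← Spec.map_comp, ← Spec.map_comp]
  congr 1
  ext c
  have h1 := awayHom_mk f hs hm 0 (MvPolynomial.C c)
    (by simp [grading])
  rw [pow_zero, mul_one] at h1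
  refine Eq.trans ?_ h1
  change awayHom f s hs _ = _
  congr 1
  apply HomogeneousLocalization.val_injective
  rw [Away.val_mk]
  exact congrArg (Localization.mk (MvPolynomial.C c)) (Subtype.ext (pow_zero s).symm)

/-- A form vanishes at the image of `x` if and only if its value at the coordinates does. -/
lemma pt_mem_basicOpen {t : MvPolynomial (Fin (n + 1)) ℂ} {m' : ℕ} (hm' : t ∈ grading n m')
    (h0' : 0 < m') (x : Spec (CommRingCat.of B)) :
    pt f hm h0 hs x ∈ Proj.basicOpen (grading n) t ↔ f t ∉ x.asIdeal := by
  have h1 : pt f hm h0 hs x ∈ Proj.basicOpen (grading n) t ↔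
      Spec.map (CommRingCat.ofHom (awayHom f s hs)) x ∈
        Proj.awayι (grading n) s hm h0 ⁻¹ᵁ Proj.basicOpen (grading n) t := by
    rw [pt]; rfl
  rw [h1, Proj.awayι_preimage_basicOpen (g_deg := hm') (hm' := h0')]
  have h2 := awayHom_mk f hs hm m' (t ^ m)
    (by simpa [mul_comm] using SetLike.pow_mem_graded m hm')
  change awayHom f s hs (Away.isLocalizationElem hm hm') ∉ x.asIdeal ↔ _
  have h3 : Away.mk (grading n) hm m' (t ^ m)
      (by simpa [mul_comm] using SetLike.pow_mem_graded m hm') =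
        Away.isLocalizationElem hm hm' := rfl
  rw [h3] at h2
  rw [not_iff_not]
  have h4 : f t ∈ x.asIdeal ↔ f (t ^ m) ∈ x.asIdeal := by
    rw [map_pow]
    exact (x.isPrime.pow_mem_iff_mem _ h0).symm
  rw [h4, ← h2]
  exact ⟨fun h => Ideal.mul_mem_right _ _ h, fun h => (x.isPrime.mem_or_mem h).resolve_right
    fun h5 => x.isPrime.ne_top (Ideal.eq_top_of_isUnit_mem _ h5 (hs.pow m'))⟩

lemma pt_range_subset_iff {t : MvPolynomial (Fin (n + 1)) ℂ} {m' : ℕ} (hm' : t ∈ grading n m')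
    (h0' : 0 < m') :
    Set.range (pt f hm h0 hs) ⊆ Proj.basicOpen (grading n) t ↔ IsUnit (f t) := by
  rw [Set.range_subset_iff]
  simp only [SetLike.mem_coe, pt_mem_basicOpen f hm h0 hs hm' h0']
  constructor
  · intro h
    by_contra h1
    obtain ⟨M, hM, h2⟩ := exists_max_ideal_of_mem_nonunits h1
    exact h ⟨M, hM.isPrime⟩ h2
  · intro h x hx
    exact x.isPrime.ne_top (Ideal.eq_top_of_isUnit_mem _ hx h)

/-! ### Standard charts of projective space -/

lemma X_mem (k : Fin (n + 1)) : (MvPolynomial.X k : MvPolynomial (Fin (n + 1)) ℂ) ∈ grading n 1 :=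
  MvPolynomial.isHomogeneous_X ℂ k

/-- Two homomorphisms that agree on constants and whose values on the variables differ by a common
factor `u` differ by `u ^ d` on forms of degree `d`. -/
lemma apply_eq_of_scale (f g : MvPolynomial (Fin (n + 1)) ℂ →+* B) (u : B)
    (hC : ∀ c, g (MvPolynomial.C c) = f (MvPolynomial.C c))
    (hX : ∀ i, g (MvPolynomial.X i) = u * f (MvPolynomial.X i)) {d : ℕ}
    {F : MvPolynomial (Fin (n + 1)) ℂ} (hF : F ∈ grading n d) : g F = u ^ d * f F := by
  have key (h : MvPolynomial (Fin (n + 1)) ℂ →+* B) : h F = ∑ e ∈ F.support,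
      h (MvPolynomial.C (F.coeff e)) * ∏ i, h (MvPolynomial.X i) ^ e i := by
    conv_lhs => rw [F.as_sum]
    rw [map_sum]
    refine Finset.sum_congr rfl fun e _ => ?_
    rw [MvPolynomial.monomial_eq, map_mul, Finsupp.prod_fintype _ _ (fun i => pow_zero _),
      map_prod]
    simp only [map_pow]
  rw [key g, key f, Finset.mul_sum]
  refine Finset.sum_congr rfl fun e he => ?_
  have h1 : ∑ i, e i = d := by
    have := (MvPolynomial.mem_homogeneousSubmodule _ _).1 hF (MvPolynomial.mem_support_iff.1 he)
    rwa [Finsupp.weight_apply, Finsupp.sum_fintype _ _ (fun i => by simp),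
      Finset.sum_congr rfl (fun i _ => by rw [Pi.one_apply, smul_eq_mul, mul_one])] at this
  simp only [hC, hX, mul_pow, Finset.prod_mul_distrib, Finset.prod_pow_eq_pow_sum, h1]
  ring

/-- Homogeneous coordinates that differ by a unit define the same point. -/
lemma pt_eq_of_X (g : MvPolynomial (Fin (n + 1)) ℂ →+* B)
    (ht : IsUnit (g t)) (u : Bˣ)
    (hC : ∀ c, g (MvPolynomial.C c) = f (MvPolynomial.C c))
    (hX : ∀ i, g (MvPolynomial.X i) = u * f (MvPolynomial.X i)) :
    pt f hm h0 hs = pt g hm' h0' ht := by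
  have h1 : IsUnit (g s) := by
    rw [apply_eq_of_scale f g u hC hX hm]
    exact (u.isUnit.pow m).mul hs
  rw [pt_eq_of_scale f hm h0 hs g h1 u fun d F hF => apply_eq_of_scale f g u hC hX hF]
  exact pt_indep g hm h0 h1 hm' h0' ht

/-- Dehomogenization `xᵢ ↦ xᵢ / xₖ`, with values in the coordinate ring of the chart `xₖ ≠ 0`. -/
def dehom (k : Fin (n + 1)) :
    MvPolynomial (Fin (n + 1)) ℂ →+* Away (grading n) (MvPolynomial.X k) :=
  MvPolynomial.eval₂Hom ((fromZeroRingHom (grading n) _).comp (algebraMap ℂ (grading n 0)))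
    fun i => Away.mk (grading n) (X_mem k) 1 (MvPolynomial.X i) (X_mem i)

lemma dehom_X (k i : Fin (n + 1)) : dehom k (MvPolynomial.X i) =
    Away.mk (grading n) (X_mem k) 1 (MvPolynomial.X i) (X_mem i) := by
  simp [dehom]

lemma dehom_X_self (k : Fin (n + 1)) : dehom k (MvPolynomial.X k) = 1 := by
  rw [dehom_X]
  apply HomogeneousLocalization.val_injective
  rw [Away.val_mk, HomogeneousLocalization.val_one]
  rw [Localization.mk_eq_mk', IsLocalization.mk'_eq_iff_eq_mul, one_mul]
  simp

lemma dehom_apply (k : Fin (n + 1)) {d : ℕ} (F : MvPolynomial (Fin (n + 1)) ℂ)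
    (hF : F ∈ grading n (d • 1)) : dehom k F = Away.mk (grading n) (X_mem k) d F hF := by
  apply HomogeneousLocalization.val_injective
  have h := apply_eq_of_scale
    (algebraMap (MvPolynomial (Fin (n + 1)) ℂ) (Localization.Away (MvPolynomial.X k)))
    ((algebraMap (Away (grading n) (MvPolynomial.X k))
      (Localization.Away (MvPolynomial.X k))).comp (dehom k))
    (Localization.mk 1 ⟨MvPolynomial.X k, Submonoid.mem_powers _⟩ :
      Localization.Away (MvPolynomial.X k : MvPolynomial (Fin (n + 1)) ℂ)) (fun c => ?_) (fun i => ?_) hF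
  · refine h.trans ?_
    rw [Away.val_mk, Localization.mk_pow, ← Localization.mk_one_eq_algebraMap,
      Localization.mk_mul]
    simp
  · rw [RingHom.comp_apply, dehom, MvPolynomial.coe_eval₂Hom, MvPolynomial.eval₂_C]
    exact Localization.mk_one_eq_algebraMap _
  · rw [RingHom.comp_apply, dehom_X, ← Localization.mk_one_eq_algebraMap, Localization.mk_mul]
    change (Away.mk (grading n) (X_mem k) 1 (MvPolynomial.X i) (X_mem i)).val = _
    rw [Away.val_mk]
    simp

lemma dehom_surjective (k : Fin (n + 1)) : Function.Surjective (dehom k) := by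
  intro x
  obtain ⟨d, a, ha, rfl⟩ := Away.mk_surjective _ (X_mem k) x
  exact ⟨a, dehom_apply k a ha⟩

lemma awayHom_dehom {k : Fin (n + 1)} (hk : f (MvPolynomial.X k) = 1)
    (F : MvPolynomial (Fin (n + 1)) ℂ) :
    awayHom f (MvPolynomial.X k) (hk ▸ isUnit_one) (dehom k F) = f F := by
  have key (d : ℕ) (F) (hF : F ∈ grading n (d • 1)) :
      awayHom f (MvPolynomial.X k) (hk ▸ isUnit_one) (dehom k F) = f F := by
    have := awayHom_mk f (hk ▸ isUnit_one) (X_mem k) d F hF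
    rw [← dehom_apply] at this
    simpa only [hk, one_pow, mul_one] using this
  rw [← DirectSum.sum_support_decompose (grading n) F]
  simp only [map_sum]
  exact Finset.sum_congr rfl fun i _ => key i _ (by
    rw [smul_eq_mul, mul_one]; exact SetLike.coe_mem _)

lemma awayHom_comp_dehom (k : Fin (n + 1)) (φ : Away (grading n) (MvPolynomial.X k) →+* B)
    (h : IsUnit ((φ.comp (dehom k)) (MvPolynomial.X k))) :
    awayHom (φ.comp (dehom k)) (MvPolynomial.X k) h = φ := by
  have h1 : (φ.comp (dehom k)) (MvPolynomial.X k) = 1 := by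
    rw [RingHom.comp_apply, dehom_X_self, map_one]
  ext x
  obtain ⟨F, rfl⟩ := dehom_surjective k x
  exact awayHom_dehom _ h1 F

/-- Every affine point of the chart `xₖ ≠ 0` has homogeneous coordinates with `xₖ = 1`. -/
lemma exists_eq_pt (q : Spec (CommRingCat.of B) ⟶ Proj (grading n)) (k : Fin (n + 1))
    (h : Set.range q ⊆ Proj.basicOpen (grading n) (MvPolynomial.X k)) :
    ∃ (f : MvPolynomial (Fin (n + 1)) ℂ →+* B) (hk : f (MvPolynomial.X k) = 1),
      q = pt f (X_mem k) one_pos (hk ▸ isUnit_one) := by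
  have hr : Set.range q ⊆ Set.range (Proj.awayι (grading n) _ (X_mem k) one_pos) := by
    have h1 := Proj.opensRange_awayι (grading n) _ (X_mem k) one_pos
    have h2 := congrArg (fun U : (Proj (grading n)).Opens => (U : Set (Proj (grading n)))) h1
    exact h.trans h2.ge
  obtain ⟨φ, hφ⟩ := Spec.map_surjective (IsOpenImmersion.lift _ q hr)
  refine ⟨φ.hom.comp (dehom k), by rw [RingHom.comp_apply, dehom_X_self, map_one], ?_⟩
  rw [pt, awayHom_comp_dehom]
  exact (IsOpenImmersion.lift_fac _ q hr).symm.trans (by rw [← hφ]; rfl)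

/-- Coordinates with `xₖ = 1` that are inverted by a substitution `σ` parametrize the chart
`xₖ ≠ 0`. -/
lemma pt_isOpenImmersion {k : Fin (n + 1)} (hk : f (MvPolynomial.X k) = 1)
    (σ : B →+* MvPolynomial (Fin (n + 1)) ℂ) (h1 : ∀ b, f (σ b) = b)
    (hC : ∀ c, σ (f (MvPolynomial.C c)) = MvPolynomial.C c)
    (h2 : ∀ i, i ≠ k → σ (f (MvPolynomial.X i)) = MvPolynomial.X i) :
    IsOpenImmersion (pt f (X_mem k) one_pos (hk ▸ isUnit_one)) ∧
      Set.range (pt f (X_mem k) one_pos (hk ▸ isUnit_one)) =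
        Proj.basicOpen (grading n) (MvPolynomial.X k) := by
  have h3 : (dehom k).comp (σ.comp f) = dehom k := by
    refine MvPolynomial.ringHom_ext (fun c => ?_) fun i => ?_
    · simp [hC]
    · by_cases hi : i = k
      · subst hi; simp [hk, dehom_X_self]
      · simp [h2 i hi]
  have hb : Function.Bijective (awayHom f (MvPolynomial.X k) (hk ▸ isUnit_one)) := by
    constructor
    · intro x y hxy
      obtain ⟨F, rfl⟩ := dehom_surjective k x
      obtain ⟨F', rfl⟩ := dehom_surjective k y
      rw [awayHom_dehom f hk, awayHom_dehom f hk] at hxy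
      have h4 := congrArg (fun φ => φ F) h3
      have h5 := congrArg (fun φ => φ F') h3
      simp only [RingHom.comp_apply] at h4 h5
      rw [← h4, ← h5, hxy]
    · exact fun b => ⟨dehom k (σ b), by rw [awayHom_dehom f hk, h1]⟩
  have : IsIso (CommRingCat.ofHom (awayHom f (MvPolynomial.X k) (hk ▸ isUnit_one))) :=
    (ConcreteCategory.isIso_iff_bijective _).2 hb
  rw [pt]
  refine ⟨inferInstance, ?_⟩
  have h4 : IsIso (Spec.map (CommRingCat.ofHom
    (awayHom f (MvPolynomial.X k) (hk ▸ isUnit_one)))) := inferInstance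
  rw [Scheme.Hom.comp_base, TopCat.coe_comp, Set.range_comp,
    Set.range_eq_univ.2 (Scheme.Hom.surjective _), Set.image_univ,
    ← Proj.opensRange_awayι (grading n) _ (X_mem k) one_pos]
  rfl

lemma awayHom_surjective {k : Fin (n + 1)} (hk : f (MvPolynomial.X k) = 1)
    (hf : Function.Surjective f) :
    Function.Surjective (awayHom f (MvPolynomial.X k) (hk ▸ isUnit_one)) := fun b => by
  obtain ⟨F, rfl⟩ := hf b
  exact ⟨_, awayHom_dehom f hk F⟩

end Points

lemma iSup_basicOpen_X (n : ℕ) :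
    ⨆ i : Fin (n + 1), Proj.basicOpen (grading n) (MvPolynomial.X i) = ⊤ := by
  refine Proj.iSup_basicOpen_eq_top' (grading n) _ (fun i => ⟨1, X_mem i⟩) ?_
  refine top_le_iff.1 fun F _ => ?_
  induction F using MvPolynomial.induction_on with
  | C c => exact Subalgebra.algebraMap_mem _ (⟨MvPolynomial.C c, by simp [grading]⟩ : grading n 0)
  | add p q hp hq => exact add_mem (hp trivial) (hq trivial)
  | mul_X p i hp => exact mul_mem (hp trivial) (Algebra.subset_adjoin ⟨i, rfl⟩)

lemma exists_mem_basicOpen_X {n : ℕ} (x : Proj (grading n)) :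
    ∃ i : Fin (n + 1), x ∈ Proj.basicOpen (grading n) (MvPolynomial.X i) := by
  have h : x ∈ (⊤ : (Proj (grading n)).Opens) := trivial
  rw [← iSup_basicOpen_X] at h
  simpa using h

lemma bijective_algebraMap_zero (n : ℕ) :
    Function.Bijective (algebraMap ℂ (grading n 0)) := by
  constructor
  · intro a b h
    exact MvPolynomial.C_injective _ _ (congrArg Subtype.val h)
  · rintro ⟨F, hF⟩
    obtain ⟨c, hc⟩ : ∃ c, F = MvPolynomial.C c := by
      refine ⟨F.coeff 0, ?_⟩
      rw [← MvPolynomial.totalDegree_eq_zero_iff_eq_C]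
      exact Nat.le_zero.1 ((MvPolynomial.mem_homogeneousSubmodule _ _).1 hF).totalDegree_le
    exact ⟨c, Subtype.ext hc.symm⟩

instance projSpace_isProper (n : ℕ) : IsProper (projSpace n).hom := by
  have h1 : IsIso (CommRingCat.ofHom (algebraMap ℂ (grading n 0))) :=
    (ConcreteCategory.isIso_iff_bijective _).2 (bijective_algebraMap_zero n)
  have h2 : Algebra.FiniteType (grading n 0) (MvPolynomial (Fin (n + 1)) ℂ) :=
    have : IsScalarTower ℂ (grading n 0) (MvPolynomial (Fin (n + 1)) ℂ) :=
      IsScalarTower.of_algebraMap_eq (R := ℂ) (S := grading n 0)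
        (A := MvPolynomial (Fin (n + 1)) ℂ) fun _ => rfl
    Algebra.FiniteType.of_restrictScalars_finiteType ℂ _ _
  have h3 : IsProper (Proj.toSpecZero (grading n)) := inferInstance
  have h4 : IsIso (Spec.map (CommRingCat.ofHom (algebraMap ℂ (grading n 0)))) := inferInstance
  have h5 : IsProper (Spec.map (CommRingCat.ofHom (algebraMap ℂ (grading n 0)))) := inferInstance
  exact MorphismProperty.comp_mem @IsProper _ _ h3 h5

/-! ### Scheme-theoretically dominant morphisms and gluing -/

section Gluing

open Limits

/-- Morphisms to a separated scheme which agree after composition with a scheme-theoretically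
dominant morphism are equal: their equalizer is a closed subscheme with trivial ideal. -/
lemma ext_of_schemeTheoreticallyDominant {W X Y : Scheme.{0}} (i : W ⟶ X)
    [IsSchemeTheoreticallyDominant i] [Y.IsSeparated] {f g : X ⟶ Y} (h : i ≫ f = i ≫ g) :
    f = g := by
  have h1 : (equalizer.ι f g).ker = ⊥ := by
    rw [← le_bot_iff, ← i.ker_eq_bot, ← equalizer.lift_ι i h]
    exact Scheme.Hom.le_ker_comp _ _
  have h2 : IsIso (equalizer.ι f g) := IsClosedImmersion.isIso_iff_ker_eq_bot.2 h1
  exact (cancel_epi (equalizer.ι f g)).1 (equalizer.condition f g)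

/-- A scheme-theoretically dominant morphism that factors through an open subscheme is also
dominant as a morphism to this subscheme, being a base change. -/
lemma schemeTheoreticallyDominant_of_comp_mono {T X W : Scheme.{0}} {η : T ⟶ X} {k : W ⟶ X}
    {e : T ⟶ W} [IsSchemeTheoreticallyDominant η] [QuasiCompact η] [IsOpenImmersion k]
    (h : e ≫ k = η) : IsSchemeTheoreticallyDominant e := by
  have H : IsPullback (𝟙 T) e η k := by
    refine ⟨⟨by simp [h]⟩, ⟨PullbackCone.IsLimit.mk _ (fun s => s.fst) (by simp)
      (fun s => ?_) (by simp +contextual)⟩⟩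
    rw [← cancel_mono k, Category.assoc, h, s.condition]
  exact .of_isPullback H

/-- Morphisms from the members of an open cover to a separated scheme glue if they agree on a
scheme-theoretically dense `T` contained in all of them. -/
lemma exists_glue {X Y T : Scheme.{0}} [Y.IsSeparated] {I : Type} (A : I → Scheme.{0})
    (κ : ∀ i, A i ⟶ X) [∀ i, IsOpenImmersion (κ i)] (hcov : ∀ x, ∃ i, x ∈ Set.range (κ i))
    (η : T ⟶ X) [IsSchemeTheoreticallyDominant η] [QuasiCompact η] (e : ∀ i, T ⟶ A i)
    (he : ∀ i, e i ≫ κ i = η) (f : ∀ i, A i ⟶ Y) (g : T ⟶ Y) (hf : ∀ i, e i ≫ f i = g) :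
    ∃ h : X ⟶ Y, ∀ i, κ i ≫ h = f i := by
  let 𝒰 : X.OpenCover := Scheme.Cover.mkOfCovers I A κ
    (fun x => by obtain ⟨i, y, hy⟩ := hcov x; exact ⟨i, y, hy⟩)
  refine ⟨𝒰.glueMorphisms f ?_, fun i => 𝒰.ι_glueMorphisms f _ i⟩
  suffices key : ∀ i j : I, pullback.fst (κ i) (κ j) ≫ f i = pullback.snd (κ i) (κ j) ≫ f j from
    key
  intro i j
  refine ext_of_schemeTheoreticallyDominant
    (pullback.snd η (pullback.fst (κ i) (κ j) ≫ κ i)) ?_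
  have h0 := pullback.condition (f := η) (g := pullback.fst (κ i) (κ j) ≫ κ i)
  have h1 : pullback.snd η (pullback.fst (κ i) (κ j) ≫ κ i) ≫ pullback.fst (κ i) (κ j) =
      pullback.fst _ _ ≫ e i := by
    rw [← cancel_mono (κ i), Category.assoc, Category.assoc, he]
    exact h0.symm
  have h2 : pullback.snd η (pullback.fst (κ i) (κ j) ≫ κ i) ≫ pullback.snd (κ i) (κ j) =
      pullback.fst _ _ ≫ e j := by
    rw [← cancel_mono (κ j), Category.assoc, Category.assoc, he, h0, pullback.condition]
  rw [reassoc_of% h1, reassoc_of% h2, hf, hf]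

instance {X Y : Scheme.{0}} (f : X ⟶ Y) [QuasiCompact f] :
    IsSchemeTheoreticallyDominant f.toImage := by
  refine ⟨Scheme.IdealSheafData.ext_of_iSup_eq_top
    (fun V : Y.affineOpens => ⟨f.imageι ⁻¹ᵁ V.1, V.2.preimage f.imageι⟩) ?_ fun V => ?_⟩
  · rw [← Scheme.Hom.preimage_iSup, iSup_affineOpens_eq_top, Scheme.Hom.preimage_top]
  · rw [Scheme.Hom.ker_apply, Scheme.IdealSheafData.ideal_bot, Pi.bot_apply,
      ← RingHom.injective_iff_ker_eq_bot]
    exact f.toImage_app_injective V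

/-- The part of the scheme-theoretic image of `f` in an open `A` through which `f` factors is
the closed subscheme `Z` of `A` if `f` factors through a scheme-theoretically dominant morphism
to `Z`. -/
lemma exists_chart_image {T Y A Z : Scheme.{0}} (f : T ⟶ Y) [QuasiCompact f] (j : A ⟶ Y)
    [IsOpenImmersion j] (c : Z ⟶ A) [IsClosedImmersion c] (z : T ⟶ Z)
    [IsSchemeTheoreticallyDominant z] (h : z ≫ c ≫ j = f) :
    ∃ κ : Z ⟶ f.image, IsOpenImmersion κ ∧ κ ≫ f.imageι = c ≫ j ∧ z ≫ κ = f.toImage ∧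
      Set.range κ = f.imageι ⁻¹' Set.range j := by
  let l : T ⟶ pullback f.imageι j := pullback.lift f.toImage (z ≫ c) (by simp [h])
  have hl : IsSchemeTheoreticallyDominant l :=
    schemeTheoreticallyDominant_of_comp_mono (k := pullback.fst f.imageι j)
      (pullback.lift_fst _ _ _)
  have hk : (pullback.snd f.imageι j).ker = c.ker := by
    have h1 : (l ≫ pullback.snd f.imageι j).ker = (z ≫ c).ker := by rw [pullback.lift_snd]
    rwa [Scheme.Hom.ker_comp, Scheme.Hom.ker_comp, l.ker_eq_bot, z.ker_eq_bot,
      Scheme.IdealSheafData.map_bot, Scheme.IdealSheafData.map_bot] at h1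
  have := IsClosedImmersion.isIso_lift (pullback.snd f.imageι j) c hk
  set m := IsClosedImmersion.lift (pullback.snd f.imageι j) c hk.le
  have hm : m ≫ pullback.snd f.imageι j = c := IsClosedImmersion.lift_fac _ _ _
  have hz : z ≫ m = l := by
    rw [← cancel_mono (pullback.snd f.imageι j), Category.assoc, hm, pullback.lift_snd]
  refine ⟨m ≫ pullback.fst _ _, inferInstance, ?_, ?_, ?_⟩
  · rw [Category.assoc, pullback.condition, reassoc_of% hm]
  · rw [reassoc_of% hz, pullback.lift_fst]
  · rw [Scheme.Hom.comp_base, TopCat.coe_comp, Set.range_comp,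
      Set.range_eq_univ.2 m.surjective, Set.image_univ, Scheme.Pullback.range_fst]

end Gluing

/-! ### Points given by homogeneous coordinates -/

section Coordinates

variable {n : ℕ} {A B : Type} [CommRing A] [Algebra ℂ A] [CommRing B] [Algebra ℂ B]

/-- Evaluation of polynomials at a vector with entries in a `ℂ`-algebra. -/
def coords (v : Fin (n + 1) → A) : MvPolynomial (Fin (n + 1)) ℂ →+* A :=
  (MvPolynomial.aeval v : MvPolynomial (Fin (n + 1)) ℂ →ₐ[ℂ] A).toRingHom

@[simp] lemma coords_X (v : Fin (n + 1) → A) (i : Fin (n + 1)) :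
    coords v (MvPolynomial.X i) = v i := MvPolynomial.aeval_X v i

@[simp] lemma coords_C (v : Fin (n + 1) → A) (c : ℂ) :
    coords v (MvPolynomial.C c) = algebraMap ℂ A c := MvPolynomial.aeval_C v c

lemma comp_coords (g : A →ₐ[ℂ] B) (v : Fin (n + 1) → A) :
    g.toRingHom.comp (coords v) = coords (g ∘ v) := by
  refine MvPolynomial.ringHom_ext (fun c => ?_) fun i => ?_ <;> simp

/-- The `A`-valued point `[v₀ : ⋯ : vₙ]` of `ℙⁿ`, where some coordinate `vₖ` is a unit. It does not
depend on the choice of `k`. -/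
def cpt (v : Fin (n + 1) → A) (k : Fin (n + 1)) (hk : IsUnit (v k)) :
    Spec (CommRingCat.of A) ⟶ (projSpace n).left :=
  pt (coords v) (X_mem k) one_pos (by rwa [coords_X])

lemma cpt_eq_of_mul {v w : Fin (n + 1) → A} {k l : Fin (n + 1)} (hk : IsUnit (v k))
    (hl : IsUnit (w l)) {u : A} (hu : IsUnit u) (h : ∀ i, w i = u * v i) :
    cpt v k hk = cpt w l hl :=
  pt_eq_of_X (coords v) _ _ _ _ _ (coords w) _ hu.unit (fun c => by simp)
    fun i => by simpa using h i

lemma SpecMap_cpt (g : A →ₐ[ℂ] B) (v : Fin (n + 1) → A) (k : Fin (n + 1)) (hk : IsUnit (v k)) :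
    Spec.map (CommRingCat.ofHom g.toRingHom) ≫ cpt v k hk = cpt (g ∘ v) k (hk.map g) := by
  refine (SpecMap_pt _ _ _ _ _).trans ?_
  simp only [comp_coords]
  rfl

lemma cpt_comp_hom (v : Fin (n + 1) → A) (k : Fin (n + 1)) (hk : IsUnit (v k)) :
    cpt v k hk ≫ (projSpace n).hom = Spec.map (CommRingCat.ofHom (algebraMap ℂ A)) := by
  refine (pt_comp_structure _ _ _ _).trans ?_
  congr 2
  ext c
  simp

lemma cpt_mem_basicOpen (v : Fin (n + 1) → A) (k : Fin (n + 1)) (hk : IsUnit (v k))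
    {F : MvPolynomial (Fin (n + 1)) ℂ} {d : ℕ} (hF : F ∈ grading n d) (hd : 0 < d)
    (x : Spec (CommRingCat.of A)) :
    cpt v k hk x ∈ Proj.basicOpen (grading n) F ↔ MvPolynomial.aeval v F ∉ x.asIdeal :=
  pt_mem_basicOpen _ _ _ _ hF hd x

lemma cpt_isOpenImmersion {v : Fin (n + 1) → A} {k : Fin (n + 1)} (hk : v k = 1)
    (σ : A →ₐ[ℂ] MvPolynomial (Fin (n + 1)) ℂ) (h1 : ∀ a, MvPolynomial.aeval v (σ a) = a)
    (h2 : ∀ i, i ≠ k → σ (v i) = MvPolynomial.X i) :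
    IsOpenImmersion (cpt v k (hk ▸ isUnit_one)) ∧
      ∀ x, x ∈ Set.range (cpt v k (hk ▸ isUnit_one)) ↔
        x ∈ Proj.basicOpen (grading n) (MvPolynomial.X k) := by
  refine (pt_isOpenImmersion (coords v) (by simpa using hk) σ.toRingHom h1 (fun c => ?_)
    fun i hi => ?_).imp_right fun h => Set.ext_iff.1 h
  · rw [coords_C]
    exact σ.commutes c
  · rw [coords_X]
    exact h2 i hi

/-- Affine points of the chart `xₖ ≠ 0`, as a scheme over `ℂ`, have coordinates. -/
lemma exists_eq_cpt (q : Spec (CommRingCat.of A) ⟶ (projSpace n).left)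
    (hq : q ≫ (projSpace n).hom = Spec.map (CommRingCat.ofHom (algebraMap ℂ A)))
    (k : Fin (n + 1))
    (h : ∀ x, q x ∈ Proj.basicOpen (grading n) (MvPolynomial.X k)) :
    ∃ (v : Fin (n + 1) → A) (hk : v k = 1), q = cpt v k (hk ▸ isUnit_one) := by
  obtain ⟨f, hk, rfl⟩ := exists_eq_pt q k (Set.range_subset_iff.2 h)
  replace hq := (pt_comp_structure f _ _ _).symm.trans hq
  have h1 : f.comp MvPolynomial.C = algebraMap ℂ A :=
    congrArg CommRingCat.Hom.hom (Spec.map_injective hq)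
  have h2 : f = coords (fun i => f (MvPolynomial.X i)) := by
    refine MvPolynomial.ringHom_ext (fun c => ?_) fun i => ?_
    · rw [coords_C, ← h1]; rfl
    · rw [coords_X]
  refine ⟨fun i => f (MvPolynomial.X i), hk, ?_⟩
  rw [cpt]
  congr 1

lemma isSchemeTheoreticallyDominant_SpecMap {R S : Type} [CommRing R] [CommRing S]
    {g : R →+* S} (hg : Function.Injective g) :
    IsSchemeTheoreticallyDominant (Spec.map (CommRingCat.ofHom g)) := by
  refine ⟨Scheme.IdealSheafData.ext_of_isAffine ?_⟩
  rw [Scheme.Hom.ker_apply, Scheme.IdealSheafData.ideal_bot, Pi.bot_apply,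
    ← RingHom.injective_iff_ker_eq_bot]
  have h := Scheme.ΓSpecIso_inv_naturality (CommRingCat.ofHom g)
  have h1 : (Spec.map (CommRingCat.ofHom g)).appTop = (Scheme.ΓSpecIso (CommRingCat.of R)).hom ≫
      CommRingCat.ofHom g ≫ (Scheme.ΓSpecIso (CommRingCat.of S)).inv := by
    rw [h, Iso.hom_inv_id_assoc]
  change Function.Injective (Spec.map (CommRingCat.ofHom g)).appTop.hom
  rw [h1]
  exact ((Scheme.ΓSpecIso (CommRingCat.of S)).symm.commRingCatIsoToRingEquiv.injective.comp
    hg).comp (Scheme.ΓSpecIso (CommRingCat.of R)).commRingCatIsoToRingEquiv.injective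

/-- The part in the chart `xₖ ≠ 0` of the closure of the image of `[e v₀ : ⋯ : e vₙ]`, where
`vₖ = 1`, is `Spec A` if `e` is injective on `A` and `A` is generated by the `vᵢ`. -/
lemma exists_chart_image_cpt {η : Spec (CommRingCat.of B) ⟶ (projSpace n).left}
    [QuasiCompact η]
    (v : Fin (n + 1) → A) (k : Fin (n + 1)) (hk : v k = 1)
    (hv : Function.Surjective (MvPolynomial.aeval v : MvPolynomial (Fin (n + 1)) ℂ →ₐ[ℂ] A))
    (e : A →ₐ[ℂ] B) (he : Function.Injective e)
    (h : cpt (e ∘ v) k ((hk ▸ isUnit_one : IsUnit (v k)).map e) = η) :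
    ∃ κ : Spec (CommRingCat.of A) ⟶ η.image, IsOpenImmersion κ ∧
      κ ≫ η.imageι = cpt v k (hk ▸ isUnit_one) ∧
      Spec.map (CommRingCat.ofHom e.toRingHom) ≫ κ = η.toImage ∧
      ∀ x, x ∈ Set.range κ ↔ η.imageι x ∈ Proj.basicOpen (grading n) (MvPolynomial.X k) := by
  have h0 : coords v (MvPolynomial.X k) = 1 := by simpa using hk
  have hc : IsClosedImmersion (Spec.map (CommRingCat.ofHom
      (awayHom (coords v) (MvPolynomial.X k) (h0 ▸ isUnit_one)))) :=
    IsClosedImmersion.spec_of_surjective _ (awayHom_surjective (coords v) h0 hv)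
  have hz : IsSchemeTheoreticallyDominant (Spec.map (CommRingCat.ofHom e.toRingHom)) :=
    isSchemeTheoreticallyDominant_SpecMap (g := e.toRingHom) he
  have hq : QuasiCompact (Y := Proj (grading n)) η := ‹_›
  obtain ⟨κ, h1, h2, h3, h4⟩ := exists_chart_image (Y := Proj (grading n)) η
    (Proj.awayι (grading n) (MvPolynomial.X k) (X_mem k) one_pos)
    (Spec.map (CommRingCat.ofHom (awayHom (coords v) (MvPolynomial.X k) (h0 ▸ isUnit_one))))
    (Spec.map (CommRingCat.ofHom e.toRingHom)) ((SpecMap_cpt e v k (hk ▸ isUnit_one)).trans h)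
  refine ⟨κ, h1, h2, h3, fun x => ?_⟩
  refine (Set.ext_iff.1 h4 x).trans ?_
  rw [← Proj.opensRange_awayι (grading n) _ (X_mem k) one_pos]
  rfl

end Coordinates

/-! ### Integrality and smoothness -/

instance isIntegral_image {X Y : Scheme.{0}} (f : X ⟶ Y) [IsIntegral X] [QuasiCompact f] :
    IsIntegral f.image := by
  have h1 : IsReduced f.image := IsSchemeTheoreticallyDominant.isReduced f.toImage
  have h2 : IrreducibleSpace f.image := by
    have : IsIrreducible (Set.univ : Set f.image) := by
      rw [← f.toImage.denseRange.closure_range, ← Set.image_univ]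
      exact ((irreducibleSpace_def X).1 inferInstance).image _
        f.toImage.continuous.continuousOn |>.closure
    exact (irreducibleSpace_def _).2 this
  exact isIntegral_of_irreducibleSpace_of_isReduced _

/-- Affine space is standard smooth: the differentials of the variables are a basis of the Kähler
differentials. -/
lemma isStandardSmoothOfRelativeDimension_mvPolynomial (n : ℕ) :
    Algebra.IsStandardSmoothOfRelativeDimension n ℂ (MvPolynomial (Fin n) ℂ) := by
  have h1 : Algebra.IsStandardSmooth ℂ (MvPolynomial (Fin n) ℂ) :=
    .of_basis_kaehlerDifferential (KaehlerDifferential.mvPolynomialBasis ℂ (Fin n)) (by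
      rintro _ ⟨i, rfl⟩
      exact ⟨MvPolynomial.X i, (KaehlerDifferential.mvPolynomialBasis_apply ℂ (Fin n) i).symm⟩)
  rw [Algebra.IsStandardSmoothOfRelativeDimension.iff_of_isStandardSmooth]
  rw [← (KaehlerDifferential.mvPolynomialBasis ℂ (Fin n)).mk_eq_rank'']
  simp

lemma smoothOfRelativeDimension_of_charts {X : Scheme.{0}} (f : X ⟶ SpecC) (n : ℕ) {I : Type}
    (κ : I → (Spec (CommRingCat.of (MvPolynomial (Fin n) ℂ)) ⟶ X))
    (h1 : ∀ i, IsOpenImmersion (κ i))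
    (hcov : ∀ x, ∃ i, x ∈ Set.range (κ i))
    (hf : ∀ i, κ i ≫ f = Spec.map (CommRingCat.ofHom (algebraMap ℂ (MvPolynomial (Fin n) ℂ)))) :
    SmoothOfRelativeDimension n f := by
  let 𝒰 : X.OpenCover := Scheme.Cover.mkOfCovers I
    (fun _ => Spec (CommRingCat.of (MvPolynomial (Fin n) ℂ))) κ
    (fun x => by obtain ⟨i, y, hy⟩ := hcov x; exact ⟨i, y, hy⟩)
  have : IsZariskiLocalAtSource (@SmoothOfRelativeDimension n) :=
    HasRingHomProperty.instIsZariskiLocalAtSource (P := @SmoothOfRelativeDimension n)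
      (Q := RingHom.Locally (RingHom.IsStandardSmoothOfRelativeDimension n))
  suffices key : ∀ i, SmoothOfRelativeDimension n (κ i ≫ f) from
    (IsZariskiLocalAtSource.iff_of_openCover (P := @SmoothOfRelativeDimension n) 𝒰).2 key
  intro i
  rw [hf, HasRingHomProperty.Spec_iff (P := @SmoothOfRelativeDimension n)
    (Q := RingHom.Locally (RingHom.IsStandardSmoothOfRelativeDimension n))]
  refine RingHom.locally_of RingHom.isStandardSmoothOfRelativeDimension_respectsIso _ ?_
  have := isStandardSmoothOfRelativeDimension_mvPolynomial n
  exact (RingHom.isStandardSmoothOfRelativeDimension_algebraMap ..).2 this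

/-! ### The two-dimensional torus and toric charts -/

/-- The coordinate ring of the affine plane. -/
abbrev PlaneRing : Type := MvPolynomial (Fin 2) ℂ

/-- The coordinate ring of the two-dimensional torus. -/
abbrev TorusRing : Type :=
  Localization.Away (MvPolynomial.X 0 * MvPolynomial.X 1 : PlaneRing)

namespace Torus

/-- The first coordinate on the torus. -/
def β : TorusRing := algebraMap PlaneRing TorusRing (MvPolynomial.X 0)

/-- The second coordinate on the torus. -/
def γ : TorusRing := algebraMap PlaneRing TorusRing (MvPolynomial.X 1)

lemma isUnit_mul : IsUnit (β * γ) := by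
  rw [β, γ, ← map_mul]
  exact IsLocalization.Away.algebraMap_isUnit _

/-- The inverse of `β`. -/
def β' : TorusRing := ↑(isUnit_of_mul_isUnit_left isUnit_mul).unit⁻¹

/-- The inverse of `γ`. -/
def γ' : TorusRing := ↑(isUnit_of_mul_isUnit_right isUnit_mul).unit⁻¹

lemma β_mul : β * β' = 1 := IsUnit.mul_val_inv _

lemma γ_mul : γ * γ' = 1 := IsUnit.mul_val_inv _

/-- Endomorphisms of the torus given by a pair of units. -/
def lift (b b' c c' : TorusRing) (hb : b * b' = 1) (hc : c * c' = 1) :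
    TorusRing →ₐ[ℂ] TorusRing :=
  IsLocalization.liftAlgHom (M := Submonoid.powers (MvPolynomial.X 0 * MvPolynomial.X 1 : PlaneRing))
    (f := MvPolynomial.aeval ![b, c]) (by
      rintro ⟨_, k, rfl⟩
      simp only [map_pow, map_mul, MvPolynomial.aeval_X, Matrix.cons_val_zero, Matrix.cons_val_one]
      exact ((IsUnit.of_mul_eq_one _ hb).mul (IsUnit.of_mul_eq_one _ hc)).pow k)

variable {b b' c c' : TorusRing} (hb : b * b' = 1) (hc : c * c' = 1)

lemma lift_β : lift b b' c c' hb hc β = b := by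
  simp [lift, β]

lemma lift_γ : lift b b' c c' hb hc γ = c := by
  simp [lift, γ]

lemma lift_β' : lift b b' c c' hb hc β' = b' := by
  have h := congrArg (lift b b' c c' hb hc) β_mul
  rw [map_mul, lift_β, map_one] at h
  exact (IsUnit.of_mul_eq_one _ hb).mul_left_cancel (h.trans hb.symm)

lemma lift_γ' : lift b b' c c' hb hc γ' = c' := by
  have h := congrArg (lift b b' c c' hb hc) γ_mul
  rw [map_mul, lift_γ, map_one] at h
  exact (IsUnit.of_mul_eq_one _ hc).mul_left_cancel (h.trans hc.symm)

lemma algebraMap_injective : Function.Injective (algebraMap PlaneRing TorusRing) :=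
  IsLocalization.injective (M := Submonoid.powers (MvPolynomial.X 0 * MvPolynomial.X 1 : PlaneRing))
    _ (powers_le_nonZeroDivisors_of_noZeroDivisors
      (mul_ne_zero (MvPolynomial.X_ne_zero _) (MvPolynomial.X_ne_zero _)))

instance : IsDomain TorusRing :=
  IsLocalization.isDomain_localization (powers_le_nonZeroDivisors_of_noZeroDivisors
    (mul_ne_zero (MvPolynomial.X_ne_zero _) (MvPolynomial.X_ne_zero _)))

/-- A monomial substitution is injective if it can be inverted on the torus. -/
lemma aeval_injective (v : Fin 2 → TorusRing) (r : TorusRing →ₐ[ℂ] TorusRing)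
    (h0 : r (v 0) = β) (h1 : r (v 1) = γ) :
    Function.Injective (MvPolynomial.aeval v : PlaneRing →ₐ[ℂ] TorusRing) := by
  have h : (r.comp (MvPolynomial.aeval v)) = IsScalarTower.toAlgHom ℂ PlaneRing TorusRing := by
    ext i
    fin_cases i
    · simpa [β] using h0
    · simpa [γ] using h1
  have h2 : Function.Injective (r.comp (MvPolynomial.aeval v)) := by
    rw [h]; exact algebraMap_injective
  exact Function.Injective.of_comp h2

end Torus

open Torus

lemma aeval_surjective {n : ℕ} (v : Fin n → PlaneRing) (h0 : ∃ i, v i = MvPolynomial.X 0)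
    (h1 : ∃ i, v i = MvPolynomial.X 1) :
    Function.Surjective (MvPolynomial.aeval v : MvPolynomial (Fin n) ℂ →ₐ[ℂ] PlaneRing) := by
  rw [← AlgHom.range_eq_top, ← top_le_iff, ← MvPolynomial.adjoin_range_X, Algebra.adjoin_le_iff]
  rintro _ ⟨i, rfl⟩
  obtain ⟨j0, h0⟩ := h0
  obtain ⟨j1, h1⟩ := h1
  fin_cases i
  · exact ⟨MvPolynomial.X j0, by simp [h0]⟩
  · exact ⟨MvPolynomial.X j1, by simp [h1]⟩

lemma isDominant_of_charts {X T : Scheme.{0}} {I : Type} (A : I → Scheme.{0})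
    (κ : ∀ i, A i ⟶ X)
    (hcov : ∀ x, ∃ i, x ∈ Set.range (κ i)) (η : T ⟶ X) (e : ∀ i, T ⟶ A i)
    [∀ i, IsDominant (e i)] (he : ∀ i, e i ≫ κ i = η) : IsDominant η := by
  refine ⟨fun x => ?_⟩
  obtain ⟨i, y, rfl⟩ := hcov x
  have h3 : y ∈ closure (Set.range (e i)) := (e i).denseRange y
  have h4 := image_closure_subset_closure_image (κ i).continuous (Set.mem_image_of_mem _ h3)
  rwa [← Set.range_comp, ← TopCat.coe_comp, ← Scheme.Hom.comp_base, he] at h4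

/-- A scheme covered by integral open charts in which a common integral scheme is dense is
integral. -/
lemma isIntegral_of_charts {X T : Scheme.{0}} [IsIntegral T] {I : Type} (A : I → Scheme.{0})
    [∀ i, IsIntegral (A i)] (κ : ∀ i, A i ⟶ X) [∀ i, IsOpenImmersion (κ i)]
    (hcov : ∀ x, ∃ i, x ∈ Set.range (κ i)) (η : T ⟶ X) (e : ∀ i, T ⟶ A i)
    [∀ i, IsDominant (e i)] (he : ∀ i, e i ≫ κ i = η) : IsIntegral X := by
  let 𝒰 : X.OpenCover := Scheme.Cover.mkOfCovers I A κ
    (fun x => by obtain ⟨i, y, hy⟩ := hcov x; exact ⟨i, y, hy⟩)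
  have h1 : IsReduced X := by
    have h : ∀ i, IsReduced (A i) := fun i => inferInstance
    have : ∀ i, IsReduced (𝒰.X i) := h
    exact IsReduced.of_openCover X 𝒰
  have h2 : DenseRange η := (isDominant_of_charts A κ hcov η e he).denseRange
  have h3 : IrreducibleSpace X := by
    have : IsIrreducible (Set.univ : Set X) := by
      rw [← h2.closure_range, ← Set.image_univ]
      exact ((irreducibleSpace_def T).1 inferInstance).image _
        η.continuous.continuousOn |>.closure
    exact (irreducibleSpace_def _).2 this
  exact isIntegral_of_irreducibleSpace_of_isReduced _

/-! ### The projective plane is a surface -/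

namespace Plane

/-- Homogeneous coordinates on the standard charts of the plane. -/
def coord : Fin 3 → Fin 3 → PlaneRing :=
  ![![1, MvPolynomial.X 0, MvPolynomial.X 1], ![MvPolynomial.X 0, 1, MvPolynomial.X 1],
    ![MvPolynomial.X 0, MvPolynomial.X 1, 1]]

lemma coord_self (i : Fin 3) : coord i i = 1 := by fin_cases i <;> rfl

/-- The standard charts of the plane. -/
def κ (i : Fin 3) : Spec (CommRingCat.of PlaneRing) ⟶ (projSpace 2).left :=
  cpt (coord i) i (coord_self i ▸ isUnit_one)

/-- Affine coordinates on the charts, as monomials on the torus, where `[1 : β : γ]` is the generic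
point. -/
def expo : Fin 3 → Fin 2 → TorusRing := ![![β, γ], ![β', γ * β'], ![γ', β * γ']]

/-- The inclusion of the torus in the charts, as a homomorphism of coordinate rings. -/
def e (i : Fin 3) : PlaneRing →ₐ[ℂ] TorusRing := MvPolynomial.aeval (expo i)

lemma e_injective (i : Fin 3) : Function.Injective (e i) := by
  fin_cases i
  · exact aeval_injective _ (AlgHom.id ℂ _) rfl rfl
  · refine aeval_injective _ (lift β' β (γ * β') (γ' * β) ?_ ?_) ?_ ?_
    · linear_combination β_mul
    · linear_combination γ * γ' * β_mul + γ_mul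
    · exact lift_β' _ _
    · change lift _ _ _ _ _ _ (γ * β') = γ
      rw [map_mul, lift_γ, lift_β']
      linear_combination γ * β_mul
  · refine aeval_injective _ (lift (γ * β') (γ' * β) β' β ?_ ?_) ?_ ?_
    · linear_combination γ * γ' * β_mul + γ_mul
    · linear_combination β_mul
    · exact lift_γ' _ _
    · change lift _ _ _ _ _ _ (β * γ') = γ
      rw [map_mul, lift_β, lift_γ']
      linear_combination γ * β_mul

lemma isOpenImmersion_κ_and (i : Fin 3) : IsOpenImmersion (κ i) ∧
    ∀ x, x ∈ Set.range (κ i) ↔ x ∈ Proj.basicOpen (grading 2) (MvPolynomial.X i) := by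
  fin_cases i
  · refine cpt_isOpenImmersion (coord_self 0)
      (MvPolynomial.aeval ![MvPolynomial.X 1, MvPolynomial.X 2]) (fun a => ?_) fun i hi => ?_
    · rw [← AlgHom.comp_apply]
      refine (congrArg (fun f : PlaneRing →ₐ[ℂ] PlaneRing => f a) ?_ : _ = AlgHom.id ℂ _ a)
      ext j; fin_cases j <;> simp [coord]
    · fin_cases i <;> simp [coord] at hi ⊢
  · refine cpt_isOpenImmersion (coord_self 1)
      (MvPolynomial.aeval ![MvPolynomial.X 0, MvPolynomial.X 2]) (fun a => ?_) fun i hi => ?_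
    · rw [← AlgHom.comp_apply]
      refine (congrArg (fun f : PlaneRing →ₐ[ℂ] PlaneRing => f a) ?_ : _ = AlgHom.id ℂ _ a)
      ext j; fin_cases j <;> simp [coord]
    · fin_cases i <;> simp [coord] at hi ⊢
  · refine cpt_isOpenImmersion (coord_self 2)
      (MvPolynomial.aeval ![MvPolynomial.X 0, MvPolynomial.X 1]) (fun a => ?_) fun i hi => ?_
    · rw [← AlgHom.comp_apply]
      refine (congrArg (fun f : PlaneRing →ₐ[ℂ] PlaneRing => f a) ?_ : _ = AlgHom.id ℂ _ a)
      ext j; fin_cases j <;> simp [coord]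
    · fin_cases i <;> simp [coord] at hi ⊢

instance isOpenImmersion_κ (i : Fin 3) : IsOpenImmersion (κ i) := (isOpenImmersion_κ_and i).1

lemma mem_range_κ (i : Fin 3) (x : (projSpace 2).left) :
    x ∈ Set.range (κ i) ↔ x ∈ Proj.basicOpen (grading 2) (MvPolynomial.X i) :=
  (isOpenImmersion_κ_and i).2 x

lemma exists_mem_range_κ (x : (projSpace 2).left) : ∃ i, x ∈ Set.range (κ i) := by
  obtain ⟨i, hi⟩ := exists_mem_basicOpen_X x
  exact ⟨i, (mem_range_κ i x).2 hi⟩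

/-- The inclusion of the torus in the plane. -/
def η : Spec (CommRingCat.of TorusRing) ⟶ (projSpace 2).left :=
  cpt ![1, β, γ] 0 (by simp)

lemma e_κ (i : Fin 3) : Spec.map (CommRingCat.ofHom (e i).toRingHom) ≫ κ i = η := by
  rw [κ, SpecMap_cpt]
  fin_cases i
  · refine cpt_eq_of_mul _ _ isUnit_one fun j => ?_
    fin_cases j <;> simp [coord, e, expo]
  · refine cpt_eq_of_mul _ _ (IsUnit.of_mul_eq_one _ β_mul) fun j => ?_
    fin_cases j <;> simp [coord, e, expo]
    · exact β_mul.symm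
    · linear_combination -γ * β_mul
  · refine cpt_eq_of_mul _ _ (IsUnit.of_mul_eq_one _ γ_mul) fun j => ?_
    fin_cases j <;> simp [coord, e, expo]
    · exact γ_mul.symm
    · linear_combination -β * γ_mul

end Plane

instance projSpace_isSeparated (n : ℕ) : (projSpace n).left.IsSeparated :=
  (inferInstance : (Proj (grading n)).IsSeparated)

lemma isSeparated_of_hom {X Y : Scheme.{0}} (f : X ⟶ Y) [Y.IsSeparated] [IsSeparated f] :
    X.IsSeparated := by
  rw [Scheme.isSeparated_iff, ← Limits.terminal.comp_from f, IsSeparated.comp_iff]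
  infer_instance

lemma isSmoothProjectiveSurface_plane : IsSmoothProjectiveSurface (projSpace 2) where
  integral := by
    have h (i : Fin 3) : IsDominant (Spec.map (CommRingCat.ofHom (Plane.e i).toRingHom)) := by
      have := isSchemeTheoreticallyDominant_SpecMap (g := (Plane.e i).toRingHom)
        (Plane.e_injective i)
      infer_instance
    exact isIntegral_of_charts _ Plane.κ Plane.exists_mem_range_κ Plane.η _ Plane.e_κ
  smooth := smoothOfRelativeDimension_of_charts _ 2 Plane.κ inferInstance
    Plane.exists_mem_range_κ fun i => cpt_comp_hom _ _ _
  projective := ⟨2, 𝟙 _, by rw [Over.id_left]; infer_instance⟩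

/-! ### The blowup of the plane at a point, as a scroll in `ℙ⁴` -/

namespace Scroll

/-- The coordinates in `ℙ⁴` of a point with Cox coordinates `(u₀, u₁; s, w)`. The Cox coordinates of
a point are unique up to the substitutions `(l u₀, l u₁; l⁻² m s, l⁻¹ m w)` with units `l` and `m`,
by which the coordinates in `ℙ⁴` are multiplied by `m`. The exceptional curve is `s = 0`. -/
def embV {B : Type} [CommRing B] (u : Fin 4 → B) : Fin 5 → B :=
  ![u 0 ^ 2 * u 2, u 0 * u 1 * u 2, u 1 ^ 2 * u 2, u 0 * u 3, u 1 * u 3]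

/-- The coordinates of the image in the plane. -/
def planeV {B : Type} [CommRing B] (u : Fin 4 → B) : Fin 3 → B := ![u 0 * u 2, u 1 * u 2, u 3]

/-- The coordinates of the image under the ruling. -/
def lineV {B : Type} [CommRing B] (u : Fin 4 → B) : Fin 2 → B := ![u 0, u 1]

/-- Cox coordinates `(u₀, u₁; s, w)` on the four charts, each a copy of the affine plane. On every
chart one of `u₀`, `u₁` and one of `s`, `w` is equal to `1`. -/
def cox : Fin 4 → Fin 4 → PlaneRing :=
  ![![1, MvPolynomial.X 0, 1, MvPolynomial.X 1], ![1, MvPolynomial.X 0, MvPolynomial.X 1, 1],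
    ![MvPolynomial.X 0, 1, 1, MvPolynomial.X 1], ![MvPolynomial.X 0, 1, MvPolynomial.X 1, 1]]

/-- Affine coordinates on the charts, as monomials on the torus. -/
def expo : Fin 4 → Fin 2 → TorusRing :=
  ![![β, γ], ![β, γ'], ![β', γ * β'], ![β', β * γ']]

/-- The inclusion of the torus in the charts, as a homomorphism of coordinate rings. -/
def e (i : Fin 4) : PlaneRing →ₐ[ℂ] TorusRing := MvPolynomial.aeval (expo i)

lemma e_injective (i : Fin 4) : Function.Injective (e i) := by
  fin_cases i
  · exact aeval_injective _ (AlgHom.id ℂ _) rfl rfl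
  · exact aeval_injective _ (lift β β' γ' γ β_mul ((mul_comm _ _).trans γ_mul)) (lift_β _ _)
      (lift_γ' _ _)
  · refine aeval_injective _ (lift β' β (γ * β') (γ' * β) ?_ ?_) ?_ ?_
    · linear_combination β_mul
    · linear_combination γ * γ' * β_mul + γ_mul
    · exact lift_β' _ _
    · change lift _ _ _ _ _ _ (γ * β') = γ
      rw [map_mul, lift_γ, lift_β']
      linear_combination γ * β_mul
  · refine aeval_injective _ (lift β' β (β' * γ') (β * γ) ?_ ?_) ?_ ?_
    · linear_combination β_mul
    · linear_combination γ * γ' * β_mul + γ_mul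
    · exact lift_β' _ _
    · change lift _ _ _ _ _ _ (β * γ') = γ
      rw [map_mul, lift_β, lift_γ']
      linear_combination γ * β_mul

/-- On each chart, a coordinate of `ℙ⁴` that is constant. -/
def embIdx : Fin 4 → Fin 5 := ![0, 3, 2, 4]

lemma embV_embIdx (i : Fin 4) : embV (cox i) (embIdx i) = 1 := by
  fin_cases i <;> simp [embV, cox, embIdx]

/-- On each chart, a coordinate of the plane that is constant. -/
def planeIdx : Fin 4 → Fin 3 := ![0, 2, 1, 2]

lemma planeV_planeIdx (i : Fin 4) : planeV (cox i) (planeIdx i) = 1 := by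
  fin_cases i <;> simp [planeV, cox, planeIdx]

/-- On each chart, a coordinate of the line that is constant. -/
def lineIdx : Fin 4 → Fin 2 := ![0, 0, 1, 1]

lemma lineV_lineIdx (i : Fin 4) : lineV (cox i) (lineIdx i) = 1 := by
  fin_cases i <;> simp [lineV, cox, lineIdx]

/-- The inclusion of the torus in `ℙ⁴`. -/
def η : Spec (CommRingCat.of TorusRing) ⟶ (projSpace 4).left :=
  cpt (embV ![1, β, 1, γ]) 0 (by simp [embV])

/-- The units `l` and `m` that take the Cox coordinates `(1, β; 1, γ)` of the generic point to those
of each chart. -/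
lemma cox_scale (i : Fin 4) : ∃ l m : TorusRing, IsUnit l ∧ IsUnit m ∧
    e i (cox i 0) = l ∧ e i (cox i 1) = l * β ∧ l ^ 2 * e i (cox i 2) = m ∧
      l * e i (cox i 3) = m * γ := by
  have hb : IsUnit β' := IsUnit.of_mul_eq_one_right _ β_mul
  have hc : IsUnit γ' := IsUnit.of_mul_eq_one_right _ γ_mul
  fin_cases i
  · exact ⟨1, 1, isUnit_one, isUnit_one, by simp [cox], by simp [cox, e, expo], by simp [cox],
      by simp [cox, e, expo]⟩
  · exact ⟨1, γ', isUnit_one, hc, by simp [cox], by simp [cox, e, expo],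
      by simp [cox, e, expo], by
        simp only [cox, e, expo]; simp; linear_combination -γ_mul⟩
  · exact ⟨β', β' ^ 2, hb, hb.pow 2, by simp [cox, e, expo], by
      simp [cox]; linear_combination -β_mul, by simp [cox], by
        simp [cox, e, expo]; ring⟩
  · exact ⟨β', β' * γ', hb, hb.mul hc, by simp [cox, e, expo], by
      simp [cox]; linear_combination -β_mul, by
        simp [cox, e, expo]; linear_combination β' * γ' * β_mul, by
        simp [cox]; linear_combination -β' * γ_mul⟩

lemma e_emb (i : Fin 4) (h : IsUnit ((e i ∘ embV (cox i)) (embIdx i))) :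
    cpt (e i ∘ embV (cox i)) (embIdx i) h = η := by
  obtain ⟨l, m, hl, hm, h0, h1, h2, h3⟩ := cox_scale i
  refine (cpt_eq_of_mul _ _ hm fun j => ?_).symm
  fin_cases j <;> simp [embV, h0, h1]
  · linear_combination h2
  · linear_combination β * h2
  · linear_combination β ^ 2 * h2
  · linear_combination h3
  · linear_combination β * h3

/-- The ruled surface `𝔽₁`, defined as the closure of the torus in `ℙ⁴`. It is a rational normal
scroll of degree three; being a closed subscheme, it is projective by construction. -/
def surface : Over SpecC := Over.mk (η.imageι ≫ (projSpace 4).hom)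

/-- The embedding of the surface in `ℙ⁴`. -/
def emb : surface ⟶ projSpace 4 := Over.homMk η.imageι rfl

/-- The inclusion of the torus in the surface. -/
def torus : Spec (CommRingCat.of TorusRing) ⟶ surface.left := η.toImage

lemma torus_emb : torus ≫ emb.left = η := η.toImage_imageι

instance : IsClosedImmersion emb.left := (inferInstance : IsClosedImmersion η.imageι)
instance : IsIntegral surface.left := (inferInstance : IsIntegral η.image)
instance : IsSchemeTheoreticallyDominant torus :=
  (inferInstance : IsSchemeTheoreticallyDominant η.toImage)
instance : IsProper surface.hom := (inferInstance : IsProper (emb.left ≫ (projSpace 4).hom))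
instance : surface.left.IsSeparated := isSeparated_of_hom surface.hom

lemma exists_κ (i : Fin 4) : ∃ κ : Spec (CommRingCat.of PlaneRing) ⟶ surface.left,
    IsOpenImmersion κ ∧ κ ≫ emb.left = cpt (embV (cox i)) (embIdx i)
      (embV_embIdx i ▸ isUnit_one) ∧
    Spec.map (CommRingCat.ofHom (e i).toRingHom) ≫ κ = torus ∧
      ∀ x, x ∈ Set.range κ ↔
        emb.left x ∈ Proj.basicOpen (grading 4) (MvPolynomial.X (embIdx i)) := by
  refine exists_chart_image_cpt (embV (cox i)) (embIdx i) (embV_embIdx i) ?_ (e i)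
    (e_injective i) (e_emb i _)
  refine aeval_surjective _ ?_ ?_
  · fin_cases i
    · exact ⟨1, by simp [embV, cox]⟩
    · exact ⟨4, by simp [embV, cox]⟩
    · exact ⟨1, by simp [embV, cox]⟩
    · exact ⟨3, by simp [embV, cox]⟩
  · fin_cases i
    · exact ⟨3, by simp [embV, cox]⟩
    · exact ⟨0, by simp [embV, cox]⟩
    · exact ⟨4, by simp [embV, cox]⟩
    · exact ⟨2, by simp [embV, cox]⟩

/-- The charts of the surface. -/
def κ (i : Fin 4) : Spec (CommRingCat.of PlaneRing) ⟶ surface.left := (exists_κ i).choose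

instance (i : Fin 4) : IsOpenImmersion (κ i) := (exists_κ i).choose_spec.1

lemma κ_emb (i : Fin 4) : κ i ≫ emb.left = cpt (embV (cox i)) (embIdx i)
    (embV_embIdx i ▸ isUnit_one) := (exists_κ i).choose_spec.2.1

lemma e_κ (i : Fin 4) : Spec.map (CommRingCat.ofHom (e i).toRingHom) ≫ κ i = torus :=
  (exists_κ i).choose_spec.2.2.1

lemma mem_range_κ (i : Fin 4) (x : surface.left) : x ∈ Set.range (κ i) ↔
    emb.left x ∈ Proj.basicOpen (grading 4) (MvPolynomial.X (embIdx i)) :=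
  (exists_κ i).choose_spec.2.2.2 x

lemma κ_hom (i : Fin 4) : κ i ≫ surface.hom =
    Spec.map (CommRingCat.ofHom (algebraMap ℂ PlaneRing)) := by
  rw [← Over.w emb, ← Category.assoc, κ_emb, cpt_comp_hom]

/-- The surface lies on the quadric `x₁² = x₀ x₂`, so the charts on which `x₀`, `x₂`, `x₃` or `x₄`
does not vanish cover it. -/
lemma emb_mem_quadric (x : surface.left) :
    emb.left x ∉ Proj.basicOpen (grading 4) (MvPolynomial.X 1 ^ 2 -
      MvPolynomial.X 0 * MvPolynomial.X 2) := by
  intro hx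
  obtain ⟨y, hy⟩ := torus.denseRange.exists_mem_open
    (emb.left ⁻¹ᵁ Proj.basicOpen (grading 4) (MvPolynomial.X 1 ^ 2 -
      MvPolynomial.X 0 * MvPolynomial.X 2)).2 ⟨x, hx⟩
  have hy' : (torus ≫ emb.left) y ∈ Proj.basicOpen (grading 4) (MvPolynomial.X 1 ^ 2 -
      MvPolynomial.X 0 * MvPolynomial.X 2) := hy
  rw [torus_emb, η, cpt_mem_basicOpen (d := 2)] at hy'
  · apply hy'
    have : (MvPolynomial.aeval (embV ![1, β, 1, γ])) (MvPolynomial.X 1 ^ 2 -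
      MvPolynomial.X 0 * MvPolynomial.X 2 : MvPolynomial (Fin 5) ℂ) = 0 := by
      simp [embV]
    rw [this]
    exact zero_mem _
  · have h2 := (MvPolynomial.isHomogeneous_X ℂ (1 : Fin 5)).pow 2
    have h3 := (MvPolynomial.isHomogeneous_X ℂ (0 : Fin 5)).mul
      (MvPolynomial.isHomogeneous_X ℂ (2 : Fin 5))
    exact h2.sub h3
  · exact two_pos

lemma exists_mem_range_κ (x : surface.left) : ∃ i, x ∈ Set.range (κ i) := by
  simp only [mem_range_κ]
  obtain ⟨k, hk⟩ := exists_mem_basicOpen_X (n := 4) (emb.left x)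
  have h := emb_mem_quadric x
  fin_cases k
  · exact ⟨0, hk⟩
  · refine ⟨0, fun h0 => h fun h1 => hk ?_⟩
    have h2 : MvPolynomial.X 1 ^ 2 ∈ (vanishingPolys (emb.left x)).toIdeal := by
      rw [← sub_add_cancel (MvPolynomial.X 1 ^ 2) (MvPolynomial.X 0 * MvPolynomial.X 2)]
      exact add_mem h1 (Ideal.mul_mem_right _ _ h0)
    exact (ProjectiveSpectrum.isPrime (show ProjectiveSpectrum (grading 4) from
      emb.left x)).mem_of_pow_mem 2 h2
  · exact ⟨2, hk⟩
  · exact ⟨1, hk⟩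
  · exact ⟨3, hk⟩

lemma isSmoothProjectiveSurface_surface : IsSmoothProjectiveSurface surface where
  integral := inferInstance
  smooth := smoothOfRelativeDimension_of_charts _ 2 κ inferInstance exists_mem_range_κ κ_hom
  projective := ⟨4, emb, inferInstance⟩

lemma e_plane (i : Fin 4) (h : IsUnit ((e i ∘ planeV (cox i)) (planeIdx i))) :
    cpt (e i ∘ planeV (cox i)) (planeIdx i) h = Plane.η := by
  obtain ⟨l, m, hl, hm, h0, h1, h2, h3⟩ := cox_scale i
  obtain ⟨l', hl'⟩ := hl.exists_right_inv
  refine (cpt_eq_of_mul _ _ (hm.mul (IsUnit.of_mul_eq_one_right _ hl')) fun j => ?_).symm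
  fin_cases j <;> simp [planeV, h0, h1]
  · linear_combination l' * h2 - l * e i (cox i 2) * hl'
  · linear_combination l' * β * h2 - l * β * e i (cox i 2) * hl'
  · linear_combination l' * h3 - e i (cox i 3) * hl'

lemma e_line (i : Fin 4) (h : IsUnit ((e i ∘ lineV (cox i)) (lineIdx i))) :
    cpt (e i ∘ lineV (cox i)) (lineIdx i) h = cpt ![1, β] 0 (by simp) := by
  obtain ⟨l, m, hl, hm, h0, h1, h2, h3⟩ := cox_scale i
  refine (cpt_eq_of_mul _ _ hl fun j => ?_).symm
  fin_cases j <;> simp [lineV, h0, h1]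

/-- Coordinates on the charts that agree on the torus define a morphism from the surface to `ℙⁿ`. -/
lemma exists_hom {n : ℕ} (v : Fin 4 → Fin (n + 1) → PlaneRing) (k : Fin 4 → Fin (n + 1))
    (hk : ∀ i, v i (k i) = 1) (g : Spec (CommRingCat.of TorusRing) ⟶ (projSpace n).left)
    (hg : ∀ i h, cpt (e i ∘ v i) (k i) h = g) :
    ∃ f : surface ⟶ projSpace n, ∀ i, κ i ≫ f.left = cpt (v i) (k i) (hk i ▸ isUnit_one) := by
  obtain ⟨f, hf⟩ := exists_glue _ κ exists_mem_range_κ torus _ e_κ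
    (fun i => cpt (v i) (k i) (hk i ▸ isUnit_one)) g fun i => by rw [SpecMap_cpt, hg]
  refine ⟨Over.homMk f (ext_of_schemeTheoreticallyDominant torus ?_), hf⟩
  rw [← e_κ 0, Category.assoc, Category.assoc, reassoc_of% hf 0, κ_hom, cpt_comp_hom]

/-- The contraction of the surface to the plane. -/
def π : surface ⟶ projSpace 2 :=
  (exists_hom _ _ planeV_planeIdx Plane.η e_plane).choose

lemma κ_π (i : Fin 4) : κ i ≫ π.left = cpt (planeV (cox i)) (planeIdx i)
    (planeV_planeIdx i ▸ isUnit_one) :=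
  (exists_hom _ _ planeV_planeIdx Plane.η e_plane).choose_spec i

/-- The ruling of the surface over the line. -/
def φ : surface ⟶ projSpace 1 :=
  (exists_hom _ _ lineV_lineIdx (cpt ![1, β] 0 (by simp)) e_line).choose

lemma κ_φ (i : Fin 4) : κ i ≫ φ.left = cpt (lineV (cox i)) (lineIdx i)
    (lineV_lineIdx i ▸ isUnit_one) :=
  (exists_hom _ _ lineV_lineIdx (cpt ![1, β] 0 (by simp)) e_line).choose_spec i

lemma torus_π : torus ≫ π.left = Plane.η := by
  rw [← e_κ 0, Category.assoc, κ_π, SpecMap_cpt, e_plane]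

lemma torus_φ : torus ≫ φ.left = cpt ![1, β] 0 (by simp) := by
  rw [← e_κ 0, Category.assoc, κ_φ, SpecMap_cpt, e_line]

end Scroll

/-! ### Ideal sheaves on affine schemes and effective Cartier divisors -/

section Ideals

variable {B B' : Type} [CommRing B] [CommRing B']

/-- The ideal of global sections of an ideal sheaf on an affine scheme. -/
def globalIdeal (J : (Spec (CommRingCat.of B)).IdealSheafData) : Ideal B :=
  (J.ideal ⟨⊤, isAffineOpen_top _⟩).comap (Scheme.ΓSpecIso (CommRingCat.of B)).inv.hom

lemma globalIdeal_le_iff {J K : (Spec (CommRingCat.of B)).IdealSheafData} :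
    globalIdeal J ≤ globalIdeal K ↔ J ≤ K := by
  constructor
  · intro h
    refine Scheme.IdealSheafData.le_of_isAffine fun x hx => ?_
    have h1 : (Scheme.ΓSpecIso (CommRingCat.of B)).inv.hom
        ((Scheme.ΓSpecIso (CommRingCat.of B)).hom.hom x) = x := by
      rw [← CommRingCat.comp_apply, Iso.hom_inv_id]; rfl
    have h2 := @h ((Scheme.ΓSpecIso (CommRingCat.of B)).hom.hom x)
      (by rw [globalIdeal, Ideal.mem_comap, h1]; exact hx)
    rwa [globalIdeal, Ideal.mem_comap, h1] at h2
  · exact fun h => Ideal.comap_mono (h _)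

lemma globalIdeal_injective {J K : (Spec (CommRingCat.of B)).IdealSheafData}
    (h : globalIdeal J = globalIdeal K) : J = K :=
  le_antisymm (globalIdeal_le_iff.1 h.le) (globalIdeal_le_iff.1 h.ge)

lemma globalIdeal_ker_SpecMap (g : B →+* B') :
    globalIdeal (Spec.map (CommRingCat.ofHom g)).ker = RingHom.ker g := by
  ext x
  rw [globalIdeal, Scheme.Hom.ker_apply, Ideal.mem_comap, RingHom.mem_ker, RingHom.mem_ker]
  have h := congrArg (fun f => f.hom x) (Scheme.ΓSpecIso_inv_naturality (CommRingCat.ofHom g))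
  change (Spec.map (CommRingCat.ofHom g)).appTop.hom _ = 0 ↔ _
  rw [← CommRingCat.comp_apply]
  change _ = ((Scheme.ΓSpecIso (CommRingCat.of B)).inv ≫
    (Spec.map (CommRingCat.ofHom g)).appTop) x at h
  rw [← h]
  change (Scheme.ΓSpecIso (CommRingCat.of B')).inv.hom (g x) = 0 ↔ _
  refine ⟨fun h0 => ?_, fun h0 => by rw [h0, map_zero]⟩
  have h1 : (Scheme.ΓSpecIso (CommRingCat.of B')).hom.hom
      ((Scheme.ΓSpecIso (CommRingCat.of B')).inv.hom (g x)) = g x := by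
    rw [← CommRingCat.comp_apply, Iso.inv_hom_id]; rfl
  rw [← h1, h0, map_zero]

/-- The ideal sheaf on `Spec B` defined by an ideal. -/
def sheafOfIdeal (K : Ideal B) : (Spec (CommRingCat.of B)).IdealSheafData :=
  (Spec.map (CommRingCat.ofHom (Ideal.Quotient.mk K))).ker

lemma globalIdeal_sheafOfIdeal (K : Ideal B) : globalIdeal (sheafOfIdeal K) = K := by
  rw [sheafOfIdeal, globalIdeal_ker_SpecMap, Ideal.mk_ker]

lemma sheafOfIdeal_globalIdeal (J : (Spec (CommRingCat.of B)).IdealSheafData) :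
    sheafOfIdeal (globalIdeal J) = J :=
  globalIdeal_injective (globalIdeal_sheafOfIdeal _)

lemma globalIdeal_le_iff' {J : (Spec (CommRingCat.of B)).IdealSheafData} {K : Ideal B} :
    globalIdeal J ≤ K ↔ J ≤ sheafOfIdeal K := by
  rw [← globalIdeal_le_iff, globalIdeal_sheafOfIdeal]

lemma globalIdeal_comap (J : (Spec (CommRingCat.of B)).IdealSheafData) (g : B →+* B') :
    globalIdeal (J.comap (Spec.map (CommRingCat.ofHom g))) = (globalIdeal J).map g := by
  refine eq_of_forall_ge_iff fun K => ?_
  rw [globalIdeal_le_iff', ← Scheme.IdealSheafData.le_map_iff_comap_le, sheafOfIdeal,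
    Scheme.IdealSheafData.map_ker, ← Spec.map_comp, ← CommRingCat.ofHom_comp,
    ← globalIdeal_le_iff, globalIdeal_ker_SpecMap, Ideal.map_le_iff_le_comap,
    ← RingHom.comap_ker, Ideal.mk_ker]

/-- The pullback of an ideal sheaf to an affine chart corresponds to its ideal of sections over the
image of the chart. -/
lemma globalIdeal_comap_of_isOpenImmersion {Y : Scheme.{0}} (J : Y.IdealSheafData)
    (j : Spec (CommRingCat.of B) ⟶ Y) [IsOpenImmersion j] :
    ∃ E : B ≃+* Γ(Y, j ''ᵁ ⊤), globalIdeal (J.comap j) =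
      (J.ideal ⟨j ''ᵁ ⊤, (isAffineOpen_top _).image_of_isOpenImmersion j⟩).comap E := by
  refine ⟨((Scheme.ΓSpecIso (CommRingCat.of B)).symm ≪≫
    (j.appIso ⊤).symm).commRingCatIsoToRingEquiv, ?_⟩
  rw [globalIdeal, Scheme.IdealSheafData.ideal_comap_of_isOpenImmersion, Ideal.comap_comap]
  rfl

lemma mem_nonZeroDivisors_map_equiv (E : B ≃+* B') {t : B} (ht : t ∈ nonZeroDivisors B) :
    E t ∈ nonZeroDivisors B' := by
  rw [mem_nonZeroDivisors_iff_right] at ht ⊢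
  intro x hx
  have h := ht (E.symm x) (E.injective (by rw [map_mul, E.apply_symm_apply, hx, map_zero]))
  rw [← E.apply_symm_apply x, h, map_zero]

/-- Effective Cartier divisors can be recognized on charts, whose coordinate rings need not be
rings of sections. -/
lemma isEffectiveCartier_of_charts {Y : Scheme.{0}} (J : Y.IdealSheafData)
    (h : ∀ y : Y, ∃ (B : Type) (_ : CommRing B) (j : Spec (CommRingCat.of B) ⟶ Y),
      IsOpenImmersion j ∧ y ∈ Set.range j ∧
        ∃ t ∈ nonZeroDivisors B, globalIdeal (J.comap j) = Ideal.span {t}) :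
    IsEffectiveCartier J := by
  intro y
  obtain ⟨B, _, j, hj, ⟨z, rfl⟩, t, ht, h1⟩ := h y
  obtain ⟨E, hE⟩ := globalIdeal_comap_of_isOpenImmersion J j
  refine ⟨⟨j ''ᵁ ⊤, (isAffineOpen_top _).image_of_isOpenImmersion j⟩, ⟨z, trivial, rfl⟩, E t,
    ?_, ?_⟩
  · exact mem_nonZeroDivisors_map_equiv E ht
  · rw [← Ideal.map_comap_of_surjective (E : B →+* _) E.surjective (J.ideal _)]
    change Ideal.map _ (Ideal.comap E _) = _
    rw [← hE, h1, Ideal.map_span, Set.image_singleton]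
    rfl

lemma IsEffectiveCartier.exists_chart {Y : Scheme.{0}} {J : Y.IdealSheafData}
    (h : IsEffectiveCartier J) (y : Y) :
    ∃ (B : Type) (_ : CommRing B) (j : Spec (CommRingCat.of B) ⟶ Y),
      IsOpenImmersion j ∧ y ∈ Set.range j ∧
        ∃ t ∈ nonZeroDivisors B, globalIdeal (J.comap j) = Ideal.span {t} := by
  obtain ⟨U, hy, h1⟩ := h y
  let j : Spec (CommRingCat.of Γ(Y, U.1)) ⟶ Y := U.2.fromSpec
  have hj : IsOpenImmersion j := U.2.isOpenImmersion_fromSpec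
  have hr : Set.range j = U.1 := U.2.range_fromSpec
  obtain ⟨E, hE⟩ := globalIdeal_comap_of_isOpenImmersion J j
  have hU : U = ⟨j ''ᵁ ⊤, (isAffineOpen_top _).image_of_isOpenImmersion j⟩ := by
    refine Subtype.ext (TopologicalSpace.Opens.ext ?_)
    rw [← hr]
    exact Set.image_univ.symm
  refine ⟨_, inferInstance, j, hj, by rw [hr]; exact hy, ?_⟩
  rw [hU] at h1
  obtain ⟨t, ht, h2⟩ := h1
  refine ⟨E.symm t, mem_nonZeroDivisors_map_equiv E.symm ht, ?_⟩
  rw [hE, h2]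
  ext x
  rw [Ideal.mem_comap, Ideal.mem_span_singleton, Ideal.mem_span_singleton]
  constructor
  · rintro ⟨c, hc⟩
    exact ⟨E.symm c, E.injective (by simpa using hc)⟩
  · rintro ⟨c, hc⟩
    exact ⟨E c, by simp [hc]⟩

/-- A point of an affine scheme where `s` does not vanish lies in the open subscheme `D(s)`. -/
lemma exists_localization_point (z : Spec (CommRingCat.of B)) {s : B} (hs : s ∉ z.asIdeal) :
    z ∈ Set.range (Spec.map (CommRingCat.ofHom (algebraMap B (Localization.Away s)))) := by
  have h := PrimeSpectrum.localization_away_comap_range (Localization.Away s) s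
  exact h.ge hs

lemma isOpenImmersion_localization (s : B) :
    IsOpenImmersion (Spec.map (CommRingCat.ofHom (algebraMap B (Localization.Away s)))) :=
  inferInstance

lemma algebraMap_mem_nonZeroDivisors {t : B} (ht : t ∈ nonZeroDivisors B) (s : B) :
    algebraMap B (Localization.Away s) t ∈ nonZeroDivisors (Localization.Away s) :=
  IsLocalization.map_nonZeroDivisors_le (Submonoid.powers s) _ ⟨t, ht, rfl⟩

end Ideals

/-! ### Equality of points -/

section Equality

variable {n : ℕ} {A : Type} [CommRing A] [Algebra ℂ A]

lemma eq_of_cpt_eq {v w : Fin (n + 1) → A} {k : Fin (n + 1)} (hv : v k = 1) (hw : w k = 1)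
    (h : cpt v k (hv ▸ isUnit_one) = cpt w k (hw ▸ isUnit_one)) : v = w := by
  have hv' : coords v (MvPolynomial.X k) = 1 := by simpa using hv
  have hw' : coords w (MvPolynomial.X k) = 1 := by simpa using hw
  have h1 : awayHom (coords v) (MvPolynomial.X k) (hv' ▸ isUnit_one) =
      awayHom (coords w) (MvPolynomial.X k) (hw' ▸ isUnit_one) :=
    congrArg CommRingCat.Hom.hom (Spec.map_injective
      ((cancel_mono (Proj.awayι (grading n) (MvPolynomial.X k) (X_mem k) one_pos)).1 h))
  ext i
  have h2 := awayHom_dehom (coords v) hv' (MvPolynomial.X i)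
  rw [h1, awayHom_dehom (coords w) hw', coords_X, coords_X] at h2
  exact h2.symm

/-- Homogeneous coordinates of the same point are proportional. -/
lemma mul_eq_of_cpt_eq {v w : Fin (n + 1) → A} {k l : Fin (n + 1)} {hk : IsUnit (v k)}
    {hl : IsUnit (w l)} (h : cpt v k hk = cpt w l hl) (i j : Fin (n + 1)) :
    v i * w j = v j * w i := by
  have hvl : IsUnit (v l) := by
    have h1 := (pt_range_subset_iff (coords w) (X_mem l) one_pos (by simpa using hl)
      (X_mem l) one_pos).2 (by simpa using hl)
    have h2 := (pt_range_subset_iff (coords v) (X_mem k) one_pos (by simpa using hk)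
      (X_mem l) one_pos).1 (by
        have h3 : pt (coords v) (X_mem k) one_pos (by simpa using hk) =
          pt (coords w) (X_mem l) one_pos (by simpa using hl) := h
        rwa [h3])
    simpa using h2
  obtain ⟨a, ha⟩ := hvl.exists_right_inv
  obtain ⟨b, hb⟩ := hl.exists_right_inv
  have ha' : a * v l = 1 := by rw [mul_comm]; exact ha
  have hb' : b * w l = 1 := by rw [mul_comm]; exact hb
  have h1 : (fun i => a * v i) = fun i => b * w i := by
    refine eq_of_cpt_eq (k := l) ha' hb' ?_
    rw [← cpt_eq_of_mul hk _ (IsUnit.of_mul_eq_one_right _ ha) (fun _ => rfl), h]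
    exact cpt_eq_of_mul _ _ (IsUnit.of_mul_eq_one_right _ hb) (fun _ => rfl)
  have h2 (i) : v i = v l * b * w i := by
    have := congrFun h1 i
    linear_combination v l * this - v i * ha
  rw [h2 i, h2 j]
  ring

end Equality

/-! ### The ideal of a point of the plane -/

namespace Plane

/-- The point `[0 : 0 : 1]`. -/
def point : SpecC ⟶ (projSpace 2).left := cpt (![0, 0, 1] : Fin 3 → ℂ) 2 (by simp)

lemma point_hom : point ≫ (projSpace 2).hom = 𝟙 _ := by
  refine (cpt_comp_hom _ _ _).trans ?_
  rw [Algebra.algebraMap_self]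
  exact Spec.map_id _

instance : IsClosedImmersion point := by
  have h : IsClosedImmersion (point ≫ (projSpace 2).hom) := by
    rw [point_hom]; infer_instance
  exact .of_comp point (projSpace 2).hom

variable {B : Type} [CommRing B] [Algebra ℂ B]

lemma SpecMap_point : Spec.map (CommRingCat.ofHom (algebraMap ℂ B)) ≫ point =
    cpt (![0, 0, 1] : Fin 3 → B) 2 (by simp) := by
  refine (SpecMap_cpt (Algebra.ofId ℂ B) _ _ _).trans (cpt_eq_of_mul _ _ isUnit_one fun j => ?_)
  fin_cases j <;> simp

/-- The inverse image of the ideal of `[0 : 0 : 1]` under `[v₀ : v₁ : v₂]` is `(v₀, v₁)`. -/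
lemma globalIdeal_comap_cpt (v : Fin 3 → B) (k : Fin 3) (hk : IsUnit (v k)) :
    globalIdeal (point.ker.comap (cpt v k hk)) = Ideal.span {v 0, v 1} := by
  have key (K : Ideal B) := SpecMap_cpt (Ideal.Quotient.mkₐ ℂ K) v k hk
  apply le_antisymm
  · rw [globalIdeal_le_iff', ← Scheme.IdealSheafData.le_map_iff_comap_le, sheafOfIdeal,
      Scheme.IdealSheafData.map_ker]
    set K := Ideal.span {v 0, v 1}
    have h0 : Ideal.Quotient.mk K (v 0) = 0 :=
      Ideal.Quotient.eq_zero_iff_mem.2 (Ideal.subset_span (by simp))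
    have h1 : Ideal.Quotient.mk K (v 1) = 0 :=
      Ideal.Quotient.eq_zero_iff_mem.2 (Ideal.subset_span (by simp))
    have h2 : IsUnit (Ideal.Quotient.mk K (v 2)) := by
      have h3 := hk.map (Ideal.Quotient.mk K)
      rcases subsingleton_or_nontrivial (B ⧸ K) with h4 | h4
      · exact isUnit_of_subsingleton _
      · fin_cases k
        · simp [h0] at h3
        · simp [h1] at h3
        · exact h3
    have h3 : Spec.map (CommRingCat.ofHom (Ideal.Quotient.mk K)) ≫ cpt v k hk =
        Spec.map (CommRingCat.ofHom (algebraMap ℂ (B ⧸ K))) ≫ point := by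
      refine (key K).trans ?_
      rw [SpecMap_point]
      refine (cpt_eq_of_mul _ _ h2 fun j => ?_).symm
      fin_cases j
      · simpa using h0
      · simpa using h1
      · simp
    rw [h3]
    exact Scheme.Hom.le_ker_comp _ _
  · set K := globalIdeal (point.ker.comap (cpt v k hk)) with hK
    have h1 : point.ker ≤
        (Spec.map (CommRingCat.ofHom (Ideal.Quotient.mk K)) ≫ cpt v k hk).ker := by
      rw [← Scheme.IdealSheafData.map_ker, Scheme.IdealSheafData.le_map_iff_comap_le,
        ← sheafOfIdeal, hK, sheafOfIdeal_globalIdeal]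
    have h2 := IsClosedImmersion.lift_fac point _ h1
    have h3 : IsClosedImmersion.lift point _ h1 =
        Spec.map (CommRingCat.ofHom (algebraMap ℂ (B ⧸ K))) := by
      rw [← Category.comp_id (IsClosedImmersion.lift point _ h1), ← point_hom,
        reassoc_of% h2, cpt_comp_hom, ← Spec.map_comp]
      rfl
    rw [h3, SpecMap_point] at h2
    have h4 := mul_eq_of_cpt_eq (h2.trans (key K))
    rw [Ideal.span_le]
    rintro _ (rfl | rfl)
    · have := h4 2 0
      simp at this
      exact Ideal.Quotient.eq_zero_iff_mem.1 this
    · have := h4 2 1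
      simp at this
      exact Ideal.Quotient.eq_zero_iff_mem.1 this

end Plane

/-! ### The universal property of the blowup -/

/-- Affine charts can be shrunk into a given open set. -/
lemma exists_smaller_chart {Y : Scheme.{0}} {B : Type} [CommRing B]
    (j : Spec (CommRingCat.of B) ⟶ Y) [IsOpenImmersion j] {y : Y} (hy : y ∈ Set.range j)
    (U : Y.Opens) (hU : y ∈ U) :
    ∃ s : B, y ∈ Set.range
      (Spec.map (CommRingCat.ofHom (algebraMap B (Localization.Away s))) ≫ j) ∧
      Set.range (Spec.map (CommRingCat.ofHom (algebraMap B (Localization.Away s))) ≫ j) ⊆ U := by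
  obtain ⟨z, rfl⟩ := hy
  obtain ⟨_, ⟨_, ⟨s, rfl⟩, rfl⟩, hz, hs⟩ := PrimeSpectrum.isBasis_basic_opens.exists_subset_of_mem_open
    (show z ∈ (j ⁻¹ᵁ U : Set _) from hU) (j ⁻¹ᵁ U).2
  refine ⟨s, ?_, ?_⟩
  · obtain ⟨z', hz'⟩ := exists_localization_point z hz
    exact ⟨z', by rw [Scheme.Hom.comp_apply, hz']⟩
  · rintro _ ⟨z', rfl⟩
    have h := PrimeSpectrum.localization_away_comap_range (Localization.Away s) s
    rw [Scheme.Hom.comp_apply]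
    exact hs (h.le ⟨z', rfl⟩)

lemma globalIdeal_localization {Y : Scheme.{0}} {B : Type} [CommRing B]
    (j : Spec (CommRingCat.of B) ⟶ Y) (J : Y.IdealSheafData) {t : B}
    (h : globalIdeal (J.comap j) = Ideal.span {t}) (s : B) :
    globalIdeal (J.comap (Spec.map (CommRingCat.ofHom (algebraMap B (Localization.Away s))) ≫ j)) =
      Ideal.span {algebraMap B (Localization.Away s) t} := by
  rw [Scheme.IdealSheafData.comap_comp, globalIdeal_comap, h, Ideal.map_span, Set.image_singleton]

lemma IsEffectiveCartier.comap {X Y : Scheme.{0}} {J : Y.IdealSheafData}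
    (h : IsEffectiveCartier J) (f : X ⟶ Y) [IsOpenImmersion f] :
    IsEffectiveCartier (J.comap f) := by
  refine isEffectiveCartier_of_charts _ fun x => ?_
  obtain ⟨B, _, j, hj, hy, t, ht, h1⟩ := h.exists_chart (f x)
  obtain ⟨s, hs, hs'⟩ := exists_smaller_chart j hy f.opensRange ⟨x, rfl⟩
  let j' := Spec.map (CommRingCat.ofHom (algebraMap B (Localization.Away s))) ≫ j
  have hl : IsOpenImmersion.lift f j' hs' ≫ f = j' := IsOpenImmersion.lift_fac f j' hs'
  have hj' : IsOpenImmersion j' := inferInstance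
  refine ⟨Localization.Away s, inferInstance, IsOpenImmersion.lift f j' hs', ?_, ?_,
    algebraMap B _ t, algebraMap_mem_nonZeroDivisors ht s, ?_⟩
  · have : IsOpenImmersion (IsOpenImmersion.lift f j' hs' ≫ f) := by rw [hl]; exact hj'
    exact .of_comp _ f
  · obtain ⟨z, hz⟩ := hs
    refine ⟨z, f.isOpenEmbedding.injective ?_⟩
    rw [← Scheme.Hom.comp_apply, hl, hz]
  · rw [← Scheme.IdealSheafData.comap_comp, hl]
    exact globalIdeal_localization j J h1 s

namespace Plane

/-- The affine points of the plane on which the ideal of `[0 : 0 : 1]` is visibly invertible. -/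
def IsLocalModel {B : Type} [CommRing B] [Algebra ℂ B]
    (q : Spec (CommRingCat.of B) ⟶ (projSpace 2).left) : Prop :=
  (∃ a b, q = cpt ![1, a, b] 0 (by simp)) ∨ (∃ a b, q = cpt ![a, 1, b] 1 (by simp)) ∨
    (∃ t ∈ nonZeroDivisors B, ∃ b, q = cpt ![t, t * b, 1] 2 (by simp)) ∨
      (∃ t ∈ nonZeroDivisors B, ∃ b, q = cpt ![t * b, t, 1] 2 (by simp))

lemma exists_eq_cpt_localization {B : Type} [CommRing B] {T : Scheme.{0}}
    (f : T ⟶ (projSpace 2).left) {y : T}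
    (j : Spec (CommRingCat.of B) ⟶ T) [IsOpenImmersion j] (hy : y ∈ Set.range j) :
    ∃ (s : B) (_ : Algebra ℂ (Localization.Away s)) (k : Fin 3)
      (v : Fin 3 → Localization.Away s) (hk : v k = 1),
      y ∈ Set.range
        (Spec.map (CommRingCat.ofHom (algebraMap B (Localization.Away s))) ≫ j) ∧
      Spec.map (CommRingCat.ofHom (algebraMap B (Localization.Away s))) ≫ j ≫ f =
        cpt v k (hk ▸ isUnit_one) := by
  obtain ⟨k, hk⟩ := exists_mem_basicOpen_X (n := 2) (f y)
  obtain ⟨s, hs, hs'⟩ := exists_smaller_chart j hy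
    (f ⁻¹ᵁ Proj.basicOpen (grading 2) (MvPolynomial.X k)) hk
  obtain ⟨α, hα⟩ := Spec.map_surjective
    ((Spec.map (CommRingCat.ofHom (algebraMap B (Localization.Away s))) ≫ j ≫ f) ≫
      (projSpace 2).hom)
  let _ : Algebra ℂ (Localization.Away s) := α.hom.toAlgebra
  obtain ⟨v, hv, h⟩ := exists_eq_cpt
    (Spec.map (CommRingCat.ofHom (algebraMap B (Localization.Away s))) ≫ j ≫ f) hα.symm k
    fun x => by
      have := hs' ⟨x, rfl⟩
      rwa [Scheme.Hom.comp_apply] at this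
  exact ⟨s, inferInstance, k, v, hv, hs, h⟩

/-- If the inverse image of the ideal of `[0 : 0 : 1]` is locally generated by a nonzerodivisor
`t`, the coordinates are locally of the shape required in the local models: near the given point,
`v₀ = t a` and `v₁ = t b`, where `a` or `b` is a unit. -/
lemma exists_isLocalModel {T : Scheme.{0}} (f : T ⟶ (projSpace 2).left)
    (hf : IsEffectiveCartier (point.ker.comap f)) (y : T) :
    ∃ (B : Type) (_ : CommRing B) (_ : Algebra ℂ B) (j : Spec (CommRingCat.of B) ⟶ T),
      IsOpenImmersion j ∧ y ∈ Set.range j ∧ IsLocalModel (j ≫ f) := by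
  obtain ⟨B, _, j, hj, hy, t, ht, h⟩ := hf.exists_chart y
  obtain ⟨s, _, k, v, hk, hy', hv⟩ := exists_eq_cpt_localization f j hy
  have h1 := globalIdeal_localization j _ h s
  replace ht := algebraMap_mem_nonZeroDivisors ht s
  set t' := algebraMap B (Localization.Away s) t
  set j' := Spec.map (CommRingCat.ofHom (algebraMap B (Localization.Away s))) ≫ j with hj'
  have hj'' : IsOpenImmersion j' := inferInstance
  replace hv : j' ≫ f = cpt v k (hk ▸ isUnit_one) := by rw [hj', Category.assoc, hv]
  rw [← Scheme.IdealSheafData.comap_comp, hv, globalIdeal_comap_cpt] at h1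
  fin_cases k
  · refine ⟨Localization.Away s, inferInstance, inferInstance, j', hj'', hy',
      .inl ⟨v 1, v 2, hv.trans ?_⟩⟩
    refine cpt_eq_of_mul _ _ isUnit_one fun i => ?_
    fin_cases i
    · exact (one_mul _).symm.trans (congrArg _ hk.symm)
    · simp
    · simp
  · refine ⟨Localization.Away s, inferInstance, inferInstance, j', hj'', hy',
      .inr (.inl ⟨v 0, v 2, hv.trans ?_⟩)⟩
    refine cpt_eq_of_mul _ _ isUnit_one fun i => ?_
    fin_cases i
    · simp
    · exact (one_mul _).symm.trans (congrArg _ hk.symm)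
    · simp
  · replace hk : v 2 = 1 := hk
    obtain ⟨a, ha⟩ : t' ∣ v 0 := Ideal.mem_span_singleton.1 (h1 ▸ Ideal.subset_span (by simp))
    obtain ⟨b, hb⟩ : t' ∣ v 1 := Ideal.mem_span_singleton.1 (h1 ▸ Ideal.subset_span (by simp))
    obtain ⟨c, d, hcd⟩ := Ideal.mem_span_pair.1
      (h1.symm ▸ Ideal.mem_span_singleton_self t' : t' ∈ Ideal.span {v 0, v 1})
    -- The generator `t` is a combination of its multiples `t a` and `t b`, so `a` and `b`
    -- generate the unit ideal.
    have h2 : c * a + d * b = 1 := by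
      have h3 := (mem_nonZeroDivisors_iff_right.1 ht) (c * a + d * b - 1)
        (by linear_combination hcd - c * ha - d * hb)
      linear_combination h3
    obtain ⟨z, hz⟩ := hy'
    have h3 : a ∉ z.asIdeal ∨ b ∉ z.asIdeal := by
      by_contra! h4
      refine z.isPrime.ne_top ((Ideal.eq_top_iff_one _).2 ?_)
      rw [← h2]
      exact add_mem (Ideal.mul_mem_left _ _ h4.1) (Ideal.mul_mem_left _ _ h4.2)
    have key (u : Localization.Away s) (hu : u ∉ z.asIdeal) :
        y ∈ Set.range (Spec.map (CommRingCat.ofHom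
          (algebraMap (Localization.Away s) (Localization.Away u))) ≫ j') := by
      obtain ⟨z', hz'⟩ := exists_localization_point z hu
      exact ⟨z', by rw [Scheme.Hom.comp_apply, hz', hz]⟩
    have key2 (u : Localization.Away s) := (SpecMap_cpt
      (IsScalarTower.toAlgHom ℂ (Localization.Away s) (Localization.Away u)) v 2
      (hk ▸ isUnit_one))
    have key3 (u : Localization.Away s) : (Spec.map (CommRingCat.ofHom
        (algebraMap (Localization.Away s) (Localization.Away u))) ≫ j') ≫ f =
        cpt (algebraMap (Localization.Away s) (Localization.Away u) ∘ v) 2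
          (by simp [hk]) := by
      rw [Category.assoc, hv]
      exact key2 u
    rcases h3 with h3 | h3
    · obtain ⟨a', ha'⟩ := (IsLocalization.Away.algebraMap_isUnit (S := Localization.Away a)
        a).exists_right_inv
      refine ⟨Localization.Away a, inferInstance, inferInstance, _,
        inferInstance, key a h3, .inr (.inr (.inl ⟨algebraMap _ _ (v 0), ?_,
          algebraMap _ _ b * a', (key3 a).trans ?_⟩))⟩
      · rw [ha, map_mul]
        exact mul_mem (algebraMap_mem_nonZeroDivisors ht a)
          (IsUnit.of_mul_eq_one _ ha').mem_nonZeroDivisors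
      · refine cpt_eq_of_mul _ _ isUnit_one fun i => ?_
        fin_cases i
        · simp
        · simp [ha, hb]
          linear_combination algebraMap _ (Localization.Away a) t' * algebraMap _ _ b * ha'
        · simp [hk]
    · obtain ⟨b', hb'⟩ := (IsLocalization.Away.algebraMap_isUnit (S := Localization.Away b)
        b).exists_right_inv
      refine ⟨Localization.Away b, inferInstance, inferInstance, _,
        inferInstance, key b h3, .inr (.inr (.inr ⟨algebraMap _ _ (v 1), ?_,
          algebraMap _ _ a * b', (key3 b).trans ?_⟩))⟩
      · rw [hb, map_mul]
        exact mul_mem (algebraMap_mem_nonZeroDivisors ht b)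
          (IsUnit.of_mul_eq_one _ hb').mem_nonZeroDivisors
      · refine cpt_eq_of_mul _ _ isUnit_one fun i => ?_
        fin_cases i
        · simp [ha, hb]
          linear_combination algebraMap _ (Localization.Away b) t' * algebraMap _ _ a * hb'
        · simp
        · simp [hk]

end Plane

namespace Scroll

open Plane

/-- On the local models, the lift to the blowup is given by Cox coordinates on one of the charts.
-/
lemma exists_lift {B : Type} [CommRing B] [Algebra ℂ B]
    {q : Spec (CommRingCat.of B) ⟶ (projSpace 2).left} (hq : IsLocalModel q) :
    ∃ g : Spec (CommRingCat.of B) ⟶ surface.left, g ≫ π.left = q := by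
  have key (i : Fin 4) (v : Fin 2 → B) : (Spec.map (CommRingCat.ofHom
      (MvPolynomial.aeval v : PlaneRing →ₐ[ℂ] B).toRingHom) ≫ κ i) ≫ π.left =
      cpt (MvPolynomial.aeval v ∘ planeV (cox i)) (planeIdx i)
        (by simp [planeV_planeIdx]) := by
    rw [Category.assoc, κ_π]
    exact SpecMap_cpt _ _ _ _
  rcases hq with ⟨a, b, rfl⟩ | ⟨a, b, rfl⟩ | ⟨t, -, b, rfl⟩ | ⟨t, -, b, rfl⟩
  · refine ⟨_, (key 0 ![a, b]).trans (cpt_eq_of_mul _ _ isUnit_one fun i => ?_)⟩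
    fin_cases i <;> simp [planeV, cox]
  · refine ⟨_, (key 2 ![a, b]).trans (cpt_eq_of_mul _ _ isUnit_one fun i => ?_)⟩
    fin_cases i <;> simp [planeV, cox]
  · refine ⟨_, (key 1 ![b, t]).trans (cpt_eq_of_mul _ _ isUnit_one fun i => ?_)⟩
    fin_cases i <;> simp [planeV, cox, mul_comm]
  · refine ⟨_, (key 3 ![b, t]).trans (cpt_eq_of_mul _ _ isUnit_one fun i => ?_)⟩
    fin_cases i <;> simp [planeV, cox, mul_comm]

lemma mem_range_κ_zero {x : surface.left}
    (hx : π.left x ∈ Proj.basicOpen (grading 2) (MvPolynomial.X 0)) : x ∈ Set.range (κ 0) := by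
  obtain ⟨i, y, rfl⟩ := exists_mem_range_κ x
  rw [mem_range_κ, ← Scheme.Hom.comp_apply, κ_emb, cpt_mem_basicOpen _ _ _ (X_mem _) one_pos]
  rw [← Scheme.Hom.comp_apply, κ_π, cpt_mem_basicOpen _ _ _ (X_mem _) one_pos] at hx
  intro h
  apply hx
  simp [embV, embIdx] at h
  simp [planeV]
  refine y.isPrime.mem_of_pow_mem 2 ?_
  have := Ideal.mul_mem_left _ (cox i 2) h
  convert this using 1
  ring

lemma mem_range_κ_two {x : surface.left}
    (hx : π.left x ∈ Proj.basicOpen (grading 2) (MvPolynomial.X 1)) : x ∈ Set.range (κ 2) := by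
  obtain ⟨i, y, rfl⟩ := exists_mem_range_κ x
  rw [mem_range_κ, ← Scheme.Hom.comp_apply, κ_emb, cpt_mem_basicOpen _ _ _ (X_mem _) one_pos]
  rw [← Scheme.Hom.comp_apply, κ_π, cpt_mem_basicOpen _ _ _ (X_mem _) one_pos] at hx
  intro h
  apply hx
  simp [embV, embIdx] at h
  simp [planeV]
  refine y.isPrime.mem_of_pow_mem 2 ?_
  have := Ideal.mul_mem_left _ (cox i 2) h
  convert this using 1
  ring

lemma κ_zero_π : κ 0 ≫ π.left = Plane.κ 0 := by
  rw [κ_π]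
  refine cpt_eq_of_mul _ _ isUnit_one fun i => ?_
  fin_cases i <;> simp [planeV, cox, coord]

lemma κ_two_π : κ 2 ≫ π.left = Plane.κ 1 := by
  rw [κ_π]
  refine cpt_eq_of_mul _ _ isUnit_one fun i => ?_
  fin_cases i <;> simp [planeV, cox, coord]

/-- The contraction is a monomorphism over any open set above which it is covered by one chart
that embeds in the plane. -/
lemma eq_of_comp_π {T : Scheme.{0}} {i : Fin 4} (hi : Mono (κ i ≫ π.left))
    {g g' : T ⟶ surface.left} (h : ∀ y, g y ∈ Set.range (κ i)) (h' : ∀ y, g' y ∈ Set.range (κ i))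
    (hg : g ≫ π.left = g' ≫ π.left) : g = g' := by
  rw [← IsOpenImmersion.lift_fac (κ i) g (Set.range_subset_iff.2 h),
    ← IsOpenImmersion.lift_fac (κ i) g' (Set.range_subset_iff.2 h')]
  congr 1
  rw [← cancel_mono (κ i ≫ π.left), IsOpenImmersion.lift_fac_assoc,
    IsOpenImmersion.lift_fac_assoc, hg]

lemma eq_of_comp_π_zero {T : Scheme.{0}} {g g' : T ⟶ surface.left}
    (h : ∀ y, (g ≫ π.left) y ∈ Proj.basicOpen (grading 2) (MvPolynomial.X 0))
    (hg : g ≫ π.left = g' ≫ π.left) : g = g' :=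
  eq_of_comp_π (i := 0) (by rw [κ_zero_π]; infer_instance)
    (fun y => mem_range_κ_zero (by rw [← Scheme.Hom.comp_apply]; exact h y))
    (fun y => mem_range_κ_zero (by rw [← Scheme.Hom.comp_apply, ← hg]; exact h y)) hg

lemma eq_of_comp_π_one {T : Scheme.{0}} {g g' : T ⟶ surface.left}
    (h : ∀ y, (g ≫ π.left) y ∈ Proj.basicOpen (grading 2) (MvPolynomial.X 1))
    (hg : g ≫ π.left = g' ≫ π.left) : g = g' :=
  eq_of_comp_π (i := 2) (by rw [κ_two_π]; infer_instance)
    (fun y => mem_range_κ_two (by rw [← Scheme.Hom.comp_apply]; exact h y))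
    (fun y => mem_range_κ_two (by rw [← Scheme.Hom.comp_apply, ← hg]; exact h y)) hg

end Scroll

namespace Scroll

open Plane

lemma cpt_mem_of_isUnit {B : Type} [CommRing B] [Algebra ℂ B] {n : ℕ} {v : Fin (n + 1) → B}
    {k l : Fin (n + 1)} {hk : IsUnit (v k)} (hl : IsUnit (v l)) (y : Spec (CommRingCat.of B)) :
    cpt v k hk y ∈ Proj.basicOpen (grading n) (MvPolynomial.X l) := by
  rw [cpt_mem_basicOpen _ _ _ (X_mem _) one_pos, MvPolynomial.aeval_X]
  exact fun h => y.isPrime.ne_top (Ideal.eq_top_of_isUnit_mem _ h hl)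

/-- Lifts to the blowup are unique: away from the divisor `t = 0` the contraction is a
monomorphism, and the complement of this divisor is scheme-theoretically dense. -/
lemma eq_of_isLocalModel {B : Type} [CommRing B] [Algebra ℂ B]
    {g g' : Spec (CommRingCat.of B) ⟶ surface.left} (hq : IsLocalModel (g ≫ π.left))
    (h : g ≫ π.left = g' ≫ π.left) : g = g' := by
  have key (t : B) (ht : t ∈ nonZeroDivisors B) : IsSchemeTheoreticallyDominant
      (Spec.map (CommRingCat.ofHom (algebraMap B (Localization.Away t)))) :=
    isSchemeTheoreticallyDominant_SpecMap (IsLocalization.injective (M := Submonoid.powers t) _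
      (Submonoid.powers_le.2 ht))
  have key2 (t : B) (v : Fin 3 → B) (hv : v 2 = 1) (h1 : g ≫ π.left = cpt v 2 (hv ▸ isUnit_one)) :
      (Spec.map (CommRingCat.ofHom (algebraMap B (Localization.Away t))) ≫ g) ≫ π.left =
        cpt (algebraMap B (Localization.Away t) ∘ v) 2 (by simp [hv]) := by
    rw [Category.assoc, h1]
    exact SpecMap_cpt (IsScalarTower.toAlgHom ℂ B (Localization.Away t)) _ _ _
  rcases hq with ⟨a, b, hq⟩ | ⟨a, b, hq⟩ | ⟨t, ht, b, hq⟩ | ⟨t, ht, b, hq⟩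
  · refine eq_of_comp_π_zero (fun y => ?_) h
    rw [hq]
    exact cpt_mem_of_isUnit (by simp) y
  · refine eq_of_comp_π_one (fun y => ?_) h
    rw [hq]
    exact cpt_mem_of_isUnit (by simp) y
  · have := key t ht
    refine ext_of_schemeTheoreticallyDominant
      (Spec.map (CommRingCat.ofHom (algebraMap B (Localization.Away t))))
      (eq_of_comp_π_zero (fun y => ?_) (by rw [Category.assoc, Category.assoc, h]))
    rw [key2 t _ (by simp) hq]
    exact cpt_mem_of_isUnit (IsLocalization.Away.algebraMap_isUnit t) y
  · have := key t ht
    refine ext_of_schemeTheoreticallyDominant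
      (Spec.map (CommRingCat.ofHom (algebraMap B (Localization.Away t))))
      (eq_of_comp_π_one (fun y => ?_) (by rw [Category.assoc, Category.assoc, h]))
    rw [key2 t _ (by simp) hq]
    exact cpt_mem_of_isUnit (IsLocalization.Away.algebraMap_isUnit t) y

lemma eq_of_isEffectiveCartier {T : Scheme.{0}} {g g' : T ⟶ surface.left}
    (hT : IsEffectiveCartier (point.ker.comap (g ≫ π.left))) (h : g ≫ π.left = g' ≫ π.left) :
    g = g' := by
  choose B _ _ j hj hy hq using exists_isLocalModel _ hT
  let 𝒰 : T.OpenCover := Scheme.Cover.mkOfCovers T (fun y => Spec (CommRingCat.of (B y))) j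
    (fun y => by obtain ⟨z, hz⟩ := hy y; exact ⟨y, z, hz⟩)
  have key : ∀ y : T, j y ≫ g = j y ≫ g' := fun y => eq_of_isLocalModel
    (by rw [Category.assoc]; exact hq y) (by rw [Category.assoc, Category.assoc, h])
  exact Scheme.Cover.hom_ext 𝒰 _ _ key

/-- On every chart, the exceptional curve is defined by the Cox coordinate `s`. -/
lemma isEffectiveCartier_π : IsEffectiveCartier (point.ker.comap π.left) := by
  refine isEffectiveCartier_of_charts _ fun y => ?_
  obtain ⟨i, hi⟩ := exists_mem_range_κ y
  refine ⟨_, inferInstance, κ i, inferInstance, hi, cox i 2, ?_, ?_⟩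
  · refine mem_nonZeroDivisors_of_ne_zero ?_
    fin_cases i <;> simp [cox]
  · rw [← Scheme.IdealSheafData.comap_comp, κ_π, globalIdeal_comap_cpt]
    have h : cox i 0 = 1 ∨ cox i 1 = 1 := by fin_cases i <;> simp [cox]
    apply le_antisymm
    · rw [Ideal.span_le]
      rintro _ (rfl | rfl)
      · exact Ideal.mem_span_singleton.2 ⟨cox i 0, by simp [planeV, mul_comm]⟩
      · exact Ideal.mem_span_singleton.2 ⟨cox i 1, by simp [planeV, mul_comm]⟩
    · rw [Ideal.span_singleton_le_iff_mem]
      rcases h with h | h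
      · exact Ideal.subset_span (.inl (by simp [planeV, h]))
      · exact Ideal.subset_span (.inr (by simp [planeV, h]))

/-- The surface is the blowup of the plane at `[0 : 0 : 1]`. -/
lemma isBlowup_π : IsBlowup π.left point.ker := by
  refine ⟨isEffectiveCartier_π, fun T f hf => ?_⟩
  refine existsUnique_of_exists_of_unique ?_ fun g g' hg hg' =>
    eq_of_isEffectiveCartier (hg ▸ hf) (hg.trans hg'.symm)
  choose B _ _ j hj hy hq using exists_isLocalModel _ hf
  choose g hg using fun y => exists_lift (hq y)
  let 𝒰 : T.OpenCover := Scheme.Cover.mkOfCovers T (fun y => Spec (CommRingCat.of (B y))) j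
    (fun y => by obtain ⟨z, hz⟩ := hy y; exact ⟨y, z, hz⟩)
  have key : ∀ y y' : T, Limits.pullback.fst (j y) (j y') ≫ g y =
      Limits.pullback.snd (j y) (j y') ≫ g y' := by
    intro y y'
    have h1 : (Limits.pullback.fst (j y) (j y') ≫ g y) ≫ π.left =
        (Limits.pullback.fst (j y) (j y') ≫ j y) ≫ f := by
      rw [Category.assoc, Category.assoc, hg]
    have h2 : (Limits.pullback.snd (j y) (j y') ≫ g y') ≫ π.left =
        (Limits.pullback.fst (j y) (j y') ≫ j y) ≫ f := by
      rw [Limits.pullback.condition, Category.assoc, Category.assoc, hg]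
    refine eq_of_isEffectiveCartier ?_ (h1.trans h2.symm)
    rw [h1, Scheme.IdealSheafData.comap_comp]
    exact hf.comap _
  refine ⟨𝒰.glueMorphisms g key, Scheme.Cover.hom_ext 𝒰 _ _ fun y => ?_⟩
  rw [← Category.assoc]
  exact (congrArg (· ≫ π.left) (Scheme.Cover.ι_glueMorphisms 𝒰 g key y)).trans (hg y)

end Scroll

/-! ### Charts of the fibres of the ruling -/

namespace Line

variable {A B : Type} [CommRing A] [Algebra ℂ A] [CommRing B] [Algebra ℂ B]

/-- Homogeneous coordinates on the standard charts of the line. -/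
def coord (k : Fin 2) (b : A) : Fin 2 → A := ![![1, b], ![b, 1]] k

lemma coord_self (k : Fin 2) (b : A) : coord k b k = 1 := by
  fin_cases k <;> rfl

lemma isUnit_coord (k : Fin 2) (b : A) : IsUnit (coord k b k) := coord_self k b ▸ isUnit_one

lemma comp_coord (g : A →ₐ[ℂ] B) (k : Fin 2) (b : A) : g ∘ coord k b = coord k (g b) := by
  funext i
  fin_cases k <;> fin_cases i <;> simp [coord]

lemma exists_eq_coord (k : Fin 2) (v : Fin 2 → A) (hv : v k = 1) : ∃ b, v = coord k b := by
  fin_cases k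
  · refine ⟨v 1, funext fun i => ?_⟩
    fin_cases i
    · exact hv
    · rfl
  · refine ⟨v 0, funext fun i => ?_⟩
    fin_cases i
    · rfl
    · exact hv

lemma eq_of_mul_coord {k : Fin 2} {b c : A}
    (h : ∀ i j, coord k b i * coord k c j = coord k b j * coord k c i) : b = c := by
  have := h 0 1
  fin_cases k
  · simpa [coord, eq_comm] using this
  · simpa [coord] using this

lemma cpt_hom {n : ℕ} (v : Fin (n + 1) → ℂ) (k : Fin (n + 1)) (hk : IsUnit (v k)) :
    cpt v k hk ≫ (projSpace n).hom = 𝟙 _ := by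
  rw [cpt_comp_hom]
  exact Spec.map_id _

lemma isClosedImmersion_cpt {n : ℕ} (v : Fin (n + 1) → ℂ) (k : Fin (n + 1)) (hk : IsUnit (v k)) :
    IsClosedImmersion (cpt v k hk) := by
  have : IsClosedImmersion (cpt v k hk ≫ (projSpace n).hom) := by
    rw [cpt_hom]; infer_instance
  exact IsClosedImmersion.of_comp _ (projSpace n).hom

/-- The inverse image of the ideal of a point `b` of the line under the point `x` is `(x - b)`. -/
lemma globalIdeal_comap_cpt (k : Fin 2) (b : ℂ) (x : B) :
    globalIdeal ((cpt (coord k b) k (isUnit_coord k b)).ker.comap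
      (cpt (coord k x) k (isUnit_coord k x))) = Ideal.span {x - algebraMap ℂ B b} := by
  have := isClosedImmersion_cpt (coord k b) k (isUnit_coord k b)
  have key (K : Ideal B) : Spec.map (CommRingCat.ofHom (Ideal.Quotient.mk K)) ≫
      cpt (coord k x) k (isUnit_coord k x) = cpt (coord k (Ideal.Quotient.mk K x)) k
        (isUnit_coord k _) := by
    refine (SpecMap_cpt (Ideal.Quotient.mkₐ ℂ K) _ k (isUnit_coord k x)).trans ?_
    congr 1
    exact comp_coord _ _ _
  have key' (K : Ideal B) : Spec.map (CommRingCat.ofHom (algebraMap ℂ (B ⧸ K))) ≫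
      cpt (coord k b) k (isUnit_coord k b) = cpt (coord k (algebraMap ℂ (B ⧸ K) b)) k
        (isUnit_coord k _) := by
    refine (SpecMap_cpt (Algebra.ofId ℂ (B ⧸ K)) _ k (isUnit_coord k b)).trans ?_
    congr 1
    exact comp_coord _ _ _
  apply le_antisymm
  · rw [globalIdeal_le_iff', ← Scheme.IdealSheafData.le_map_iff_comap_le, sheafOfIdeal,
      Scheme.IdealSheafData.map_ker]
    set K := Ideal.span {x - algebraMap ℂ B b}
    have h0 : Ideal.Quotient.mk K x = algebraMap ℂ (B ⧸ K) b :=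
      Ideal.Quotient.eq.2 (Ideal.subset_span rfl)
    have h3 := key K
    rw [h0, ← key'] at h3
    rw [h3]
    exact Scheme.Hom.le_ker_comp _ _
  · set K := globalIdeal ((cpt (coord k b) k (isUnit_coord k b)).ker.comap
      (cpt (coord k x) k (isUnit_coord k x))) with hK
    have h1 : (cpt (coord k b) k (isUnit_coord k b)).ker ≤
        (Spec.map (CommRingCat.ofHom (Ideal.Quotient.mk K)) ≫
          cpt (coord k x) k (isUnit_coord k x)).ker := by
      rw [← Scheme.IdealSheafData.map_ker, Scheme.IdealSheafData.le_map_iff_comap_le,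
        ← sheafOfIdeal, hK, sheafOfIdeal_globalIdeal]
    have h2 := IsClosedImmersion.lift_fac _ _ h1
    have h3 : IsClosedImmersion.lift _ _ h1 =
        Spec.map (CommRingCat.ofHom (algebraMap ℂ (B ⧸ K))) := by
      rw [← Category.comp_id (IsClosedImmersion.lift _ _ h1),
        ← cpt_hom (coord k b) k (isUnit_coord k b),
        reassoc_of% h2, cpt_comp_hom, ← Spec.map_comp]
      rfl
    rw [h3, key', key] at h2
    have h4 := eq_of_mul_coord (mul_eq_of_cpt_eq h2.symm)
    rw [Ideal.span_le, Set.singleton_subset_iff]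
    exact Ideal.Quotient.eq.1 h4

end Line

/-- Closed points of projective space have complex coordinates. -/
lemma exists_eq_cpt_of_isClosed {n : ℕ} {t : (projSpace n).left} (ht : IsClosed {t})
    (k : Fin (n + 1)) (hk : t ∈ Proj.basicOpen (grading n) (MvPolynomial.X k)) :
    ∃ (v : Fin (n + 1) → ℂ) (hv : v k = 1),
      (cpt v k (hv ▸ isUnit_one)).ker = ((projSpace n).left.fromSpecResidueField t).ker ∧
      ∀ x, cpt v k (hv ▸ isUnit_one) x = t := by
  obtain ⟨v, hv, h⟩ := exists_eq_cpt (A := ℂ) (pointOfClosedPoint (projSpace n).hom t ht)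
    ((pointOfClosedPoint_comp _ t ht).trans (Spec.map_id _).symm) k
    (fun x => by rw [pointOfClosedPoint_apply]; exact hk)
  refine ⟨v, hv, ?_, fun x => ?_⟩
  · rw [← h]
    exact Scheme.Hom.ker_comp_of_isIso _ _
  · rw [← h, pointOfClosedPoint_apply]

namespace Scroll

/-- The two charts of the surface over each of the standard charts of the line: `s = 1` and `w = 1`.
-/
def lineChart : Fin 2 → Fin 2 → Fin 4 := ![![0, 1], ![2, 3]]

lemma lineV_lineChart (k j : Fin 2) :
    lineV (cox (lineChart k j)) = Line.coord k (MvPolynomial.X 0) := by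
  funext i
  fin_cases k <;> fin_cases j <;> fin_cases i <;> rfl

lemma κ_φ' (k j : Fin 2) : κ (lineChart k j) ≫ φ.left =
    cpt (Line.coord k (MvPolynomial.X 0)) k (Line.isUnit_coord k _) := by
  refine (κ_φ _).trans ?_
  have h : lineIdx (lineChart k j) = k := by
    fin_cases k <;> fin_cases j <;> rfl
  simp only [lineV_lineChart, h]

lemma exists_mem_range_κ_of_φ {x : surface.left} {k : Fin 2}
    (hx : φ.left x ∈ Proj.basicOpen (grading 1) (MvPolynomial.X k)) :
    ∃ j, x ∈ Set.range (κ (lineChart k j)) := by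
  obtain ⟨i, z, rfl⟩ := exists_mem_range_κ x
  have h1 : lineV (cox i) k ∉ z.asIdeal := by
    rw [← Scheme.Hom.comp_apply, κ_φ, cpt_mem_basicOpen _ _ _ (X_mem k) one_pos,
      MvPolynomial.aeval_X] at hx
    exact hx
  have h2 : ∃ j, embV (cox i) (embIdx (lineChart k j)) = lineV (cox i) k ∨
      embV (cox i) (embIdx (lineChart k j)) = lineV (cox i) k ^ 2 := by
    fin_cases i
    · exact ⟨0, .inr (by fin_cases k <;> simp [embV, embIdx, lineChart, lineV, cox])⟩
    · exact ⟨1, .inl (by fin_cases k <;> simp [embV, embIdx, lineChart, lineV, cox])⟩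
    · exact ⟨0, .inr (by fin_cases k <;> simp [embV, embIdx, lineChart, lineV, cox])⟩
    · exact ⟨1, .inl (by fin_cases k <;> simp [embV, embIdx, lineChart, lineV, cox])⟩
  obtain ⟨j, hj⟩ := h2
  refine ⟨j, ?_⟩
  rw [mem_range_κ, ← Scheme.Hom.comp_apply, κ_emb, cpt_mem_basicOpen _ _ _ (X_mem _) one_pos,
    MvPolynomial.aeval_X]
  rcases hj with hj | hj
  · rw [hj]; exact h1
  · rw [hj]; exact fun h => h1 (z.isPrime.mem_of_pow_mem 2 h)

/-- The inclusion of the line `x₀ = b` into the affine plane. -/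
def vert (b : ℂ) : PlaneRing →ₐ[ℂ] Polynomial ℂ :=
  MvPolynomial.aeval ![Polynomial.C b, Polynomial.X]

lemma vert_surjective (b : ℂ) : Function.Surjective (vert b) := by
  intro p
  refine ⟨Polynomial.aeval (MvPolynomial.X 1) p, ?_⟩
  rw [← AlgHom.comp_apply]
  have : (vert b).comp (Polynomial.aeval (MvPolynomial.X 1)) = AlgHom.id ℂ _ := by
    ext
    simp [vert]
  rw [this]; rfl

/-- A homomorphism that sends `x₀` to the constant `b` factors through restriction to the line
`x₀ = b`. -/
lemma factor_vert {A : Type} [CommRing A] [Algebra ℂ A] (f : PlaneRing →ₐ[ℂ] A) (b : ℂ)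
    (h : f (MvPolynomial.X 0) = f (algebraMap ℂ PlaneRing b)) (p : PlaneRing) :
    f p = Polynomial.aeval (f (MvPolynomial.X 1)) (vert b p) := by
  rw [← AlgHom.comp_apply]
  congr 1
  ext i
  fin_cases i
  · change f (MvPolynomial.X 0) = _
    rw [h, AlgHom.commutes]
    simp [vert]
  · simp [vert]

lemma ker_vert (b : ℂ) : RingHom.ker (vert b).toRingHom =
    Ideal.span {MvPolynomial.X 0 - algebraMap ℂ PlaneRing b} := by
  apply le_antisymm
  · intro p hp
    rw [← Ideal.Quotient.eq_zero_iff_mem]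
    have h := factor_vert (Ideal.Quotient.mkₐ ℂ
      (Ideal.span {MvPolynomial.X 0 - algebraMap ℂ PlaneRing b})) b
      (Ideal.Quotient.eq.2 (Ideal.subset_span rfl))
    have hp' : vert b p = 0 := hp
    refine (h p).trans ?_
    rw [hp', map_zero]
  · rw [Ideal.span_le, Set.singleton_subset_iff]
    change vert b _ = 0
    simp [vert, ← Polynomial.algebraMap_eq]

/-- Each of the two charts of the surface over a chart of the line meets the fibre over the point
`b` in the affine line `x₀ = b`. -/
lemma exists_fibre_chart {t : (projSpace 1).left} (ht : IsClosed {t}) {k : Fin 2}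
    (hk : t ∈ Proj.basicOpen (grading 1) (MvPolynomial.X k)) :
    ∃ b : ℂ, ∀ j, ∃ κ' : Spec (CommRingCat.of (Polynomial ℂ)) ⟶ φ.left.fiber t,
      IsOpenImmersion κ' ∧
      κ' ≫ φ.left.fiberι t =
        Spec.map (CommRingCat.ofHom (vert b).toRingHom) ≫ κ (lineChart k j) ∧
      ∀ x, x ∈ Set.range κ' ↔ φ.left.fiberι t x ∈ Set.range (κ (lineChart k j)) := by
  obtain ⟨v, hv, h, -⟩ := exists_eq_cpt_of_isClosed ht k hk
  obtain ⟨b, rfl⟩ := Line.exists_eq_coord k v hv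
  refine ⟨b, fun j => ?_⟩
  have := isClosed_singleton_iff_isClosedImmersion.1 ht
  have h1 : (φ.left.fiberι t).ker =
      (cpt (Line.coord k b) k (hv ▸ isUnit_one)).ker.comap φ.left := by
    rw [h]
    exact Scheme.IdealSheafData.ker_fst_of_isClosedImmersion _ _
  have h2 : (φ.left.fiberι t).ker.comap (κ (lineChart k j)) =
      (Spec.map (CommRingCat.ofHom (vert b).toRingHom)).ker := by
    apply globalIdeal_injective
    rw [h1, ← Scheme.IdealSheafData.comap_comp, κ_φ', Line.globalIdeal_comap_cpt,
      globalIdeal_ker_SpecMap, ker_vert]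
  have : IsClosedImmersion (φ.left.fiberι t) :=
    (inferInstance : IsClosedImmersion (Limits.pullback.fst _ _))
  have h3 : (φ.left.fiberι t).ker ≤
      (Spec.map (CommRingCat.ofHom (vert b).toRingHom) ≫ κ (lineChart k j)).ker := by
    rw [← Scheme.IdealSheafData.map_ker, Scheme.IdealSheafData.le_map_iff_comap_le, h2]
  have : IsClosedImmersion (Spec.map (CommRingCat.ofHom (vert b).toRingHom)) :=
    IsClosedImmersion.spec_of_surjective _ (vert_surjective b)
  have h4 := IsClosedImmersion.lift_fac (φ.left.fiberι t) _ h3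
  have h5 := isPullback_of_isClosedImmersion _ _ _ _ h4.symm h2
  refine ⟨_, MorphismProperty.of_isPullback h5 inferInstance, h4, fun x => ?_⟩
  have h6 := Scheme.image_preimage_eq_of_isPullback h5 Set.univ
  rw [Set.image_univ, Set.preimage_univ, Set.image_univ] at h6
  exact iff_of_eq (congrArg (x ∈ ·) h6)

end Scroll

/-! ### The smooth conic and the fibres of the ruling -/

/-- A morphism that factors through an open subscheme acts on sections over this subscheme as its
factor does. -/
lemma ι_app_comp_map {X Y : Scheme.{0}} (U : Y.Opens) (l : X ⟶ U)
    (h : (l ≫ U.ι) ⁻¹ᵁ U = ⊤) :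
    (l ≫ U.ι).app U ≫ X.presheaf.map (eqToHom h.symm).op = U.topIso.inv ≫ l.appTop := by
  have h1 : U.ι ⁻¹ᵁ U = ⊤ := by simp
  have h2 := l.naturality (eqToHom h1.symm).op
  have h4 : U.ι.app U ≫ (U : Scheme).presheaf.map (eqToHom h1.symm).op = U.topIso.inv := by
    rw [Scheme.Opens.ι_app, Scheme.Opens.topIso_inv, Scheme.Opens.toScheme_presheaf_map]
    exact (Y.presheaf.map_comp _ _).symm
  rw [← h4, Category.assoc]
  refine Eq.trans ?_ (congrArg (U.ι.app U ≫ ·) h2.symm)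
  exact (congrArg (· ≫ X.presheaf.map (eqToHom h.symm).op) (Scheme.Hom.comp_app l U.ι U)).trans
    (Category.assoc _ _ _)

/-- The pullback of functions on the chart `xₖ ≠ 0` to a point of this chart is evaluation at the
coordinates, up to isomorphism. -/
lemma awayToSection_comp_app {n : ℕ} {B : Type} [CommRing B]
    (f : MvPolynomial (Fin (n + 1)) ℂ →+* B) (k : Fin (n + 1))
    (hk : IsUnit (f (MvPolynomial.X k))) (x : HomogeneousLocalization.Away (grading n)
      (MvPolynomial.X k)) :
    ((pt f (X_mem k) one_pos hk).app (Proj.basicOpen (grading n) (MvPolynomial.X k))).hom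
      ((Proj.awayToSection (grading n) (MvPolynomial.X k)).hom x) = 0 ↔
      awayHom f (MvPolynomial.X k) hk x = 0 := by
  set U := Proj.basicOpen (grading n) (MvPolynomial.X k) with hU
  set l := Spec.map (CommRingCat.ofHom (awayHom f (MvPolynomial.X k) hk)) ≫
    (Proj.basicOpenIsoSpec (grading n) (MvPolynomial.X k) (X_mem k) one_pos).inv with hl
  have h1 : pt f (X_mem k) one_pos hk = l ≫ U.ι := by
    rw [hl, Category.assoc]; rfl
  have h2 : l ≫ Proj.basicOpenToSpec (grading n) (MvPolynomial.X k) =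
      Spec.map (CommRingCat.ofHom (awayHom f (MvPolynomial.X k) hk)) := by
    rw [hl, Category.assoc, ← Proj.basicOpenIsoSpec_hom (grading n) _ (X_mem k) one_pos,
      Iso.inv_hom_id, Category.comp_id]
  clear_value l
  have h3 : (l ≫ U.ι) ⁻¹ᵁ U = ⊤ := by
    rw [Scheme.Hom.comp_preimage]
    simp
  have h4 : (l ≫ U.ι).app U ≫ (Spec (CommRingCat.of B)).presheaf.map (eqToHom h3.symm).op =
      U.topIso.inv ≫ l.appTop := ι_app_comp_map U l h3
  have h5 : Proj.awayToSection (grading n) (MvPolynomial.X k) ≫ (l ≫ U.ι).app U ≫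
      (Spec (CommRingCat.of B)).presheaf.map (eqToHom h3.symm).op =
      CommRingCat.ofHom (awayHom f (MvPolynomial.X k) hk) ≫ (Scheme.ΓSpecIso _).inv := by
    rw [h4, Scheme.ΓSpecIso_inv_naturality, ← h2, Scheme.Hom.comp_appTop]
    have h8 : (Proj.basicOpenToSpec (grading n) (MvPolynomial.X k)).appTop =
      (Scheme.ΓSpecIso _).hom ≫ Proj.awayToSection (grading n) (MvPolynomial.X k) ≫
        U.topIso.inv := Proj.basicOpenToSpec_app_top _ _
    rw [h8]
    exact ((Iso.inv_hom_id_assoc _ _).symm.trans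
      (congrArg ((Scheme.ΓSpecIso _).inv ≫ ·) (by simp only [Category.assoc])))
  have h6 := congrArg (fun g => g.hom x) h5
  simp only [CommRingCat.hom_comp, RingHom.comp_apply] at h6
  rw [h1]
  constructor
  · intro h
    rw [h, map_zero] at h6
    exact ((Scheme.ΓSpecIso (CommRingCat.of B)).symm.commRingCatIsoToRingEquiv.injective
      (h6.symm.trans (map_zero _).symm))
  · intro h
    have h7 : CommRingCat.ofHom (awayHom f (MvPolynomial.X k) hk) x = 0 := h
    rw [h7, map_zero] at h6
    have h8 := (asIso ((Spec (CommRingCat.of B)).presheaf.map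
      (eqToHom h3.symm).op)).commRingCatIsoToRingEquiv.injective
    exact h8 (h6.trans (map_zero _).symm)

/-- The ideal of the closure of a point on the chart `xₖ ≠ 0` consists of the relations between
the affine coordinates of the point. -/
lemma ideal_ker_pt {n : ℕ} {B : Type} [CommRing B]
    (f : MvPolynomial (Fin (n + 1)) ℂ →+* B) {k : Fin (n + 1)}
    (hk : IsUnit (f (MvPolynomial.X k)))
    (h : Proj.basicOpen (grading n) (MvPolynomial.X k) ∈ (Proj (grading n)).affineOpens)
    {a : HomogeneousLocalization.Away (grading n) (MvPolynomial.X k)}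
    (ha : RingHom.ker (awayHom f (MvPolynomial.X k) hk) = Ideal.span {a}) :
    (pt f (X_mem k) one_pos hk).ker.ideal ⟨_, h⟩ =
      Ideal.span {(Proj.awayToSection (grading n) (MvPolynomial.X k)).hom a} := by
  have hs : Function.Surjective (Proj.awayToSection (grading n) (MvPolynomial.X k)).hom :=
    ((Proj.basicOpenIsoAway (grading n) (MvPolynomial.X k) (X_mem k)
      one_pos).commRingCatIsoToRingEquiv).surjective
  rw [Scheme.Hom.ker_apply]
  ext y
  obtain ⟨x, rfl⟩ := hs y
  rw [← Set.image_singleton, ← Ideal.map_span, ← ha, RingHom.mem_ker]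
  refine (awayToSection_comp_app f k hk x).trans ?_
  rw [Ideal.mem_map_iff_of_surjective _ hs]
  refine ⟨fun h => ⟨x, h, rfl⟩, ?_⟩
  rintro ⟨x', hx', h'⟩
  have hi : Function.Injective (Proj.awayToSection (grading n) (MvPolynomial.X k)).hom :=
    ((Proj.basicOpenIsoAway (grading n) (MvPolynomial.X k) (X_mem k)
      one_pos).commRingCatIsoToRingEquiv).injective
  exact hi h' ▸ hx'

/-- If the point with coordinates `v` factors over the injection `g` through a point with
coordinates in `D`, the relations between its affine coordinates are generated by `q` as soon as
the universal point modulo `q` factors through `D` as well. -/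
lemma ker_awayHom_eq_span {n : ℕ} {B D : Type} [CommRing B] [Algebra ℂ B] [CommRing D] [Algebra ℂ D]
    {v : Fin (n + 1) → B} {k : Fin (n + 1)} (hk : v k = 1)
    (g : D →ₐ[ℂ] B) (hg : Function.Injective g) (w : Fin (n + 1) → D) (hw : g ∘ w = v)
    {q : MvPolynomial (Fin (n + 1)) ℂ} (hq : MvPolynomial.aeval w q = 0)
    (r : D →+* HomogeneousLocalization.Away (grading n) (MvPolynomial.X k) ⧸
      Ideal.span {dehom k q})
    (hC : ∀ c : ℂ, r (algebraMap ℂ D c) = Ideal.Quotient.mk _ (dehom k (MvPolynomial.C c)))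
    (hX : ∀ i, r (w i) = Ideal.Quotient.mk _ (dehom k (MvPolynomial.X i)))
    (h : IsUnit (coords v (MvPolynomial.X k))) :
    RingHom.ker (awayHom (coords v) (MvPolynomial.X k) h) = Ideal.span {dehom k q} := by
  have hv : coords v (MvPolynomial.X k) = 1 := by rw [coords_X, hk]
  have h1 : r.comp (coords w) = (Ideal.Quotient.mk (Ideal.span {dehom k q})).comp (dehom k) := by
    apply MvPolynomial.ringHom_ext
    · intro c
      rw [RingHom.comp_apply, RingHom.comp_apply, ← hC, coords_C]
    · intro i
      rw [RingHom.comp_apply, RingHom.comp_apply, ← hX, coords_X]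
  have h2 : ∀ F, awayHom (coords v) (MvPolynomial.X k) h (dehom k F) = g (coords w F) := by
    intro F
    rw [awayHom_dehom _ hv, ← hw, ← comp_coords]
    rfl
  apply le_antisymm
  · intro a ha
    obtain ⟨F, rfl⟩ := dehom_surjective k a
    rw [RingHom.mem_ker, h2] at ha
    have h3 : coords w F = 0 := hg (ha.trans (map_zero g).symm)
    rw [← Ideal.Quotient.eq_zero_iff_mem]
    have h4 := congrArg (fun f => f F) h1
    simp only [RingHom.comp_apply, h3, map_zero] at h4
    exact h4.symm
  · rw [Ideal.span_le, Set.singleton_subset_iff]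
    change awayHom _ _ _ _ = 0
    rw [h2]
    exact (congrArg g hq).trans (map_zero g)

namespace Conic

open LaurentPolynomial

/-- The parametrization `[s : w] ↦ [s² : sw : w²]` of the conic `x₁² = x₀x₂`. -/
def vec {B : Type} [CommRing B] (s w : B) : Fin 3 → B := ![s ^ 2, s * w, w ^ 2]

/-- The quadratic form `x₁² - x₀x₂`. -/
def form : MvPolynomial (Fin 3) ℂ := MvPolynomial.X 1 ^ 2 - MvPolynomial.X 0 * MvPolynomial.X 2

lemma form_mem : form ∈ grading 2 2 :=
  ((MvPolynomial.isHomogeneous_X ℂ (1 : Fin 3)).pow 2).sub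
    ((MvPolynomial.isHomogeneous_X ℂ (0 : Fin 3)).mul (MvPolynomial.isHomogeneous_X ℂ (2 : Fin 3)))

lemma aeval_form {B : Type} [CommRing B] [Algebra ℂ B] (s w : B) :
    MvPolynomial.aeval (vec s w) form = 0 := by
  simp [form, vec]; ring

/-- The generic point of the conic. -/
def η : Spec (CommRingCat.of ℂ[T;T⁻¹]) ⟶ (projSpace 2).left :=
  cpt (vec 1 (T 1)) 0 (by simp [vec])

/-- The two standard charts of the projective line, `s = 1` and `w = 1`. -/
def par : Fin 2 → Fin 2 → Polynomial ℂ := ![![1, Polynomial.X], ![Polynomial.X, 1]]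

/-- The inclusion of the torus in the two charts of the projective line, as a homomorphism of
coordinate rings. -/
def e : Fin 2 → (Polynomial ℂ →ₐ[ℂ] ℂ[T;T⁻¹]) :=
  ![Polynomial.toLaurentAlg, invert.toAlgHom.comp Polynomial.toLaurentAlg]

lemma e_injective (j : Fin 2) : Function.Injective (e j) := by
  fin_cases j
  · exact Polynomial.toLaurent_injective
  · exact invert.injective.comp Polynomial.toLaurent_injective

lemma e_X (j : Fin 2) : e j Polynomial.X = ![T 1, T (-1)] j := by
  fin_cases j <;> simp [e]

lemma T_mul_T_neg : (T 1 : ℂ[T;T⁻¹]) * T (-1) = 1 := by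
  rw [← T_add]; simp

/-- The coordinate that equals `1` on each of the two charts of the conic. -/
def idx : Fin 2 → Fin 3 := ![0, 2]

lemma vec_par (j : Fin 2) : vec (par j 0) (par j 1) (idx j) = 1 := by
  fin_cases j <;> simp [vec, par, idx]

lemma e_vec (j : Fin 2) (h : IsUnit ((e j ∘ vec (par j 0) (par j 1)) (idx j))) :
    cpt (e j ∘ vec (par j 0) (par j 1)) (idx j) h = η := by
  fin_cases j
  · refine (cpt_eq_of_mul _ _ isUnit_one fun i => ?_).symm
    fin_cases i <;> simp [vec, par, e]
  · refine (cpt_eq_of_mul _ _ (LaurentPolynomial.isUnit_T (-2)) fun i => ?_).symm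
    fin_cases i
    · simp [vec, par, e, T_pow]
    · change e 1 (Polynomial.X * 1) = T (-2) * (1 * T 1)
      rw [mul_one, one_mul, e_X, ← T_add]
      rfl
    · change e 1 (1 ^ 2) = T (-2) * T 1 ^ 2
      rw [one_pow, map_one, T_pow, ← T_add]
      exact T_zero.symm

lemma aeval_vec_surjective (j : Fin 2) : Function.Surjective
    (MvPolynomial.aeval (vec (par j 0) (par j 1)) :
      MvPolynomial (Fin 3) ℂ →ₐ[ℂ] Polynomial ℂ) := by
  intro p
  refine ⟨Polynomial.aeval (MvPolynomial.X 1) p, ?_⟩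
  rw [← AlgHom.comp_apply]
  have : (MvPolynomial.aeval (vec (par j 0) (par j 1))).comp
      (Polynomial.aeval (MvPolynomial.X 1)) = AlgHom.id ℂ (Polynomial ℂ) := by
    ext
    fin_cases j <;> simp [vec, par]
  rw [this]; rfl

/-- The conic is covered by two affine lines, glued along the torus like the charts of `ℙ¹`. -/
lemma exists_κ (j : Fin 2) : ∃ κ : Spec (CommRingCat.of (Polynomial ℂ)) ⟶ η.image,
    IsOpenImmersion κ ∧
    κ ≫ η.imageι = cpt (vec (par j 0) (par j 1)) (idx j) (vec_par j ▸ isUnit_one) ∧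
    Spec.map (CommRingCat.ofHom (e j).toRingHom) ≫ κ = η.toImage ∧
      ∀ x, x ∈ Set.range κ ↔
        η.imageι x ∈ Proj.basicOpen (grading 2) (MvPolynomial.X (idx j)) :=
  exists_chart_image_cpt _ _ (vec_par j) (aeval_vec_surjective j) (e j) (e_injective j) (e_vec j _)

lemma imageι_mem (x : η.image) : η.imageι x ∉ Proj.basicOpen (grading 2) form := by
  have hc : IsClosed (η.imageι ⁻¹' {x | x ∉ Proj.basicOpen (grading 2) form}) :=
    (Proj.basicOpen (grading 2) form).isOpen.isClosed_compl.preimage η.imageι.continuous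
  have hd : DenseRange η.toImage := (inferInstance : IsDominant η.toImage).denseRange
  refine hd.induction_on (p := fun x => x ∈ η.imageι ⁻¹' {x | x ∉ Proj.basicOpen (grading 2) form}) x hc
    fun z => ?_
  change η.imageι (η.toImage z) ∉ Proj.basicOpen (grading 2) form
  rw [← Scheme.Hom.comp_apply, η.toImage_imageι]
  refine fun h => (cpt_mem_basicOpen _ _ _ form_mem two_pos z).1 h ?_
  rw [aeval_form]
  exact zero_mem _

lemma exists_mem_range (x : η.image) :
    ∃ j, η.imageι x ∈ Proj.basicOpen (grading 2) (MvPolynomial.X (idx j)) := by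
  obtain ⟨k, hk⟩ := exists_mem_basicOpen_X (n := 2) (η.imageι x)
  have h := imageι_mem x
  fin_cases k
  · exact ⟨0, hk⟩
  · refine ⟨0, fun h0 => h fun h1 => hk ?_⟩
    have h2 : MvPolynomial.X 1 ^ 2 ∈ (vanishingPolys (η.imageι x)).toIdeal := by
      rw [← sub_add_cancel (MvPolynomial.X 1 ^ 2) (MvPolynomial.X 0 * MvPolynomial.X 2)]
      exact add_mem h1 (Ideal.mul_mem_right _ _ h0)
    exact (ProjectiveSpectrum.isPrime (show ProjectiveSpectrum (grading 2) from
      η.imageι x)).mem_of_pow_mem 2 h2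
  · exact ⟨1, hk⟩

lemma dehomogenize_eq (k : Fin 3) : dehomogenize form form_mem k =
    (Proj.awayToSection (grading 2) (MvPolynomial.X k)).hom (dehom k form) := by
  rw [dehom_apply k (d := 2) form form_mem]
  rfl

/-- On every chart, the functions vanishing on `[1 : c : c²]` are the multiples of the
dehomogenization of `x₁² - x₀x₂`. -/
lemma exists_ker_eq (k : Fin 3) : ∃ (v : Fin 3 → ℂ[T;T⁻¹]) (h : IsUnit (v k)),
    η = cpt v k h ∧ RingHom.ker (awayHom (coords v) (MvPolynomial.X k)
      ((coords_X v k).symm ▸ h)) = Ideal.span {dehom k form} := by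
  have hq : (Ideal.Quotient.mk (Ideal.span {dehom k form})) (dehom k form) = 0 :=
    Ideal.Quotient.eq_zero_iff_mem.2 (Ideal.subset_span rfl)
  set m := (Ideal.Quotient.mk (Ideal.span {dehom k form})).comp (dehom k) with hm
  have hq' : m (MvPolynomial.X 1) ^ 2 = m (MvPolynomial.X 0) * m (MvPolynomial.X 2) := by
    have : m (MvPolynomial.X 1 ^ 2 - MvPolynomial.X 0 * MvPolynomial.X 2) = 0 := hq
    rwa [map_sub, map_mul, map_pow, sub_eq_zero] at this
  have hk : m (MvPolynomial.X k) = 1 := by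
    rw [hm, RingHom.comp_apply, dehom_X_self, map_one]
  have main (j : Fin 2) (hj : idx j = k) : ∃ (v : Fin 3 → ℂ[T;T⁻¹]) (h : IsUnit (v k)),
      η = cpt v k h ∧ RingHom.ker (awayHom (coords v) (MvPolynomial.X k)
        ((coords_X v k).symm ▸ h)) = Ideal.span {dehom k form} := by
    subst hj
    have h1 : (e j ∘ vec (par j 0) (par j 1)) (idx j) = 1 := by
      rw [Function.comp_apply, vec_par, map_one]
    refine ⟨e j ∘ vec (par j 0) (par j 1), h1 ▸ isUnit_one, (e_vec j _).symm,
      ker_awayHom_eq_span h1 (e j) (e_injective j) _ rfl (aeval_form _ _)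
        (Polynomial.eval₂RingHom (m.comp MvPolynomial.C) (m (MvPolynomial.X 1)))
        (fun c => by simp [m]) (fun i => ?_) _⟩
    change _ = m (MvPolynomial.X i)
    fin_cases j
    · have h0 : m (MvPolynomial.X 0) = 1 := hk
      fin_cases i
      · simp [vec, par, h0]
      · simp [vec, par]
      · simp [vec, par, hq', h0]
    · have h0 : m (MvPolynomial.X 2) = 1 := hk
      fin_cases i
      · simp [vec, par, hq', h0]
      · simp [vec, par]
      · simp [vec, par, h0]
  fin_cases k
  · exact main 0 rfl
  · have h0 : m (MvPolynomial.X 0) * m (MvPolynomial.X 2) = 1 := by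
      rw [← hq']
      have : m (MvPolynomial.X 1) = 1 := hk
      rw [this, one_pow]
    let u : (HomogeneousLocalization.Away (grading 2) (MvPolynomial.X 1) ⧸
      Ideal.span {dehom 1 form})ˣ := ⟨m (MvPolynomial.X 2), m (MvPolynomial.X 0),
        (mul_comm _ _).trans h0, h0⟩
    obtain ⟨v, v0, v1, v2⟩ : ∃ v : Fin 3 → ℂ[T;T⁻¹], v 0 = T (-1) ∧ v 1 = 1 ∧ v 2 = T 1 :=
      ⟨![T (-1), 1, T 1], rfl, rfl, rfl⟩
    refine ⟨v, v1 ▸ isUnit_one, ?_,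
      ker_awayHom_eq_span v1 (AlgHom.id ℂ _) Function.injective_id v rfl ?_
        (LaurentPolynomial.eval₂ (m.comp MvPolynomial.C) u) (fun c => ?_) (fun i => ?_) _⟩
    · refine cpt_eq_of_mul _ _ (LaurentPolynomial.isUnit_T (-1)) fun i => ?_
      fin_cases i
      · simp [vec, v0]
      · change v 1 = T (-1) * (1 * T 1)
        rw [v1, one_mul, ← T_add]
        exact T_zero.symm
      · change v 2 = T (-1) * T 1 ^ 2
        rw [v2, T_pow, ← T_add]
        rfl
    · have h1 : T (-1) * T 1 = (1 : ℂ[T;T⁻¹]) := by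
        rw [← T_add]
        exact T_zero
      simp only [form, map_sub, map_mul, map_pow, MvPolynomial.aeval_X, v0, v1, v2, h1, one_pow,
        sub_self]
    · change LaurentPolynomial.eval₂ _ _ (LaurentPolynomial.C c) = _
      rw [LaurentPolynomial.eval₂_C]
      rfl
    · change _ = m (MvPolynomial.X i)
      fin_cases i
      · change LaurentPolynomial.eval₂ _ _ (v 0) = _
        rw [v0, LaurentPolynomial.eval₂_T, zpow_neg_one]
        rfl
      · change LaurentPolynomial.eval₂ _ _ (v 1) = _
        rw [v1, map_one]
        exact hk.symm
      · change LaurentPolynomial.eval₂ _ _ (v 2) = _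
        rw [v2, LaurentPolynomial.eval₂_T, zpow_one]
        rfl
  · exact main 1 rfl

/-- The ideal sheaf of the closure of the image of `[1 : c : c²]` is generated by the form
`x₁² - x₀x₂`. -/
lemma ideal_ker_η (k : Fin 3) : η.ker.ideal (chart k) = Ideal.span {dehomogenize form form_mem k} := by
  obtain ⟨v, h, h1, h2⟩ := exists_ker_eq k
  rw [dehomogenize_eq, h1]
  exact ideal_ker_pt _ _ (chart k).2 h2

end Conic

/-- Two separated schemes with the same charts, glued in the same way, are isomorphic. -/
lemma exists_iso_of_charts {X Y T : Scheme.{0}} [X.IsSeparated] [Y.IsSeparated] {I : Type}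
    (A : I → Scheme.{0}) (κ : ∀ i, A i ⟶ X) [∀ i, IsOpenImmersion (κ i)]
    (hcov : ∀ x, ∃ i, x ∈ Set.range (κ i)) (κ' : ∀ i, A i ⟶ Y) [∀ i, IsOpenImmersion (κ' i)]
    (hcov' : ∀ x, ∃ i, x ∈ Set.range (κ' i)) (i₀ : I)
    (η : T ⟶ X) [IsSchemeTheoreticallyDominant η] [QuasiCompact η]
    (η' : T ⟶ Y) [IsSchemeTheoreticallyDominant η'] [QuasiCompact η'] (e : ∀ i, T ⟶ A i)
    (he : ∀ i, e i ≫ κ i = η) (he' : ∀ i, e i ≫ κ' i = η') :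
    ∃ h : X ≅ Y, ∀ i, κ i ≫ h.hom = κ' i := by
  obtain ⟨f, hf⟩ := exists_glue A κ hcov η e he κ' η' he'
  obtain ⟨g, hg⟩ := exists_glue A κ' hcov' η' e he' κ η he
  have h1 : η ≫ f = η' := by rw [← he i₀, Category.assoc, hf, he']
  have h2 : η' ≫ g = η := by rw [← he' i₀, Category.assoc, hg, he]
  refine ⟨⟨f, g, ext_of_schemeTheoreticallyDominant η ?_,
    ext_of_schemeTheoreticallyDominant η' ?_⟩, hf⟩
  · rw [reassoc_of% h1, h2, Category.comp_id]
  · rw [reassoc_of% h2, h1, Category.comp_id]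

namespace Scroll

open LaurentPolynomial

variable {t : (projSpace 1).left}

/-- On the common part of a fibre, where `x₁` and its inverse are the coordinates of the two
charts, the coordinates in `ℙ⁴` differ by a unit. -/
lemma map_embV {A : Type} [CommRing A] [Algebra ℂ A] (f g : PlaneRing →ₐ[ℂ] A) {u : A}
    (h0 : f (MvPolynomial.X 0) = g (MvPolynomial.X 0)) (hf : f (MvPolynomial.X 1) = u)
    (hg : u * g (MvPolynomial.X 1) = 1) (k : Fin 2) (i : Fin 5) :
    f (embV (cox (lineChart k 0)) i) = u * g (embV (cox (lineChart k 1)) i) := by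
  fin_cases k <;> fin_cases i <;> simp [embV, cox, lineChart, h0, hf] <;> grind

/-- The fibres of the ruling are covered by two affine lines, glued like the charts of `ℙ¹`. -/
lemma exists_fibre_charts (ht : IsClosed {t}) :
    ∃ (κ' : Fin 2 → (Spec (CommRingCat.of (Polynomial ℂ)) ⟶ φ.left.fiber t)),
      (∀ j, IsOpenImmersion (κ' j)) ∧ (∀ x, ∃ j, x ∈ Set.range (κ' j)) ∧
      ∃ η' : Spec (CommRingCat.of ℂ[T;T⁻¹]) ⟶ φ.left.fiber t,
        (∀ j, Spec.map (CommRingCat.ofHom (Conic.e j).toRingHom) ≫ κ' j = η') ∧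
        η' ≫ φ.left.fiberι t ≫ surface.hom =
          Spec.map (CommRingCat.ofHom (algebraMap ℂ ℂ[T;T⁻¹])) := by
  obtain ⟨k, hk⟩ := exists_mem_basicOpen_X (n := 1) t
  obtain ⟨b, hb⟩ := exists_fibre_chart ht hk
  choose κ' h1 h2 h3 using hb
  refine ⟨κ', h1, fun x => ?_, Spec.map (CommRingCat.ofHom (Conic.e 0).toRingHom) ≫ κ' 0, ?_, ?_⟩
  · have h4 : φ.left (φ.left.fiberι t x) = t := by
      have : φ.left.fiberι t x ∈ φ.left ⁻¹' {t} := by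
        rw [← Scheme.Hom.range_fiberι]; exact ⟨x, rfl⟩
      exact this
    obtain ⟨j, hj⟩ := exists_mem_range_κ_of_φ (x := φ.left.fiberι t x) (k := k) (by rw [h4]; exact hk)
    exact ⟨j, (h3 j x).2 hj⟩
  swap
  · rw [Category.assoc, reassoc_of% h2 0, κ_hom, ← Spec.map_comp, ← Spec.map_comp]
    congr 1
    refine CommRingCat.hom_ext (RingHom.ext fun c => ?_)
    exact (congrArg (Conic.e 0) ((vert b).commutes c)).trans ((Conic.e 0).commutes c)
  have hmono : Mono (φ.left.fiberι t ≫ emb.left) := by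
    have := isClosed_singleton_iff_isClosedImmersion.1 ht
    have : IsClosedImmersion (φ.left.fiberι t) :=
      (inferInstance : IsClosedImmersion (Limits.pullback.fst _ _))
    infer_instance
  have key (j : Fin 2) : ∃ h, (Spec.map (CommRingCat.ofHom (Conic.e j).toRingHom) ≫ κ' j) ≫
      φ.left.fiberι t ≫ emb.left = cpt (Conic.e j ∘ (vert b ∘ embV (cox (lineChart k j))))
        (embIdx (lineChart k j)) h := by
    refine ⟨?_, ?_⟩
    · rw [Function.comp_apply, Function.comp_apply, embV_embIdx, map_one, map_one]
      exact isUnit_one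
    · rw [Category.assoc, reassoc_of% h2 j, κ_emb, SpecMap_cpt, SpecMap_cpt]
  intro j
  fin_cases j
  · rfl
  · rw [← cancel_mono (φ.left.fiberι t ≫ emb.left)]
    obtain ⟨g0, k0⟩ := key 0
    obtain ⟨g1, k1⟩ := key 1
    refine k1.trans (Eq.trans ?_ k0.symm)
    refine cpt_eq_of_mul _ _ (LaurentPolynomial.isUnit_T 1) fun i => ?_
    refine map_embV ((Conic.e 0).comp (vert b)) ((Conic.e 1).comp (vert b)) ?_ ?_ ?_ k i
    · simp only [vert, AlgHom.comp_apply, MvPolynomial.aeval_X]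
      exact ((Conic.e 0).commutes b).trans ((Conic.e 1).commutes b).symm
    · simp only [vert, AlgHom.comp_apply, MvPolynomial.aeval_X]
      exact Conic.e_X 0
    · simp only [vert, AlgHom.comp_apply, MvPolynomial.aeval_X]
      exact (congrArg (T 1 * ·) (Conic.e_X 1)).trans Conic.T_mul_T_neg

/-- The fibres of the ruling have the same charts as the conic `x₁² = x₀x₂`, hence are isomorphic
to it. -/
lemma isConic_fibre (ht : IsClosed {t}) :
    IsConic (Over.mk (φ.left.fiberι t ≫ surface.hom)) := by
  obtain ⟨κ', h1, h2, η', h3, h4⟩ := exists_fibre_charts ht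
  choose κ'' k1 k2 k3 k4 using Conic.exists_κ
  have := isClosed_singleton_iff_isClosedImmersion.1 ht
  have : IsClosedImmersion (φ.left.fiberι t) :=
    (inferInstance : IsClosedImmersion (Limits.pullback.fst _ _))
  have hs : (φ.left.fiber t).IsSeparated := isSeparated_of_hom (φ.left.fiberι t)
  have hs' : Conic.η.image.IsSeparated := isSeparated_of_hom Conic.η.imageι
  have (j : Fin 2) : IsSchemeTheoreticallyDominant
      (Spec.map (CommRingCat.ofHom (Conic.e j).toRingHom)) :=
    isSchemeTheoreticallyDominant_SpecMap (Conic.e_injective j)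
  have : IsIntegral (φ.left.fiber t) := isIntegral_of_charts _ κ' h2 η' _ h3
  have : IsDominant η' := isDominant_of_charts _ κ' h2 η' _ h3
  have : IsSchemeTheoreticallyDominant η' := .of_isDominant _
  obtain ⟨h, hh⟩ := exists_iso_of_charts _ κ' h2 κ''
    (fun x => by
      obtain ⟨j, hj⟩ := Conic.exists_mem_range x
      exact ⟨j, (k4 j x).2 hj⟩) 0 η' Conic.η.toImage _ h3 k3
  have hc : (h.hom ≫ Conic.η.imageι) ≫ (projSpace 2).hom = φ.left.fiberι t ≫ surface.hom := by
    refine ext_of_schemeTheoreticallyDominant η' ?_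
    have h5 : η' ≫ h.hom = Conic.η.toImage := by
      rw [← h3 0, Category.assoc, hh, k3]
    rw [h4, Category.assoc, reassoc_of% h5, Scheme.Hom.toImage_imageι_assoc]
    exact cpt_comp_hom _ _ _
  refine ⟨Conic.form, Conic.form_mem, Over.homMk (h.hom ≫ Conic.η.imageι) hc, ?_, ?_, fun k => ?_⟩
  · intro h0
    have := congrArg (MvPolynomial.aeval (![0, 1, 0] : Fin 3 → ℂ)) h0
    simp [Conic.form] at this
  · exact (inferInstance : IsClosedImmersion (h.hom ≫ Conic.η.imageι))
  · refine Eq.trans ?_ (Conic.ideal_ker_η k)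
    refine congrArg (fun J : (projSpace 2).left.IdealSheafData => J.ideal (chart k)) ?_
    change (h.hom ≫ Conic.η.imageι).ker = _
    rw [Scheme.Hom.ker_comp_of_isIso]
    exact Scheme.IdealSheafData.ker_subschemeι _

end Scroll

/-! ### Normality of smooth varieties -/

section Normality

open TensorProduct

/-- Étale domains over normal domains are normal. If `K` is the fraction field of `P`, then
`A ⊗ K` is a domain that is finite over `K`, hence the fraction field of `A`, and integral closure
commutes with étale base change. -/
lemma isIntegrallyClosed_of_etale (P A : Type) [CommRing P] [IsDomain P] [IsIntegrallyClosed P]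
    [CommRing A] [IsDomain A] [Algebra P A] [Algebra.Etale P A] : IsIntegrallyClosed A := by
  let K := FractionRing P
  have hflat : Module.Flat P A := inferInstance
  have hinj : Function.Injective (algebraMap P A) := by
    have : Module.IsTorsionFree P A := inferInstance
    exact FaithfulSMul.algebraMap_injective P A
  have hle : Algebra.algebraMapSubmonoid A (nonZeroDivisors P) ≤ nonZeroDivisors A := by
    rintro _ ⟨p, hp, rfl⟩
    exact mem_nonZeroDivisors_of_ne_zero
      ((map_ne_zero_iff _ hinj).2 (nonZeroDivisors.ne_zero hp))
  have hloc : IsLocalization (Algebra.algebraMapSubmonoid A (nonZeroDivisors P)) (A ⊗[P] K) :=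
    inferInstance
  have hdom : IsDomain (A ⊗[P] K) := IsLocalization.isDomain_of_le_nonZeroDivisors _ hle
  have hdom' : IsDomain (K ⊗[P] A) := (Algebra.TensorProduct.comm P A K).symm.toMulEquiv.isDomain _
  have hfin : Module.Finite K (K ⊗[P] A) := Algebra.FormallyUnramified.finite_of_free _ _
  have hfield' : IsField (K ⊗[P] A) := isField_of_isIntegral_of_isField' (Field.toIsField K)
  have hfield : IsField (A ⊗[P] K) :=
    (Algebra.TensorProduct.comm P A K).toMulEquiv.isField hfield'
  have hinj' : Function.Injective (algebraMap A (A ⊗[P] K)) := IsLocalization.injective _ hle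
  have hfrac : IsFractionRing A (A ⊗[P] K) := by
    refine IsLocalization.of_le (Algebra.algebraMapSubmonoid A (nonZeroDivisors P)) _ hle
      fun r hr => ?_
    obtain ⟨b, hb⟩ := hfield.mul_inv_cancel
      ((map_ne_zero_iff _ hinj').2 (nonZeroDivisors.ne_zero hr))
    exact IsUnit.of_mul_eq_one _ hb
  let := hfield.toField
  rw [isIntegrallyClosed_iff (A ⊗[P] K)]
  intro x hx
  obtain ⟨z, hz⟩ := (TensorProduct.toIntegralClosure_bijective_of_smooth
    (R := P) (S := A) (B := K)).2 ⟨x, hx⟩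
  have hz' : (TensorProduct.toIntegralClosure P A K z : A ⊗[P] K) = x := congrArg Subtype.val hz
  rw [← hz']
  clear hz hz' hx
  induction z with
  | zero => exact ⟨0, by simp⟩
  | add y z hy hz =>
    obtain ⟨a, ha⟩ := hy
    obtain ⟨b, hb⟩ := hz
    exact ⟨a + b, by rw [map_add, map_add, ha, hb]; rfl⟩
  | tmul a p =>
    obtain ⟨p, hp⟩ := p
    obtain ⟨p', rfl⟩ := IsIntegrallyClosed.algebraMap_eq_of_integral hp
    refine ⟨p' • a, ?_⟩
    change (p' • a) ⊗ₜ[P] (1 : K) = a ⊗ₜ algebraMap P K p'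
    rw [TensorProduct.smul_tmul, Algebra.algebraMap_eq_smul_one]

/-- A standard smooth algebra over a field is étale over a polynomial ring, hence normal. -/
lemma isIntegrallyClosed_of_isStandardSmooth {R A : Type} [CommRing R] (hR : IsField R)
    [CommRing A] [IsDomain A] {f : R →+* A} {n : ℕ}
    (hf : f.IsStandardSmoothOfRelativeDimension n) : IsIntegrallyClosed A := by
  let := hR.toField
  obtain ⟨g, -, hg⟩ := hf.exists_etale_mvPolynomial
  algebraize [g]
  exact isIntegrallyClosed_of_etale (MvPolynomial (Fin n) R) A

end Normality

lemma isField_section_SpecC {U : SpecC.Opens} (hU : (U : Set SpecC).Nonempty) :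
    IsField Γ(SpecC, U) := by
  have : U = ⊤ := by
    ext x
    obtain ⟨y, hy⟩ := hU
    have : Subsingleton SpecC := (inferInstance : Subsingleton (PrimeSpectrum ℂ))
    simp [Subsingleton.elim x y ▸ hy]
  subst this
  exact (Scheme.ΓSpecIso (CommRingCat.of ℂ)).commRingCatIsoToRingEquiv.toMulEquiv.isField
    (Field.toIsField ℂ)

lemma exists_normal_nhd {Y : Scheme.{0}} [IsIntegral Y] (s : Y ⟶ SpecC) {n : ℕ}
    [SmoothOfRelativeDimension n s] (y : Y) :
    ∃ V : Y.Opens, IsAffineOpen V ∧ y ∈ V ∧ IsDomain Γ(Y, V) ∧ IsIntegrallyClosed Γ(Y, V) := by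
  obtain ⟨U, -, V, hV, hy, e, h⟩ :=
    SmoothOfRelativeDimension.exists_isStandardSmoothOfRelativeDimension (n := n) (f := s) y
  have : Nonempty V := ⟨⟨y, hy⟩⟩
  exact ⟨V, hV, hy, inferInstance,
    isIntegrallyClosed_of_isStandardSmooth (isField_section_SpecC ⟨_, e hy⟩) h⟩

/-- An integral morphism of integral schemes to a normal affine scheme which has a section over a
nonempty basic open set is an isomorphism. -/
lemma isIso_of_isIntegralHom {A : Type} [CommRing A] [IsDomain A] [IsIntegrallyClosed A]
    {P : Scheme.{0}} [IsIntegral P] (p : P ⟶ Spec (CommRingCat.of A)) [IsIntegralHom p] {s : A}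
    (hs : s ≠ 0)
    (j : Spec (CommRingCat.of (Localization.Away s)) ⟶ P) [IsDominant j]
    (hj : j ≫ p = Spec.map (CommRingCat.ofHom (algebraMap A (Localization.Away s)))) :
    IsIso p := by
  have : IsAffine P := isAffine_of_isAffineHom p
  wlog hP : ∃ B, P = Spec B
  · have h := this (P := Spec Γ(P, ⊤)) (P.isoSpec.inv ≫ p) hs (j ≫ P.isoSpec.hom)
      (by simpa using hj) inferInstance ⟨_, rfl⟩
    exact (isIso_comp_left_iff P.isoSpec.inv p).1 h
  obtain ⟨B, rfl⟩ := hP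
  have hB : IsDomain B := (affine_isIntegral_iff B).1 inferInstance
  obtain ⟨g, rfl⟩ := Spec.map_surjective p
  obtain ⟨r, rfl⟩ := Spec.map_surjective j
  rw [← Spec.map_comp] at hj
  have hj' : ∀ a, r.hom (g.hom a) = algebraMap A (Localization.Away s) a := fun a =>
    congrArg (fun f => f.hom a) (Spec.map_injective hj)
  have hr : Function.Injective r.hom := by
    rw [RingHom.injective_iff_ker_eq_bot, ← le_bot_iff]
    have h := (PrimeSpectrum.denseRange_comap_iff_ker_le_nilRadical r.hom).1
      (Spec.map r).denseRange
    rwa [nilradical_eq_zero] at h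
  have hle : Submonoid.powers s ≤ nonZeroDivisors A := powers_le_nonZeroDivisors_of_noZeroDivisors hs
  have hA : Function.Injective (algebraMap A (Localization.Away s)) := IsLocalization.injective _ hle
  have hg : g.hom.IsIntegral := IsIntegralHom.SpecMap_iff.1 inferInstance
  have hb : Function.Bijective g.hom := by
    refine ⟨fun a b h => hA (by rw [← hj', ← hj', h]), fun b => ?_⟩
    let K := FractionRing A
    let F : Localization.Away s →+* K := IsLocalization.map K (RingHom.id A)
      (show Submonoid.powers s ≤ (nonZeroDivisors A).comap (RingHom.id A) from hle)
    have hF : ∀ a, F (algebraMap A _ a) = algebraMap A K a := fun a => IsLocalization.map_eq _ a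
    have hFi : Function.Injective F := IsLocalization.map_injective_of_injective' _ _ _ _
      zero_notMem_nonZeroDivisors Function.injective_id
    have h1 : IsIntegral A (F (r.hom b)) := by
      obtain ⟨q, hq, hq'⟩ := hg b
      refine ⟨q, hq, ?_⟩
      have h2 : algebraMap A K = (F.comp r.hom).comp g.hom := by
        ext a
        exact ((congrArg F (hj' a)).trans (hF a)).symm
      rw [h2]
      refine (Polynomial.hom_eval₂ q g.hom (F.comp r.hom) b).symm.trans ?_
      rw [hq', map_zero]
    obtain ⟨a, ha⟩ := IsIntegrallyClosed.algebraMap_eq_of_integral h1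
    refine ⟨a, hr (hFi ?_)⟩
    rw [hj', hF, ha]
  have : IsIso g := (ConcreteCategory.isIso_iff_bijective g).2 hb
  infer_instance

/-- A birational morphism is an open immersion on a dense open set. -/
lemma exists_isOpenImmersion_of_isBirationalMorphism {X Y : Over SpecC} {f : X ⟶ Y}
    (hf : IsBirationalMorphism f) :
    ∃ W : X.left.Opens, Dense (W : Set X.left) ∧ IsOpenImmersion (W.ι ≫ f.left) := by
  obtain ⟨e, he⟩ := hf
  obtain ⟨W, hW, h1, h2, h3⟩ := Scheme.PartialMap.toRationalMap_eq_iff.1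
    (show e.toPartialIso.toPartialMap.toRationalMap = f.left.toPartialMap.toRationalMap from he)
  refine ⟨W, hW, ?_⟩
  let k : (W : Scheme) ⟶ e.toPartialIso.source := X.left.homOfLE h1
  have h4 : W.ι ≫ f.left = k ≫ e.toPartialIso.iso.hom ≫ e.toPartialIso.target.ι := by
    refine Eq.trans ?_ h3.symm
    have h5 : X.left.homOfLE (show W ≤ ⊤ from le_top) ≫ (⊤ : X.left.Opens).ι = W.ι :=
      Scheme.homOfLE_ι _ _
    rw [← h5, Category.assoc]
    rfl
  have hk : IsOpenImmersion k := (inferInstance : IsOpenImmersion (X.left.homOfLE h1))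
  rw [h4]
  exact IsOpenImmersion.comp k _

/-- A finite birational morphism to a nonsingular variety is an isomorphism, since the target is
normal. -/
lemma isIso_of_isFinite_of_birational {X Y : Over SpecC} [IsIntegral X.left] [IsIntegral Y.left]
    {n : ℕ} [SmoothOfRelativeDimension n Y.hom] {f : X ⟶ Y}
    (hf : IsBirationalMorphism f) [IsFinite f.left] : IsIso f.left := by
  obtain ⟨W, hW, hW'⟩ := exists_isOpenImmersion_of_isBirationalMorphism hf
  choose V hV hy hd hn using exists_normal_nhd (n := n) Y.hom
  have hcov : ⨆ y, V y = ⊤ := top_le_iff.1 fun y _ =>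
    TopologicalSpace.Opens.mem_iSup.2 ⟨y, hy y⟩
  refine (IsZariskiLocalAtTarget.iff_of_iSup_eq_top
    (P := MorphismProperty.isomorphisms Scheme.{0}) V hcov).2 fun y => ?_
  change IsIso (f.left ∣_ V y)
  have h1 : (W : Set X.left).Nonempty := hW.nonempty
  have h2 : (((W.ι ≫ f.left).opensRange : Set Y.left) ∩ V y).Nonempty := by
    refine nonempty_preirreducible_inter (W.ι ≫ f.left).opensRange.isOpen (V y).isOpen ?_ ⟨y, hy y⟩
    obtain ⟨w, hw⟩ := h1
    exact ⟨_, ⟨w, hw⟩, rfl⟩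
  obtain ⟨z, hz, hz'⟩ := h2
  obtain ⟨s, ⟨z', hs1⟩, hs2⟩ := exists_smaller_chart (B := Γ(Y.left, V y)) (hV y).fromSpec (y := z)
    (by rw [(hV y).range_fromSpec]; exact hz') (W.ι ≫ f.left).opensRange hz
  set m := Spec.map (CommRingCat.ofHom (algebraMap Γ(Y.left, V y) (Localization.Away s)))
  have : IsOpenImmersion m := isOpenImmersion_localization s
  have hs0 : s ≠ 0 := by
    rintro rfl
    have : Subsingleton (Localization.Away (0 : Γ(Y.left, V y))) :=
      IsLocalization.subsingleton (M := Submonoid.powers (0 : Γ(Y.left, V y))) ⟨1, by simp⟩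
    exact (inferInstance : IsEmpty (PrimeSpectrum (Localization.Away (0 : Γ(Y.left, V y))))).elim z'
  let l := IsOpenImmersion.lift (W.ι ≫ f.left) (m ≫ (hV y).fromSpec) hs2
  have hl : l ≫ W.ι ≫ f.left = m ≫ (hV y).fromSpec := IsOpenImmersion.lift_fac _ _ _
  have : IsOpenImmersion l := by
    have : IsOpenImmersion (l ≫ W.ι ≫ f.left) := by rw [hl]; infer_instance
    exact IsOpenImmersion.of_comp l (W.ι ≫ f.left)
  have hr : Set.range (l ≫ W.ι) ⊆ Set.range (f.left ⁻¹ᵁ V y).ι := by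
    rw [Scheme.Opens.range_ι]
    rintro _ ⟨a, rfl⟩
    change f.left _ ∈ V y
    rw [← Scheme.Hom.comp_apply, Category.assoc, hl, ← SetLike.mem_coe, ← (hV y).range_fromSpec]
    exact ⟨m a, rfl⟩
  let j := IsOpenImmersion.lift (f.left ⁻¹ᵁ V y).ι (l ≫ W.ι) hr
  have hj : j ≫ (f.left ⁻¹ᵁ V y).ι = l ≫ W.ι := IsOpenImmersion.lift_fac _ _ _
  have : IsOpenImmersion j := by
    have : IsOpenImmersion (j ≫ (f.left ⁻¹ᵁ V y).ι) := by rw [hj]; infer_instance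
    exact IsOpenImmersion.of_comp j (f.left ⁻¹ᵁ V y).ι
  have : Nonempty (f.left ⁻¹ᵁ V y) := ⟨j z'⟩
  have : IsDominant j := ⟨j.opensRange.isOpen.dense ⟨_, ⟨z', rfl⟩⟩⟩
  have h3 : IsIso (f.left ∣_ V y ≫ (hV y).isoSpec.hom) := by
    refine isIso_of_isIntegralHom _ hs0 j ?_
    rw [← cancel_mono (hV y).fromSpec]
    simp only [Category.assoc]
    refine Eq.trans ?_ hl
    rw [← IsAffineOpen.isoSpec_inv_ι, Iso.hom_inv_id_assoc, morphismRestrict_ι, reassoc_of% hj]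
  exact (isIso_comp_right_iff _ (hV y).isoSpec.hom).1 h3

/-! ### Relative minimality of the ruling -/

lemma finite_or_eq_univ_of_isClosed {Z : Set (Spec (CommRingCat.of (Polynomial ℂ)))}
    (hZ : IsClosed Z) : Z.Finite ∨ Z = Set.univ := by
  obtain ⟨I, rfl⟩ := (PrimeSpectrum.isClosed_iff_zeroLocus_ideal (R := Polynomial ℂ) Z).1 hZ
  by_cases hI : I = ⊥
  · right
    subst hI
    exact PrimeSpectrum.zeroLocus_bot
  · left
    have h1 : {v : PrimeSpectrum (Polynomial ℂ) | v.asIdeal ≠ ⊥ ∧ I ≤ v.asIdeal}.Finite := by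
      refine ((Ideal.finite_factors hI).image
        (fun v => (⟨v.asIdeal, v.isPrime⟩ : PrimeSpectrum (Polynomial ℂ)))).subset ?_
      rintro v ⟨hv, hv'⟩
      exact ⟨⟨v.asIdeal, v.isPrime, hv⟩, Ideal.dvd_iff_le.2 hv', rfl⟩
    refine h1.subset fun v hv => ⟨fun h => hI ?_, hv⟩
    have hv' : I ≤ v.asIdeal := hv
    rwa [h, le_bot_iff] at hv'

namespace Line

/-- The standard charts of the line. -/
def κ (k : Fin 2) : Spec (CommRingCat.of (Polynomial ℂ)) ⟶ (projSpace 1).left :=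
  cpt (coord k Polynomial.X) k (isUnit_coord k _)

lemma isOpenImmersion_κ_and (k : Fin 2) : IsOpenImmersion (κ k) ∧
    ∀ x, x ∈ Set.range (κ k) ↔ x ∈ Proj.basicOpen (grading 1) (MvPolynomial.X k) := by
  refine cpt_isOpenImmersion (coord_self k _)
    (Polynomial.aeval (MvPolynomial.X (![1, 0] k))) (fun a => ?_) (fun i hi => ?_)
  · have : (MvPolynomial.aeval (coord k Polynomial.X)).comp
      (Polynomial.aeval (MvPolynomial.X (![1, 0] k))) = AlgHom.id ℂ (Polynomial ℂ) := by
      ext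
      fin_cases k <;> simp [coord]
    exact DFunLike.congr_fun this a
  · fin_cases k <;> fin_cases i <;> simp_all [coord]

instance (k : Fin 2) : IsOpenImmersion (κ k) := (isOpenImmersion_κ_and k).1

end Line

/-- A prime of a Noetherian ring which is the only prime containing some element has height at most
one. -/
lemma not_lt_of_forall_mem {A : Type} [CommRing A] [IsNoetherianRing A] {a : A}
    {p₀ p₁ p₂ : PrimeSpectrum A} (h2 : a ∈ p₂.asIdeal)
    (h : ∀ p : PrimeSpectrum A, a ∈ p.asIdeal → p = p₂) (h01 : p₀ < p₁) : ¬ p₁ < p₂ := by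
  intro h12
  have h3 : p₂.asIdeal ∈ (Ideal.span {a}).minimalPrimes := by
    refine ⟨⟨p₂.isPrime, (Ideal.span_singleton_le_iff_mem _).2 h2⟩, fun q hq _ => ?_⟩
    have := h ⟨q, hq.1⟩ ((Ideal.span_singleton_le_iff_mem _).1 hq.2)
    rw [← this]
  have h4 := Ideal.height_le_one_of_isPrincipal_of_mem_minimalPrimes _ _ h3
  have h5 := Ideal.height_le_iff.1 (show p₂.asIdeal.height ≤ (1 : ℕ) from h4) p₁.asIdeal p₁.isPrime h12
  have h6 : p₁.asIdeal.height ≤ (0 : ℕ) := (Order.lt_one_iff.1 h5).le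
  have h7 := Ideal.height_le_iff.1 h6 p₀.asIdeal p₀.isPrime h01
  simp at h7

namespace Scroll

/-- The inclusion of the line `x₁ = a` into the affine plane. -/
def hor (a : ℂ) : PlaneRing →ₐ[ℂ] Polynomial ℂ :=
  MvPolynomial.aeval ![Polynomial.X, Polynomial.C a]

lemma hor_κ_φ (a : ℂ) (k : Fin 2) :
    Spec.map (CommRingCat.ofHom (hor a).toRingHom) ≫ κ (lineChart k 0) ≫ φ.left = Line.κ k := by
  rw [κ_φ', SpecMap_cpt]
  have : hor a ∘ Line.coord k (MvPolynomial.X 0) = Line.coord k Polynomial.X := by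
    rw [Line.comp_coord]
    simp [hor]
  simp only [this]
  rfl

lemma exists_hor_ne_zero {h : PlaneRing} (hh : h ≠ 0) : ∃ a, hor a h ≠ 0 := by
  by_contra! H
  refine hh (MvPolynomial.funext fun v => ?_)
  have h1 := congrArg (Polynomial.eval (v 0)) (H (v 1))
  rw [Polynomial.eval_zero, ← Polynomial.coe_evalRingHom] at h1
  rw [map_zero, ← h1]
  have : (MvPolynomial.aeval v : PlaneRing →ₐ[ℂ] ℂ) =
      ((Polynomial.aeval (v 0)).comp (hor (v 1)) : PlaneRing →ₐ[ℂ] ℂ) := by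
    ext i
    fin_cases i <;> simp [hor]
  have h2 := DFunLike.congr_fun this h
  simpa [Polynomial.aeval_def, Polynomial.eval₂_eq_eval_map] using h2

/-- In every dense open set of the surface there are two points, one a proper specialization
of the other, the second of which specializes to a point of a given fibre of the ruling without
belonging to that fibre. -/
lemma exists_chain {W : surface.left.Opens} (hW : Dense (W : Set surface.left)) {k : Fin 2}
    (z : Spec (CommRingCat.of (Polynomial ℂ))) (hz : z.asIdeal ≠ ⊥) :
    ∃ g c p : surface.left, g ∈ W ∧ c ∈ W ∧ g ≠ c ∧ g ⤳ c ∧ c ⤳ p ∧ φ.left p = Line.κ k z ∧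
      φ.left c ≠ Line.κ k z := by
  obtain ⟨x, hx⟩ := (hW.preimage (κ (lineChart k 0)).isOpenEmbedding.isOpenMap).nonempty
  obtain ⟨_, ⟨h, rfl⟩, hxh, hsub⟩ := PrimeSpectrum.isTopologicalBasis_basic_opens.exists_subset_of_mem_open
    (show x ∈ (κ (lineChart k 0) ⁻¹ᵁ W) from hx) (κ (lineChart k 0) ⁻¹ᵁ W).isOpen
  have hh : h ≠ 0 := fun h0 => hxh (h0 ▸ zero_mem _)
  obtain ⟨a, ha⟩ := exists_hor_ne_zero hh
  let L := Spec.map (CommRingCat.ofHom (hor a).toRingHom)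
  let ξ : Spec (CommRingCat.of (Polynomial ℂ)) := (⊥ : PrimeSpectrum (Polynomial ℂ))
  let γ : Spec (CommRingCat.of PlaneRing) := (⊥ : PrimeSpectrum PlaneRing)
  have hφ : ∀ w, φ.left (κ (lineChart k 0) (L w)) = Line.κ k w := fun w => by
    rw [← hor_κ_φ a k]; rfl
  have h1 : L ξ ∈ κ (lineChart k 0) ⁻¹ᵁ W := hsub fun h0 => ha h0
  have h2 : γ ⤳ L ξ := (PrimeSpectrum.le_iff_specializes _ _).1 bot_le
  refine ⟨κ (lineChart k 0) γ, κ (lineChart k 0) (L ξ), κ (lineChart k 0) (L z),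
    h2.mem_open (κ (lineChart k 0) ⁻¹ᵁ W).isOpen h1, h1, fun h0 => ?_,
    h2.map (κ (lineChart k 0)).continuous,
    (((PrimeSpectrum.le_iff_specializes ξ z).1 bot_le).map L.continuous).map
      (κ (lineChart k 0)).continuous, hφ z, fun h0 => ?_⟩
  · have h3 : γ = L ξ := (κ (lineChart k 0)).isOpenEmbedding.injective h0
    have h4 : (MvPolynomial.X 1 - MvPolynomial.C a : PlaneRing) ∈ (L ξ).asIdeal := by
      change hor a _ = 0
      simp [hor]
    rw [← h3] at h4
    have h5 : (MvPolynomial.X 1 - MvPolynomial.C a : PlaneRing) = 0 := h4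
    have h6 := congrArg (MvPolynomial.aeval (fun _ => a + 1 : Fin 2 → ℂ)) h5
    simp at h6
  · rw [hφ] at h0
    have h3 : ξ = z := (Line.κ k).isOpenEmbedding.injective h0
    exact hz (h3 ▸ rfl)

/-- A birational morphism from the surface over the line does not contract a fibre of the ruling:
otherwise the image point would be a whole fibre of `ψ`, defined by one equation, although there is
a chain of two specializations ending in it. -/
lemma exists_apply_ne {Y : Over SpecC} [LocallyOfFiniteType Y.hom]
    {f : surface ⟶ Y} {ψ : Y ⟶ projSpace 1} (hψ : f ≫ ψ = φ) (hf : Function.Surjective f.left)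
    {W : surface.left.Opens} (hW : Dense (W : Set surface.left))
    [IsOpenImmersion (W.ι ≫ f.left)] {y : Y.left} (hy : IsClosed {ψ.left y}) :
    ∃ x, φ.left x = ψ.left y ∧ f.left x ≠ y := by
  by_contra! H
  have hψ' : ∀ x, ψ.left (f.left x) = φ.left x := fun x => by rw [← hψ]; rfl
  obtain ⟨k, hk⟩ := exists_mem_basicOpen_X (n := 1) (ψ.left y)
  obtain ⟨z, hz⟩ := ((Line.isOpenImmersion_κ_and k).2 _).2 hk
  have hzc : IsClosed {z} := by
    have h1 : {z} = Line.κ k ⁻¹' {ψ.left y} := by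
      ext w
      rw [Set.mem_preimage, ← hz, Set.mem_singleton_iff, Set.mem_singleton_iff]
      exact ((Line.κ k).isOpenEmbedding.injective.eq_iff).symm
    rw [h1]
    exact hy.preimage (Line.κ k).continuous
  have hzm : z.asIdeal.IsMaximal := (PrimeSpectrum.isClosed_singleton_iff_isMaximal z).1 hzc
  have hzb : z.asIdeal ≠ ⊥ := by
    intro h0
    rw [h0] at hzm
    exact Polynomial.not_isField ℂ (Ring.isField_iff_maximal_bot.2 hzm)
  obtain ⟨g, c, p, hg, hc, hgc, hgc', hcp, hp, hcz⟩ := exists_chain hW (k := k) z hzb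
  have hpy : f.left p = y := H p (hp.trans hz)
  have hcy : f.left c ≠ y := fun h0 => hcz (by rw [← hψ', h0, hz])
  have hfgc : f.left g ≠ f.left c := by
    intro h0
    have h1 : (⟨g, hg⟩ : W) = ⟨c, hc⟩ := (W.ι ≫ f.left).isOpenEmbedding.injective h0
    exact hgc (congrArg Subtype.val h1)
  -- An affine neighbourhood of `y` that maps to the chart of the line.
  obtain ⟨_, ⟨V, hV, rfl⟩, hyV, hVU⟩ := Y.left.isBasis_affineOpens.exists_subset_of_mem_open
    (show y ∈ ψ.left ⁻¹ᵁ (Line.κ k).opensRange from ⟨z, hz⟩)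
    (ψ.left ⁻¹ᵁ (Line.κ k).opensRange).isOpen
  let j := hV.fromSpec
  have hjo : IsOpenImmersion j := hV.isOpenImmersion_fromSpec
  have hj : Set.range j = V := hV.range_fromSpec
  have hN : IsLocallyNoetherian Y.left := LocallyOfFiniteType.isLocallyNoetherian Y.hom
  have hA : IsNoetherianRing Γ(Y.left, V) := hN.component_noetherian ⟨V, hV⟩
  have hr : Set.range (j ≫ ψ.left) ⊆ Set.range (Line.κ k) := by
    rintro _ ⟨a, rfl⟩
    exact hVU (hj ▸ ⟨a, rfl⟩ : j a ∈ (V : Set Y.left))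
  let l := IsOpenImmersion.lift (Line.κ k) (j ≫ ψ.left) hr
  have hl : l ≫ Line.κ k = j ≫ ψ.left := IsOpenImmersion.lift_fac _ _ _
  have hl' : ∀ a, Line.κ k (l a) = ψ.left (j a) := fun a =>
    congrArg (fun q => q a) (congrArg (fun q : Spec Γ(Y.left, V) ⟶ (projSpace 1).left => ⇑q) hl)
  obtain ⟨r, hr⟩ := Spec.map_surjective l
  obtain ⟨a₂, ha₂⟩ : y ∈ Set.range j := by rw [hj]; exact hyV
  have hs12 : f.left c ⤳ y := hpy ▸ hcp.map f.left.continuous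
  have hs01 : f.left g ⤳ f.left c := hgc'.map f.left.continuous
  have hcV : f.left c ∈ (V : Set Y.left) := hs12.mem_open V.isOpen hyV
  obtain ⟨a₁, ha₁⟩ : f.left c ∈ Set.range j := by rw [hj]; exact hcV
  obtain ⟨a₀, ha₀⟩ : f.left g ∈ Set.range j := by
    rw [hj]; exact hs01.mem_open V.isOpen hcV
  have h01 : a₀ ⤳ a₁ := (j.isOpenEmbedding.isInducing.specializes_iff).1 (by rwa [ha₀, ha₁])
  have h12 : a₁ ⤳ a₂ := (j.isOpenEmbedding.isInducing.specializes_iff).1 (by rwa [ha₁, ha₂])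
  have h01' : @LT.lt (PrimeSpectrum Γ(Y.left, V)) _ a₀ a₁ := 
    lt_of_le_of_ne ((PrimeSpectrum.le_iff_specializes a₀ a₁).2 h01)
    fun h0 => hfgc (by rw [← ha₀, ← ha₁, h0])
  have h12' : @LT.lt (PrimeSpectrum Γ(Y.left, V)) _ a₁ a₂ := 
    lt_of_le_of_ne ((PrimeSpectrum.le_iff_specializes a₁ a₂).2 h12)
    fun h0 => hcy (by rw [← ha₂, ← ha₁, h0])
  obtain ⟨π₀, hπ₀⟩ := (IsPrincipalIdealRing.principal z.asIdeal).principal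
  have hmem : ∀ a : Spec Γ(Y.left, V), r.hom π₀ ∈ a.asIdeal ↔ l a = z := by
    intro a
    have h1 : r.hom π₀ ∈ a.asIdeal ↔ π₀ ∈ (l a).asIdeal := by rw [← hr]; rfl
    rw [h1]
    constructor
    · intro h2
      have h3 : z.asIdeal ≤ (l a).asIdeal := by
        rw [hπ₀, Submodule.span_singleton_le_iff_mem]
        exact h2
      exact (PrimeSpectrum.ext (hzm.eq_of_le (l a).isPrime.ne_top h3)).symm
    · intro h2
      rw [h2, hπ₀]
      exact Submodule.mem_span_singleton_self _
  -- The equation `π₀` of the point of the line vanishes at `y` only, which contradicts the chain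
  -- of primes.
  refine not_lt_of_forall_mem (A := Γ(Y.left, V)) (a := r.hom π₀) (p₂ := a₂) ?_ ?_ h01' h12'
  · refine (hmem a₂).2 ((Line.κ k).isOpenEmbedding.injective ?_)
    exact (hl' a₂).trans (by rw [ha₂, hz])
  · intro a ha
    have h1 := hl' a
    rw [(hmem a).1 ha, hz] at h1
    obtain ⟨x, hx⟩ := hf (j a)
    refine j.isOpenEmbedding.injective ?_
    rw [ha₂, ← hx]
    refine H x ?_
    rw [← hψ', hx, ← h1]

/-- Proper closed subsets of the fibres of the ruling are finite, since the fibres are irreducible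
curves. -/
lemma finite_or_fibre_subset {t : (projSpace 1).left} (ht : IsClosed {t}) {Z : Set surface.left}
    (hZ : IsClosed Z) (hZt : Z ⊆ φ.left ⁻¹' {t}) : Z.Finite ∨ φ.left ⁻¹' {t} ⊆ Z := by
  obtain ⟨κ', h1, h2, η', h3, -⟩ := exists_fibre_charts ht
  have (j : Fin 2) : IsSchemeTheoreticallyDominant
      (Spec.map (CommRingCat.ofHom (Conic.e j).toRingHom)) :=
    isSchemeTheoreticallyDominant_SpecMap (Conic.e_injective j)
  have : IsIntegral (φ.left.fiber t) := isIntegral_of_charts _ κ' h2 η' _ h3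
  have hc : IsClosed (φ.left.fiberι t ⁻¹' Z) := hZ.preimage (φ.left.fiberι t).continuous
  by_cases H : ∃ j, κ' j ⁻¹' (φ.left.fiberι t ⁻¹' Z) = Set.univ
  · right
    obtain ⟨j, hj⟩ := H
    have hd : Dense (Set.range (κ' j)) := (κ' j).opensRange.isOpen.dense
      ⟨_, ⟨(⊥ : PrimeSpectrum (Polynomial ℂ)), rfl⟩⟩
    have hu : φ.left.fiberι t ⁻¹' Z = Set.univ := by
      refine Set.univ_subset_iff.1 ?_
      rw [← hd.closure_eq]
      refine closure_minimal ?_ hc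
      rintro _ ⟨w, rfl⟩
      exact (Set.eq_univ_iff_forall.1 hj w : w ∈ κ' j ⁻¹' (φ.left.fiberι t ⁻¹' Z))
    rw [← Scheme.Hom.range_fiberι]
    rintro _ ⟨w, rfl⟩
    exact Set.eq_univ_iff_forall.1 hu w
  · left
    push Not at H
    have h4 : ∀ j, (κ' j ⁻¹' (φ.left.fiberι t ⁻¹' Z)).Finite := fun j =>
      (finite_or_eq_univ_of_isClosed (hc.preimage (κ' j).continuous)).resolve_right (H j)
    refine (Set.finite_iUnion fun j => (h4 j).image fun w => φ.left.fiberι t (κ' j w)).subset ?_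
    intro x hx
    obtain ⟨w, rfl⟩ : x ∈ Set.range (φ.left.fiberι t) := by
      rw [Scheme.Hom.range_fiberι]; exact hZt hx
    obtain ⟨j, u, rfl⟩ := h2 w
    exact Set.mem_iUnion.2 ⟨j, u, hx, rfl⟩

/-- A birational morphism over the line from the ruled surface to a nonsingular projective surface
is an isomorphism. -/
lemma isIso_of_isBirationalMorphism {Y : Over SpecC} (hY : IsSmoothProjectiveSurface Y)
    {f : surface ⟶ Y} {ψ : Y ⟶ projSpace 1} (hψ : f ≫ ψ = φ) (hf : IsBirationalMorphism f) :
    IsIso f := by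
  obtain ⟨hint, hsm, n, i, hi⟩ := hY
  obtain ⟨W, hW, hW'⟩ := exists_isOpenImmersion_of_isBirationalMorphism hf
  have hproper : IsProper Y.hom := by
    rw [← Over.w i]; infer_instance
  have hft : LocallyOfFiniteType Y.hom := inferInstance
  have hfp : IsProper f.left := by
    have : IsProper (f.left ≫ Y.hom) := by rw [Over.w f]; infer_instance
    exact IsProper.of_comp f.left Y.hom
  have hsurj : Function.Surjective f.left := by
    rw [← Set.range_eq_univ, ← f.left.isClosedMap.isClosed_range.closure_eq]
    refine Set.univ_subset_iff.1 ?_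
    rw [← ((W.ι ≫ f.left).opensRange.isOpen.dense ?_).closure_eq]
    · refine closure_mono ?_
      rintro _ ⟨w, rfl⟩
      exact ⟨W.ι w, rfl⟩
    · obtain ⟨w, hw⟩ := hW.nonempty
      exact ⟨_, ⟨⟨w, hw⟩, rfl⟩⟩
  have hJ : JacobsonSpace Y.left := LocallyOfFiniteType.jacobsonSpace Y.hom
  have hJ' : JacobsonSpace (projSpace 1).left := LocallyOfFiniteType.jacobsonSpace (projSpace 1).hom
  have hψft : LocallyOfFiniteType ψ.left := by
    have : LocallyOfFiniteType (ψ.left ≫ (projSpace 1).hom) := by rw [Over.w ψ]; infer_instance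
    exact locallyOfFiniteType_of_comp ψ.left (projSpace 1).hom
  -- The preimage of a closed point is a closed subset of a fibre of the ruling, but not the whole
  -- fibre.
  have hfin : ∀ y : Y.left, IsClosed {y} → (f.left ⁻¹' {y}).Finite := by
    intro y hy
    have ht : IsClosed {ψ.left y} := ψ.left.closePoints_subset_preimage_closedPoints hy
    refine (finite_or_fibre_subset ht (hy.preimage f.left.continuous) ?_).resolve_right fun H => ?_
    · rintro x rfl
      change φ.left x = _
      rw [← hψ]
      rfl
    · obtain ⟨x, hx, hx'⟩ := exists_apply_ne hψ hsurj hW ht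
      exact hx' (H hx)
  -- By the theorem of Zariski on proper morphisms with finite fibres, `f` is finite near every
  -- closed point of `Y`, and the closed points meet every nonempty closed set.
  have : IsFinite f.left := by
    choose V hyV hV using fun y : {y : Y.left // IsClosed {y}} =>
      exists_isFinite_morphismRestrict_of_finite_preimage_singleton f.left y.1 (hfin y.1 y.2)
    have hloc : IsZariskiLocalAtTarget @IsIntegralHom.{0} :=
      (HasAffineProperty.iff.1 IsIntegralHom.hasAffineProperty.{0}).1
    refine (IsFinite.iff_isIntegralHom_and_locallyOfFiniteType f.left).2 ⟨?_, inferInstance⟩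
    refine (IsZariskiLocalAtTarget.iff_of_iSup_eq_top (P := @IsIntegralHom.{0}) V ?_).2
      fun y => have := hV y; inferInstance
    by_contra H
    have h1 : ((⨆ y, V y : Y.left.Opens) : Set Y.left)ᶜ.Nonempty := by
      rw [Set.nonempty_compl]
      exact fun h0 => H (TopologicalSpace.Opens.ext h0)
    obtain ⟨y, hy, hyc⟩ := nonempty_inter_closedPoints h1
      (⨆ y, V y : Y.left.Opens).isOpen.isClosed_compl.isLocallyClosed
    exact hy (TopologicalSpace.Opens.mem_iSup.2 ⟨⟨y, hyc⟩, hyV _⟩)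
  have := isIso_of_isFinite_of_birational (n := 2) hf
  have : IsIso ((Over.forget SpecC).map f) := this
  exact isIso_of_reflects_iso f (Over.forget SpecC)

end Scroll

/-! ### Curves in the plane meet -/

namespace Plane

open MvPolynomial

lemma mem_idealOfVars_iff {F : MvPolynomial (Fin 3) ℂ} :
    F ∈ idealOfVars (Fin 3) ℂ ↔ constantCoeff F = 0 := by
  rw [← pow_one (idealOfVars (Fin 3) ℂ), mem_pow_idealOfVars_iff', constantCoeff_eq]
  constructor
  · intro h
    exact h 0 (by simp)
  · intro h x hx
    rw [(Finsupp.degree_eq_zero_iff x).1 (Nat.lt_one_iff.1 hx), h]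

lemma isPrime_idealOfVars : (idealOfVars (Fin 3) ℂ).IsPrime := by
  have : idealOfVars (Fin 3) ℂ = RingHom.ker (constantCoeff (σ := Fin 3) (R := ℂ)) := by
    ext F
    exact mem_idealOfVars_iff
  rw [this]
  exact RingHom.ker_isPrime _

/-- The irrelevant ideal is generated by three elements. -/
lemma height_idealOfVars_le : (idealOfVars (Fin 3) ℂ).height ≤ 3 := by
  have h := Ideal.height_le_card_of_mem_minimalPrimes_span
    (s := Set.range (X : Fin 3 → MvPolynomial (Fin 3) ℂ)) (p := idealOfVars (Fin 3) ℂ)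
    (Set.finite_range _) ⟨⟨isPrime_idealOfVars, le_rfl⟩, fun _ h _ => h.2⟩
  refine h.trans ?_
  have : (Set.range (X : Fin 3 → MvPolynomial (Fin 3) ℂ)).ncard = 3 := by
    rw [← Set.image_univ, Set.ncard_image_of_injective _ (X_injective)]
    simp
  rw [this]
  rfl

/-- The substitution of zero for the first `k` variables. -/
def kill (k : ℕ) : MvPolynomial (Fin 3) ℂ →ₐ[ℂ] MvPolynomial (Fin 3) ℂ :=
  aeval fun i => if (i : ℕ) < k then 0 else X i

lemma kill_X (k : ℕ) (i : Fin 3) : kill k (X i) = if (i : ℕ) < k then 0 else X i := aeval_X _ _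

lemma ker_kill_lt {k : ℕ} (hk : k < 3) :
    RingHom.ker (kill k).toRingHom < RingHom.ker (kill (k + 1)).toRingHom := by
  refine lt_of_le_of_ne ?_ fun h => ?_
  · have h1 : (kill (k + 1)).comp (kill k) = kill (k + 1) := by
      refine algHom_ext fun i => ?_
      rw [AlgHom.comp_apply, kill_X, kill_X]
      split_ifs with h2 h3 h3
      · exact map_zero _
      · omega
      · rw [kill_X, if_pos h3]
      · rw [kill_X, if_neg h3]
    intro F hF
    change kill (k + 1) F = 0
    rw [← h1, AlgHom.comp_apply, show kill k F = 0 from hF, map_zero]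
  · have h1 : (X ⟨k, hk⟩ : MvPolynomial (Fin 3) ℂ) ∈ RingHom.ker (kill k).toRingHom := by
      rw [h]
      change kill (k + 1) (X ⟨k, hk⟩) = 0
      rw [kill_X, if_pos (Nat.lt_succ_self k)]
    have h2 : kill k (X ⟨k, hk⟩) = 0 := h1
    rw [kill_X, if_neg (lt_irrefl k)] at h2
    exact X_ne_zero _ h2

instance (k : ℕ) : (RingHom.ker (kill k).toRingHom).IsPrime := RingHom.ker_isPrime _

/-- The ideals generated by the first variables form a chain of primes. -/
lemma le_height_ker_kill {k : ℕ} (hk : k ≤ 3) :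
    (k : ℕ∞) ≤ (RingHom.ker (kill k).toRingHom).height := by
  induction k with
  | zero => simp
  | succ k ih =>
    refine le_trans ?_ (Ideal.height_add_one_le_of_lt_of_isPrime (ker_kill_lt (k := k) (by omega)))
    push_cast
    gcongr
    exact ih (by omega)

lemma le_height_idealOfVars : 3 ≤ (idealOfVars (Fin 3) ℂ).height := by
  refine (le_height_ker_kill le_rfl).trans (Ideal.height_mono ?_)
  intro F hF
  have h1 : (constantCoeff (σ := Fin 3) (R := ℂ)).comp (kill 3).toRingHom = constantCoeff := by
    refine ringHom_ext (fun c => ?_) fun i => ?_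
    · change constantCoeff (kill 3 (C c)) = _
      rw [algHom_C]
      rfl
    · change constantCoeff (kill 3 (X i)) = _
      rw [kill_X, if_pos i.2]
      simp
  rw [mem_idealOfVars_iff, ← h1, RingHom.comp_apply, show (kill 3).toRingHom F = 0 from hF,
    map_zero]

lemma decompose_zero (F : MvPolynomial (Fin 3) ℂ) :
    (DirectSum.decompose (grading 2) F 0 : MvPolynomial (Fin 3) ℂ) = C (constantCoeff F) :=
  (decomposition.decompose'_apply F 0).trans (homogeneousComponent_zero F)

lemma asIdeal_lt_idealOfVars (x : ProjectiveSpectrum (grading 2)) :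
    x.asHomogeneousIdeal.toIdeal < idealOfVars (Fin 3) ℂ := by
  refine lt_of_le_of_ne ?_ ?_
  · intro F hF
    rw [mem_idealOfVars_iff]
    by_contra h0
    refine x.isPrime.ne_top ((Ideal.eq_top_iff_one _).2 ?_)
    have h1 := x.asHomogeneousIdeal.isHomogeneous 0 hF
    rw [decompose_zero] at h1
    have h2 := Ideal.mul_mem_left x.asHomogeneousIdeal.toIdeal (C (constantCoeff F)⁻¹) h1
    rwa [← C_mul, inv_mul_cancel₀ h0, C_1] at h2
  · intro h
    refine x.not_irrelevant_le ?_
    intro F hF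
    change F ∈ x.asHomogeneousIdeal.toIdeal
    rw [h, mem_idealOfVars_iff]
    have h1 := (HomogeneousIdeal.mem_irrelevant_iff (grading 2) F).1 hF
    rw [GradedRing.proj_apply, decompose_zero] at h1
    exact C_injective _ _ (h1.trans C_0.symm)

/-- A non-closed point of the plane has a principal ideal: its height is at most one, as the
irrelevant ideal has height three, and the polynomial ring is factorial. -/
lemma isPrincipal_asIdeal {x y : ProjectiveSpectrum (grading 2)} (h : x < y) :
    x.asHomogeneousIdeal.toIdeal.IsPrincipal := by
  have h1 := Ideal.height_add_one_le_of_lt_of_isPrime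
    (show x.asHomogeneousIdeal.toIdeal < y.asHomogeneousIdeal.toIdeal from h)
  have h2 := @Ideal.height_add_one_le_of_lt_of_isPrime _ _ _ _ y.isPrime isPrime_idealOfVars
    (asIdeal_lt_idealOfVars y)
  have h3 : x.asHomogeneousIdeal.toIdeal.height ≤ 1 := by
    have h4 := (add_le_add_left h1 1).trans (h2.trans height_idealOfVars_le)
    generalize x.asHomogeneousIdeal.toIdeal.height = a at h4
    induction a with
    | top => simp at h4
    | coe a => norm_cast at h4 ⊢; omega
  rcases h3.eq_or_lt with h4 | h4
  · exact UniqueFactorizationMonoid.iff_forall_isPrincipal_of_height_eq_one.1 inferInstance _ h4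
  · have h5 : x.asHomogeneousIdeal.toIdeal.height = 0 := by
      simpa [Order.lt_one_iff] using h4
    rw [Ideal.height_eq_zero_iff, IsDomain.minimalPrimes_eq_singleton_bot] at h5
    rw [show x.asHomogeneousIdeal.toIdeal = ⊥ from h5]
    exact inferInstance

/-- Two curves in the plane meet. -/
lemma exists_le {x₀ x₁ y₀ y₁ : ProjectiveSpectrum (grading 2)} (h₀ : x₀ < y₀) (h₁ : x₁ < y₁) :
    ∃ z, x₀ ≤ z ∧ x₁ ≤ z := by
  obtain ⟨F, hF⟩ := isPrincipal_asIdeal h₀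
  obtain ⟨F', hF'⟩ := isPrincipal_asIdeal h₁
  have h1 : Ideal.span {F, F'} = x₀.asHomogeneousIdeal.toIdeal ⊔ x₁.asHomogeneousIdeal.toIdeal := by
    rw [Ideal.span_insert, hF, hF']
  have h2 : Ideal.span {F, F'} ≤ idealOfVars (Fin 3) ℂ := by
    rw [h1]
    exact sup_le (asIdeal_lt_idealOfVars x₀).le (asIdeal_lt_idealOfVars x₁).le
  have hM : (idealOfVars (Fin 3) ℂ).IsPrime := isPrime_idealOfVars
  obtain ⟨P, hP, -⟩ := @Ideal.exists_minimalPrimes_le _ _ _ _ hM h2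
  have hPp : P.IsPrime := hP.1.1
  -- By the height theorem, a prime that is minimal over two equations has height at most two, so
  -- it differs from the irrelevant ideal.
  have hht : P.height ≤ 2 := by
    refine (Ideal.height_le_card_of_mem_minimalPrimes_span (Set.toFinite _) hP).trans ?_
    have h3 := Set.ncard_insert_le F {F'}
    rw [Set.ncard_singleton] at h3
    exact_mod_cast h3
  have hle : ∀ x : ProjectiveSpectrum (grading 2), x.asHomogeneousIdeal.toIdeal ≤ P →
      x.asHomogeneousIdeal ≤ P.homogeneousCore (grading 2) := fun x hx =>
    (Ideal.homogeneousCore.gc (grading 2) x.asHomogeneousIdeal P).1 hx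
  refine ⟨⟨P.homogeneousCore (grading 2), hPp.homogeneousCore, fun h => ?_⟩, ?_, ?_⟩
  · have h3 : idealOfVars (Fin 3) ℂ ≤ P := by
      refine Ideal.span_le.2 ?_
      rintro _ ⟨i, rfl⟩
      exact Ideal.toIdeal_homogeneousCore_le _ _
        (h (HomogeneousIdeal.mem_irrelevant_of_mem _ one_pos (X_mem i)))
    have h4 := le_height_idealOfVars.trans ((Ideal.height_mono h3).trans hht)
    norm_num at h4
  · exact hle x₀ (le_sup_left.trans (h1.ge.trans hP.1.2))
  · exact hle x₁ (le_sup_right.trans (h1.ge.trans hP.1.2))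

/-- Two non-closed points of the plane, that is, the generic points of curves or of the plane,
have a common specialization. -/
lemma exists_specializes {x₀ x₁ y₀ y₁ : (projSpace 2).left} (h₀ : x₀ ⤳ y₀) (h₀' : x₀ ≠ y₀)
    (h₁ : x₁ ⤳ y₁) (h₁' : x₁ ≠ y₁) : ∃ z, x₀ ⤳ z ∧ x₁ ⤳ z := by
  have key (x y : ProjectiveSpectrum (grading 2)) : x ≤ y ↔ x ⤳ y := by
    rw [ProjectiveSpectrum.le_iff_mem_closure, specializes_iff_mem_closure]
  obtain ⟨z, hz₀, hz₁⟩ := exists_le (lt_of_le_of_ne ((key x₀ y₀).2 h₀) h₀')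
    (lt_of_le_of_ne ((key x₁ y₁).2 h₁) h₁')
  exact ⟨z, (key x₀ z).1 hz₀, (key x₁ z).1 hz₁⟩

end Plane

lemma isClosed_singleton_of_isClosedImmersion {X : Scheme.{0}} (s : SpecC ⟶ X)
    [IsClosedImmersion s] (u : SpecC) : IsClosed {s u} := by
  convert s.isClosedEmbedding.isClosed_range
  ext z
  constructor
  · rintro rfl
    exact ⟨u, rfl⟩
  · rintro ⟨w, rfl⟩
    exact congrArg s (Subsingleton.elim (α := PrimeSpectrum ℂ) _ _)

namespace Scroll

/-- A fibre of the ruling contains a point that is not closed. -/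
lemma exists_specializes_fibre (b : ℂ) : ∃ x y : surface.left, x ⤳ y ∧ x ≠ y ∧
    ∀ u, φ.left x = cpt (Line.coord 0 b) 0 (Line.isUnit_coord 0 b) u := by
  let s : Spec (CommRingCat.of (Polynomial ℂ)) ⟶ Spec (CommRingCat.of PlaneRing) :=
    Spec.map (CommRingCat.ofHom (vert b).toRingHom)
  have hs : IsClosedImmersion s := IsClosedImmersion.spec_of_surjective _ (vert_surjective b)
  have hφ : s ≫ κ (lineChart 0 0) ≫ φ.left =
      Spec.map (CommRingCat.ofHom (algebraMap ℂ (Polynomial ℂ))) ≫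
        cpt (Line.coord 0 b) 0 (Line.isUnit_coord 0 b) := by
    rw [κ_φ']
    refine (SpecMap_cpt (vert b) _ _ _).trans ?_
    refine Eq.trans ?_ (SpecMap_cpt (Algebra.ofId ℂ (Polynomial ℂ)) _ _ _).symm
    have h1 : (vert b ∘ Line.coord 0 (MvPolynomial.X 0) : Fin 2 → Polynomial ℂ) =
        Algebra.ofId ℂ (Polynomial ℂ) ∘ Line.coord 0 b := by
      rw [Line.comp_coord, Line.comp_coord]
      congr 1
      simp [vert, Algebra.ofId_apply]
    simp only [h1]
  let g : Spec (CommRingCat.of (Polynomial ℂ)) := (⊥ : PrimeSpectrum (Polynomial ℂ))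
  let c : Spec (CommRingCat.of (Polynomial ℂ)) :=
    ⟨Ideal.span {Polynomial.X}, (Ideal.span_singleton_prime Polynomial.X_ne_zero).2
      Polynomial.prime_X⟩
  have hgc : g ⤳ c := (PrimeSpectrum.le_iff_specializes (R := Polynomial ℂ) g c).1 bot_le
  refine ⟨(s ≫ κ (lineChart 0 0)) g, (s ≫ κ (lineChart 0 0)) c,
    hgc.map (s ≫ κ (lineChart 0 0)).continuous, fun h => ?_, fun u => ?_⟩
  · have h1 : g = c := s.isClosedEmbedding.injective ((κ (lineChart 0 0)).isOpenEmbedding.injective h)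
    have h2 : (⊥ : Ideal (Polynomial ℂ)) = Ideal.span {Polynomial.X} :=
      congrArg PrimeSpectrum.asIdeal h1
    exact Polynomial.X_ne_zero (Ideal.span_singleton_eq_bot.1 h2.symm)
  · have h1 := congrArg (fun q : Spec (CommRingCat.of (Polynomial ℂ)) ⟶ (projSpace 1).left => q g) hφ
    refine h1.trans ?_
    change cpt (Line.coord 0 b) 0 (Line.isUnit_coord 0 b) _ = _
    congr 1
    exact Subsingleton.elim (α := PrimeSpectrum ℂ) _ _

/-- The ruled surface is not isomorphic to the plane, since it has disjoint curves. -/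
lemma isEmpty_iso_plane : IsEmpty (surface ≅ projSpace 2) := by
  refine ⟨fun E => ?_⟩
  have hE : IsIso E.hom.left := (inferInstance : IsIso ((Over.forget SpecC).map E.hom))
  have hinj : Function.Injective E.hom.left := E.hom.left.isOpenEmbedding.injective
  let u : SpecC := (⊥ : PrimeSpectrum ℂ)
  let t (b : ℂ) : (projSpace 1).left := cpt (Line.coord 0 b) 0 (Line.isUnit_coord 0 b) u
  have ht (b : ℂ) : IsClosed {t b} := by
    have := Line.isClosedImmersion_cpt (Line.coord 0 b) 0 (Line.isUnit_coord 0 b)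
    exact isClosed_singleton_of_isClosedImmersion _ u
  obtain ⟨x₀, y₀, h₀, h₀', hx₀⟩ := exists_specializes_fibre 0
  obtain ⟨x₁, y₁, h₁, h₁', hx₁⟩ := exists_specializes_fibre 1
  obtain ⟨z, hz₀, hz₁⟩ := Plane.exists_specializes
    (h₀.map E.hom.left.continuous) (fun h => h₀' (hinj h))
    (h₁.map E.hom.left.continuous) (fun h => h₁' (hinj h))
  obtain ⟨w, rfl⟩ : ∃ w, E.hom.left w = z := E.hom.left.surjective z
  have key (b : ℂ) (x : surface.left) (hx : φ.left x = t b) (hz : E.hom.left x ⤳ E.hom.left w) :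
      φ.left w = t b := by
    have h1 : x ⤳ w := E.hom.left.isOpenEmbedding.isInducing.specializes_iff.1 hz
    have h2 := h1.map φ.left.continuous
    rw [hx] at h2
    exact h2.mem_closed (ht b) rfl
  have h3 : t 0 = t 1 := (key 0 x₀ (hx₀ u) hz₀).symm.trans (key 1 x₁ (hx₁ u) hz₁)
  have h4 (b : ℂ) : t b ∈ Proj.basicOpen (grading 1) (MvPolynomial.X 1) ↔ b ≠ 0 := by
    refine (cpt_mem_basicOpen _ _ _ (X_mem 1) one_pos u).trans ?_
    rw [MvPolynomial.aeval_X]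
    exact Iff.rfl
  exact (h4 0).1 (h3 ▸ (h4 1).2 one_ne_zero) rfl

end Scroll

/-! ### Linear automorphisms and blowups -/

section LinearAction

variable {n : ℕ} {A : Type} [CommRing A] [Algebra ℂ A]

lemma linearAction_hom (M : Matrix.SpecialLinearGroup (Fin (n + 1)) ℂ) :
    (linearAction n M).hom = linearMap M := rfl

lemma linearMap_mul (M N : Matrix.SpecialLinearGroup (Fin (n + 1)) ℂ) :
    linearMap (M * N) = linearMap N ≫ linearMap M := by
  rw [← linearAction_hom, map_mul]
  rfl

instance (M : Matrix.SpecialLinearGroup (Fin (n + 1)) ℂ) : IsIso (linearMap M) :=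
  Iso.isIso_hom (linearAction n M)

instance (M : Matrix.SpecialLinearGroup (Fin (n + 1)) ℂ) : IsIso (linearMap M).left :=
  (inferInstance : IsIso ((Over.forget SpecC).map (linearMap M)))

/-- The product of a complex matrix with a vector with entries in a `ℂ`-algebra. -/
def act (M : Matrix (Fin (n + 1)) (Fin (n + 1)) ℂ) (v : Fin (n + 1) → A) : Fin (n + 1) → A :=
  fun i => ∑ j, algebraMap ℂ A (M i j) * v j

/-- The automorphism defined by `M` is `v ↦ M v` on points. -/
lemma cpt_linearMap (M : Matrix.SpecialLinearGroup (Fin (n + 1)) ℂ) (v : Fin (n + 1) → A)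
    {k l : Fin (n + 1)} (hk : IsUnit (v k)) (hl : IsUnit (act M.1 v l)) :
    cpt v k hk ≫ (linearMap M).left = cpt (act M.1 v) l hl := by
  have h1 : (coords v).comp (gradedSubst M.1).toRingHom = coords (act M.1 v) := by
    refine MvPolynomial.ringHom_ext (fun c => ?_) fun i => ?_
    · refine (congrArg (coords v) ((subst M.1).commutes c)).trans ?_
      exact (coords_C v c).trans (coords_C _ c).symm
    · refine (congrArg (coords v) (MvPolynomial.aeval_X _ i)).trans ?_
      rw [map_sum, coords_X]
      refine Finset.sum_congr rfl fun j _ => ?_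
      rw [map_mul, coords_C, coords_X]
  have h2 : (coords v) (gradedSubst M.1 (MvPolynomial.X l)) =
      coords (act M.1 v) (MvPolynomial.X l) := by
    rw [← h1]
    rfl
  have h3 : IsUnit ((coords v) (gradedSubst M.1 (MvPolynomial.X l))) := by
    rw [h2, coords_X]
    exact hl
  refine (pt_comp_map (coords v) (X_mem k) one_pos _ (X_mem l) one_pos (gradedSubst M.1)
    (irrelevant_le_map M) h3).trans ?_
  unfold cpt
  congr 1

end LinearAction

/-- An isomorphism of ambient schemes takes the ideal of a subscheme to that of its image. -/
lemma ker_comp_comap {X Y Y' : Scheme.{0}} (f : X ⟶ Y) (h : Y ⟶ Y') [IsIso h] :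
    (f ≫ h).ker.comap h = f.ker := by
  refine le_antisymm ?_ ?_
  · rw [← Scheme.IdealSheafData.le_map_iff_comap_le, Scheme.IdealSheafData.map_ker]
  · have h1 : f.ker.comap (inv h) ≤ (f ≫ h).ker := by
      rw [← Scheme.IdealSheafData.le_map_iff_comap_le, Scheme.IdealSheafData.map_ker,
        Category.assoc, IsIso.hom_inv_id, Category.comp_id]
    have h2 := Scheme.IdealSheafData.comap_mono (f := h) h1
    dsimp only at h2
    rwa [← Scheme.IdealSheafData.comap_comp, IsIso.hom_inv_id, Scheme.IdealSheafData.comap_id] at h2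

/-- The reduced ideal sheaf of a complex point is the kernel of its inclusion. -/
lemma vanishingIdeal_closure_singleton {X : Scheme.{0}} (s : SpecC ⟶ X) (u : SpecC) :
    Scheme.IdealSheafData.vanishingIdeal (.closure {s u}) = s.ker := by
  have h1 : s '' (⊤ : TopologicalSpace.Closeds SpecC) = {s u} := by
    ext z
    constructor
    · rintro ⟨w, -, rfl⟩
      exact congrArg s (Subsingleton.elim (α := PrimeSpectrum ℂ) w u)
    · rintro rfl
      exact ⟨u, trivial, rfl⟩
  rw [← h1, ← Scheme.IdealSheafData.map_vanishingIdeal, Scheme.IdealSheafData.vanishingIdeal_top,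
    Scheme.nilradical_eq_bot, Scheme.IdealSheafData.map_bot]

/-- Blowups can be transported along isomorphisms of the target. -/
lemma IsBlowup.comp_isIso {Z Y Y' : Scheme.{0}} {π : Z ⟶ Y} {I : Y.IdealSheafData}
    (h : IsBlowup π I) (j : Y ⟶ Y') [IsIso j] {K : Y'.IdealSheafData} (hK : K.comap j = I) :
    IsBlowup (π ≫ j) K := by
  subst hK
  refine ⟨?_, fun T f hf => ?_⟩
  · rw [Scheme.IdealSheafData.comap_comp]
    exact h.1
  · obtain ⟨g, hg, hu⟩ := h.2 T (f ≫ inv j) (by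
      rwa [← Scheme.IdealSheafData.comap_comp, Category.assoc, IsIso.inv_hom_id, Category.comp_id])
    refine ⟨g, ?_, fun g' hg' => hu g' ?_⟩
    · change g ≫ π ≫ j = f
      rw [← Category.assoc, hg, Category.assoc, IsIso.inv_hom_id, Category.comp_id]
    · change g' ≫ π = _
      rw [← hg', Category.assoc, Category.assoc, IsIso.hom_inv_id, Category.comp_id]

/-- Automorphisms that preserve the centre of a blowup lift to it. -/
lemma IsBlowup.existsUnique_lift {Z Y : Over SpecC} {π : Z ⟶ Y} {I : Y.left.IdealSheafData}
    (h : IsBlowup π.left I) (σ : Y ⟶ Y) (hσ : I.comap σ.left = I) :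
    ∃! f : Z ⟶ Z, f ≫ π = π ≫ σ := by
  obtain ⟨g, hg, hu⟩ := h.2 Z.left (π.left ≫ σ.left) (by
    rw [Scheme.IdealSheafData.comap_comp, hσ]
    exact h.1)
  refine ⟨Over.homMk g ?_, Over.OverMorphism.ext hg, fun g' hg' => Over.OverMorphism.ext (hu _ ?_)⟩
  · rw [← Over.w π, reassoc_of% hg, Over.w σ, Over.w π]
  · exact congrArg CommaMorphism.left hg'

/-- The action on a blowup that lifts an action on the base preserving the centre. It is a
homomorphism by the uniqueness of the lifts. -/
def blowupAction {Z Y : Over SpecC} {π : Z ⟶ Y} {I : Y.left.IdealSheafData}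
    (h : IsBlowup π.left I) {H : Type} [Group H] (ρ : H →* Aut Y)
    (hρ : ∀ σ, I.comap (ρ σ).hom.left = I) : H →* Aut Z :=
  (Aut.unitsEndEquivAut Z).toMonoidHom.comp (MonoidHom.toHomUnits
    { toFun := fun σ => End.of (h.existsUnique_lift (ρ σ).hom (hρ σ)).choose
      map_one' := by
        refine ((h.existsUnique_lift (ρ 1).hom (hρ 1)).choose_spec.2 (𝟙 Z) ?_).symm
        change 𝟙 Z ≫ π = π ≫ (ρ 1).hom
        rw [map_one, Category.id_comp]
        exact (Category.comp_id π).symm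
      map_mul' := fun σ τ => by
        refine ((h.existsUnique_lift (ρ (σ * τ)).hom (hρ _)).choose_spec.2
          ((h.existsUnique_lift (ρ τ).hom (hρ τ)).choose ≫
            (h.existsUnique_lift (ρ σ).hom (hρ σ)).choose) ?_).symm
        have h1 := (h.existsUnique_lift (ρ τ).hom (hρ τ)).choose_spec.1
        have h2 := (h.existsUnique_lift (ρ σ).hom (hρ σ)).choose_spec.1
        dsimp only at h1 h2 ⊢
        rw [Category.assoc, h2, reassoc_of% h1, map_mul]
        rfl })

lemma blowupAction_comp {Z Y : Over SpecC} {π : Z ⟶ Y} {I : Y.left.IdealSheafData}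
    (h : IsBlowup π.left I) {H : Type} [Group H] (ρ : H →* Aut Y)
    (hρ : ∀ σ, I.comap (ρ σ).hom.left = I) (σ : H) :
    (blowupAction h ρ hρ σ).hom ≫ π = π ≫ (ρ σ).hom :=
  (h.existsUnique_lift (ρ σ).hom (hρ σ)).choose_spec.1

/-! ### Birational maps -/

/-- The restriction of a birational map, as a morphism to the whole target. -/
lemma restrictSource_spec {X Y : Scheme.{0}} (f : X.PartialIso Y) (U : X.Opens)
    (hU : Dense (U : Set X)) (hU' : U ≤ f.source) :
    (f.restrictSource U hU hU').iso.hom ≫ (f.restrictSource U hU hU').target.ι =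
      X.homOfLE hU' ≫ f.iso.hom ≫ f.target.ι := by
  change ((Scheme.Opens.isoOfLE hU').inv ≫ (f.iso.hom.isoImage (f.source.ι ⁻¹ᵁ U)).hom ≫
    (f.target.ι.isoImage (f.iso.hom ''ᵁ f.source.ι ⁻¹ᵁ U)).hom) ≫
      (f.target.ι ''ᵁ f.iso.hom ''ᵁ f.source.ι ⁻¹ᵁ U).ι = _
  have h : (Scheme.Opens.isoOfLE hU').inv ≫ (f.source.ι ⁻¹ᵁ U).ι = X.homOfLE hU' := by
    rw [← cancel_mono f.source.ι, Category.assoc, Scheme.Opens.isoOfLE_inv_ι, Scheme.homOfLE_ι]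
  rw [Category.assoc, Category.assoc, Scheme.Hom.isoImage_hom_ι, Scheme.Hom.isoImage_hom_ι_assoc,
    reassoc_of% h]

/-- The morphism underlying a composition of isomorphisms `i` and `k` of open subschemes that
restrict `f` and `g`. -/
lemma exists_lift_trans {X Y Z : Scheme.{0}} (f : X.PartialIso Y) (g : Y.PartialIso Z)
    {S : X.Opens} {U : Y.Opens} {T : Z.Opens} (i : S.toScheme ≅ U) (k : U.toScheme ≅ T)
    (hU : U ≤ f.target) (hU' : U ≤ g.source) (hS : S ≤ f.source)
    (hi : i.inv ≫ S.ι = Y.homOfLE hU ≫ f.iso.inv ≫ f.source.ι)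
    (hk : k.hom ≫ T.ι = Y.homOfLE hU' ≫ g.iso.hom ≫ g.target.ι) :
    ∃ l : S.toScheme ⟶ g.source.toScheme,
      l ≫ g.source.ι = X.homOfLE hS ≫ f.iso.hom ≫ f.target.ι ∧
      (i ≪≫ Y.isoOfEq rfl ≪≫ k).hom ≫ T.ι = l ≫ g.iso.hom ≫ g.target.ι := by
  have h2 : i.inv ≫ X.homOfLE hS = Y.homOfLE hU ≫ f.iso.inv := by
    rw [← cancel_mono f.source.ι, Category.assoc, Category.assoc, Scheme.homOfLE_ι, hi]
  refine ⟨i.hom ≫ Y.homOfLE hU', ?_, ?_⟩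
  · rw [Category.assoc, Scheme.homOfLE_ι, ← cancel_epi i.inv, Iso.inv_hom_id_assoc,
      reassoc_of% h2, Iso.inv_hom_id_assoc, Scheme.homOfLE_ι]
  · rw [Category.assoc, ← hk]
    simp

/-- On its domain, the composition of two birational maps is the composition of morphisms. Here `l`
is the restriction of `f` to a morphism to the domain of `g`. -/
lemma trans_spec {X Y Z : Scheme.{0}} (f : X.PartialIso Y) (g : Y.PartialIso Z) :
    ∃ (h : (f.trans g).source ≤ f.source) (l : (f.trans g).source.toScheme ⟶ g.source.toScheme),
      l ≫ g.source.ι = X.homOfLE h ≫ f.iso.hom ≫ f.target.ι ∧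
      (f.trans g).iso.hom ≫ (f.trans g).target.ι = l ≫ g.iso.hom ≫ g.target.ι := by
  have hd : Dense ((f.target ⊓ g.source : Y.Opens) : Set Y) :=
    f.dense_target.inter_of_isOpen_right g.dense_source g.source.2
  have hle : (f.trans g).source ≤ f.source := f.source.ι_image_le _
  exact ⟨hle, exists_lift_trans f g (f.restrictTarget _ hd inf_le_left).iso
    (g.restrictSource _ hd inf_le_right).iso inf_le_left inf_le_right hle
    (restrictSource_spec f.symm _ hd inf_le_left) (restrictSource_spec g _ hd inf_le_right)⟩

/-- The birational map defined by two dominant open immersions of the same scheme. -/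
def BirMap.ofCharts {X Y : Over SpecC} {A : Scheme.{0}} (j : A ⟶ X.left) [IsOpenImmersion j]
    [IsDominant j] (j' : A ⟶ Y.left) [IsOpenImmersion j'] [IsDominant j']
    (h : j ≫ X.hom = j' ≫ Y.hom) : BirMap X Y where
  toPartialIso :=
    { source := j.opensRange
      dense_source := j.denseRange
      target := j'.opensRange
      dense_target := j'.denseRange
      iso := j.isoOpensRange.symm ≪≫ j'.isoOpensRange }
  isOver := by
    change (j.isoOpensRange.inv ≫ j'.isoOpensRange.hom) ≫ j'.opensRange.ι ≫ Y.hom =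
      j.opensRange.ι ≫ X.hom
    rw [Category.assoc, ← Category.assoc _ _ Y.hom, Scheme.Hom.isoOpensRange_hom_ι, ← h,
      ← Category.assoc, Scheme.Hom.isoOpensRange_inv_comp]

lemma BirMap.ofCharts_comp {X Y : Over SpecC} {A : Scheme.{0}} (j : A ⟶ X.left)
    [IsOpenImmersion j] [IsDominant j] (j' : A ⟶ Y.left) [IsOpenImmersion j'] [IsDominant j']
    (h : j ≫ X.hom = j' ≫ Y.hom) {π : Y.left ⟶ X.left} (hπ : j' ≫ π = j) :
    (ofCharts j j' h).toPartialIso.iso.hom ≫ (ofCharts j j' h).toPartialIso.target.ι ≫ π =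
      (ofCharts j j' h).toPartialIso.source.ι := by
  change (j.isoOpensRange.inv ≫ j'.isoOpensRange.hom) ≫ j'.opensRange.ι ≫ π = j.opensRange.ι
  rw [Category.assoc, ← Category.assoc _ _ π, Scheme.Hom.isoOpensRange_hom_ι, hπ,
    Scheme.Hom.isoOpensRange_inv_comp]

lemma BirMap.ofIso_hom_ι {X Y : Over SpecC} (E : X ≅ Y) :
    (ofIso E).toPartialIso.iso.hom ≫ (ofIso E).toPartialIso.target.ι =
      (ofIso E).toPartialIso.source.ι ≫ E.hom.left := by
  change (X.left.topIso.hom ≫ E.hom.left ≫ Y.left.topIso.inv) ≫ (⊤ : Y.left.Opens).ι =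
    (⊤ : X.left.Opens).ι ≫ E.hom.left
  have h : Y.left.topIso.inv ≫ (⊤ : Y.left.Opens).ι = 𝟙 _ := Y.left.topIso.inv_hom_id
  rw [Category.assoc, Category.assoc, h, Category.comp_id]
  rfl

section Inverse

variable {X Y : Over SpecC} {f : BirMap X Y} {π : Y ⟶ X} {σ : X ≅ X}

/-- If `f` is inverse to the morphism `π`, the composition of an automorphism `σ` with `f` is a
lift of `σ` along `π`. -/
lemma BirMap.ofIso_trans_comp (σ : X ≅ X)
    (hf : f.toPartialIso.iso.hom ≫ f.toPartialIso.target.ι ≫ π.left = f.toPartialIso.source.ι) :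
    ((ofIso σ).trans f).toPartialIso.toPartialMap.hom ≫ π.left =
      ((ofIso σ).trans f).toPartialIso.toPartialMap.domain.ι ≫ σ.hom.left := by
  obtain ⟨h, l, h1, h2⟩ := trans_spec (ofIso σ).toPartialIso f.toPartialIso
  refine (congrArg (· ≫ π.left) h2).trans ?_
  refine (Category.assoc _ _ _).trans ((congrArg (l ≫ ·) (Category.assoc _ _ _)).trans ?_)
  refine (congrArg (l ≫ ·) hf).trans (h1.trans ?_)
  rw [ofIso_hom_ι, ← Category.assoc, Scheme.homOfLE_ι]
  rfl

/-- If `f` is inverse to the morphism `π` and `E` is an automorphism over `σ`, the composition of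
`f` with `E` is a lift of `σ` along `π`. -/
lemma BirMap.trans_ofIso_comp (E : Y ≅ Y)
    (hf : f.toPartialIso.iso.hom ≫ f.toPartialIso.target.ι ≫ π.left = f.toPartialIso.source.ι)
    (hE : E.hom ≫ π = π ≫ σ.hom) :
    (f.trans (ofIso E)).toPartialIso.toPartialMap.hom ≫ π.left =
      (f.trans (ofIso E)).toPartialIso.toPartialMap.domain.ι ≫ σ.hom.left := by
  have hE' : E.hom.left ≫ π.left = π.left ≫ σ.hom.left := congrArg CommaMorphism.left hE
  obtain ⟨h, l, h1, h2⟩ := trans_spec f.toPartialIso (ofIso E).toPartialIso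
  refine (congrArg (· ≫ π.left) h2).trans ?_
  rw [ofIso_hom_ι, ← Category.assoc l, h1, Category.assoc, hE', ← Category.assoc]
  refine (congrArg (· ≫ σ.hom.left) (?_ : _ = (f.trans (ofIso E)).toPartialIso.source.ι))
  rw [Category.assoc, Category.assoc, hf, Scheme.homOfLE_ι]
  rfl

end Inverse

/-- Two partial maps with the same composition with a morphism `π` agree as rational maps if `π` is
a monomorphism over an open set with dense preimage. -/
lemma toRationalMap_eq_of_comp {X Y Z : Scheme.{0}} {a b : X.PartialMap Y} {π : Y ⟶ Z} {U : Z.Opens}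
    (hU : ∀ (T : Scheme.{0}) (g g' : T ⟶ Y), (∀ y, (g ≫ π) y ∈ U) → g ≫ π = g' ≫ π → g = g')
    (σ : X ⟶ Z) (hd : Dense (σ ⁻¹ᵁ U : Set X)) (ha : a.hom ≫ π = a.domain.ι ≫ σ)
    (hb : b.hom ≫ π = b.domain.ι ≫ σ) : a.toRationalMap = b.toRationalMap := by
  rw [Scheme.PartialMap.toRationalMap_eq_iff]
  refine ⟨a.domain ⊓ b.domain ⊓ σ ⁻¹ᵁ U,
    (a.dense_domain.inter_of_isOpen_left b.dense_domain a.domain.2).inter_of_isOpen_right hd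
      (σ ⁻¹ᵁ U).2, inf_le_left.trans inf_le_left, inf_le_left.trans inf_le_right, ?_⟩
  change X.homOfLE _ ≫ a.hom = X.homOfLE _ ≫ b.hom
  have h1 (h : a.domain ⊓ b.domain ⊓ σ ⁻¹ᵁ U ≤ a.domain) : (X.homOfLE h ≫ a.hom) ≫ π =
      (a.domain ⊓ b.domain ⊓ σ ⁻¹ᵁ U).ι ≫ σ := by
    rw [Category.assoc, ha, ← Category.assoc, Scheme.homOfLE_ι]
  have h2 (h : a.domain ⊓ b.domain ⊓ σ ⁻¹ᵁ U ≤ b.domain) : (X.homOfLE h ≫ b.hom) ≫ π =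
      (a.domain ⊓ b.domain ⊓ σ ⁻¹ᵁ U).ι ≫ σ := by
    rw [Category.assoc, hb, ← Category.assoc, Scheme.homOfLE_ι]
  refine hU _ _ _ (fun y => ?_) ((h1 _).trans (h2 _).symm)
  rw [h1]
  exact y.2.2

/-! ### The action on the ruled surface -/

/-- The matrices for which `[0 : 0 : 1]` is an eigenvector. -/
def FixesPoint (N : Matrix.SpecialLinearGroup (Fin 3) ℂ) : Prop := N.1 0 2 = 0 ∧ N.1 1 2 = 0

lemma FixesPoint.det_eq {N : Matrix.SpecialLinearGroup (Fin 3) ℂ} (h : FixesPoint N) :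
    (N.1 0 0 * N.1 1 1 - N.1 0 1 * N.1 1 0) * N.1 2 2 = 1 := by
  have h1 := N.2
  rw [Matrix.det_fin_three, h.1, h.2] at h1
  linear_combination h1

lemma act_fin_three {A : Type} [CommRing A] [Algebra ℂ A] (N : Matrix (Fin 3) (Fin 3) ℂ)
    (v : Fin 3 → A) (i : Fin 3) : act N v i = algebraMap ℂ A (N i 0) * v 0 +
      algebraMap ℂ A (N i 1) * v 1 + algebraMap ℂ A (N i 2) * v 2 :=
  Fin.sum_univ_three _

lemma act_fin_two {A : Type} [CommRing A] [Algebra ℂ A] (N : Matrix (Fin 2) (Fin 2) ℂ)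
    (v : Fin 2 → A) (i : Fin 2) : act N v i = algebraMap ℂ A (N i 0) * v 0 +
      algebraMap ℂ A (N i 1) * v 1 :=
  Fin.sum_univ_two _

/-- Points over a field are equal if their coordinates are proportional. -/
lemma cpt_eq_of_mul_eq {L : Type} [Field L] [Algebra ℂ L] {n : ℕ} {v w : Fin (n + 1) → L}
    {k l : Fin (n + 1)} (hk : IsUnit (v k)) (hl : IsUnit (w l))
    (h : ∀ i j, v i * w j = v j * w i) : cpt v k hk = cpt w l hl := by
  have h1 : v l * w k ≠ 0 := h k l ▸ mul_ne_zero hk.ne_zero hl.ne_zero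
  refine cpt_eq_of_mul hk hl (u := w k / v k)
    (div_ne_zero (right_ne_zero_of_mul h1) hk.ne_zero).isUnit fun i => ?_
  rw [div_mul_eq_mul_div, eq_div_iff hk.ne_zero]
  linear_combination h k i

namespace Plane

lemma point_linearMap {N : Matrix.SpecialLinearGroup (Fin 3) ℂ} (hN : FixesPoint N) :
    point ≫ (linearMap N).left = point := by
  have h0 : N.1 2 2 ≠ 0 := right_ne_zero_of_mul (hN.det_eq ▸ one_ne_zero)
  have h1 (i : Fin 3) : act N.1 (![0, 0, 1] : Fin 3 → ℂ) i = N.1 i 2 := by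
    rw [act_fin_three]
    simp
  refine (cpt_linearMap (l := 2) N _ _ (by rw [h1]; exact h0.isUnit)).trans
    (cpt_eq_of_mul _ _ h0.isUnit fun i => ?_).symm
  rw [h1]
  obtain rfl | rfl | rfl : i = (0 : Fin 3) ∨ i = (1 : Fin 3) ∨ i = (2 : Fin 3) := by
    revert i; decide
  · simpa using hN.1
  · simpa using hN.2
  · simp

end Plane

namespace Scroll

lemma torus_hom : torus ≫ surface.hom =
    Spec.map (CommRingCat.ofHom (algebraMap ℂ TorusRing)) := by
  rw [← e_κ 0, Category.assoc, κ_hom, ← Spec.map_comp, ← CommRingCat.ofHom_comp]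
  congr 2
  exact (e 0).comp_algebraMap

instance isDominant_π : IsDominant π.left := by
  have h1 : IsIntegral (projSpace 2).left := isSmoothProjectiveSurface_plane.integral
  refine ⟨Dense.mono ?_ ((Plane.κ 0).opensRange.isOpen.dense
    ⟨_, ⟨(⊥ : PrimeSpectrum PlaneRing), rfl⟩⟩)⟩
  rintro _ ⟨w, rfl⟩
  rw [← κ_zero_π]
  exact ⟨κ 0 w, rfl⟩

/-- A point of the surface over a field lies on one of the charts. -/
lemma exists_algHom {L : Type} [Field L] [Algebra ℂ L]
    (q : Spec (CommRingCat.of L) ⟶ surface.left)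
    (hq : q ≫ surface.hom = Spec.map (CommRingCat.ofHom (algebraMap ℂ L))) :
    ∃ (i : Fin 4) (g : PlaneRing →ₐ[ℂ] L),
      q = Spec.map (CommRingCat.ofHom g.toRingHom) ≫ κ i := by
  obtain ⟨i, hi⟩ := exists_mem_range_κ (q (⊥ : PrimeSpectrum L))
  have hr : Set.range q ⊆ Set.range (κ i) := by
    rintro _ ⟨y, rfl⟩
    rwa [Subsingleton.elim (α := PrimeSpectrum L) y ⊥]
  obtain ⟨g, hg⟩ := Spec.map_surjective (IsOpenImmersion.lift (κ i) q hr)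
  have h1 : Spec.map g ≫ κ i = q := by rw [hg, IsOpenImmersion.lift_fac]
  have h2 : CommRingCat.ofHom (algebraMap ℂ PlaneRing) ≫ g =
      CommRingCat.ofHom (algebraMap ℂ L) := by
    refine Spec.map_injective ?_
    rw [Spec.map_comp, ← hq, ← h1, Category.assoc, κ_hom]
  refine ⟨i, ⟨g.hom, fun c => ?_⟩, ?_⟩
  · exact congrArg (fun f : CommRingCat.of ℂ ⟶ CommRingCat.of L => f.hom c) h2
  · rw [← h1]
    rfl

/-- A point over a field lying over the point `[w₀ : w₁ : w₂] ≠ [0 : 0 : 1]` of the plane lies over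
the point `[w₀ : w₁]` of the line. -/
lemma comp_φ_eq {L : Type} [Field L] [Algebra ℂ L] {q : Spec (CommRingCat.of L) ⟶ surface.left}
    (hq : q ≫ surface.hom = Spec.map (CommRingCat.ofHom (algebraMap ℂ L))) {w : Fin 3 → L}
    {k : Fin 3} {hk : IsUnit (w k)} (hw : q ≫ π.left = cpt w k hk) (hw' : w 0 ≠ 0 ∨ w 1 ≠ 0)
    {l : Fin 2} (hl : IsUnit ((![w 0, w 1] : Fin 2 → L) l)) :
    q ≫ φ.left = cpt ![w 0, w 1] l hl := by
  obtain ⟨i, g, rfl⟩ := exists_algHom q hq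
  rw [Category.assoc, κ_π] at hw
  rw [Category.assoc, κ_φ]
  have h1 := mul_eq_of_cpt_eq ((SpecMap_cpt g _ _ _).symm.trans hw)
  refine (SpecMap_cpt g _ _ _).trans (cpt_eq_of_mul_eq _ _ ?_)
  have h0 : (g ∘ planeV (cox i)) (planeIdx i) = 1 := by
    rw [Function.comp_apply, planeV_planeIdx, map_one]
  have hp0 : (g ∘ planeV (cox i)) 0 = g (cox i 0) * g (cox i 2) := map_mul g _ _
  have hp1 : (g ∘ planeV (cox i)) 1 = g (cox i 1) * g (cox i 2) := map_mul g _ _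
  have hs : g (cox i 2) ≠ 0 := by
    intro hs
    rw [hs, mul_zero] at hp0 hp1
    have h2 : (g ∘ planeV (cox i)) 2 ≠ 0 := by
      intro hp2
      have : ∀ j, (g ∘ planeV (cox i)) j = 0 := fun j => by
        obtain rfl | rfl | rfl : j = 0 ∨ j = 1 ∨ j = 2 := by omega
        exacts [hp0, hp1, hp2]
      exact one_ne_zero (h0.symm.trans (this _))
    have h3 := h1 2 0
    have h4 := h1 2 1
    rw [hp0, zero_mul] at h3
    rw [hp1, zero_mul] at h4
    exact hw'.elim (fun h => h ((mul_eq_zero.1 h3).resolve_left h2))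
      fun h => h ((mul_eq_zero.1 h4).resolve_left h2)
  have h2 : g (cox i 0) * w 1 = g (cox i 1) * w 0 := by
    refine mul_left_cancel₀ hs ?_
    have h3 := h1 0 1
    rw [hp0, hp1] at h3
    linear_combination h3
  have h01 : ∀ j : Fin 2, j = 0 ∨ j = 1 := by omega
  intro a b
  obtain rfl | rfl := h01 a <;> obtain rfl | rfl := h01 b
  · rfl
  · exact h2
  · exact h2.symm
  · rfl

/-- Linear maps that fix the centre of the blowup permute the fibres of the ruling, which are the
strict transforms of the lines through the centre. This can be checked at the generic point. -/
lemma exists_comp_φ_eq {N : Matrix.SpecialLinearGroup (Fin 3) ℂ} (hN : FixesPoint N)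
    {f : surface ⟶ surface} (hf : f ≫ π = π ≫ linearMap N) :
    ∃ τ : Aut (projSpace 1), f ≫ φ = φ ≫ τ.hom := by
  set δ := N.1 0 0 * N.1 1 1 - N.1 0 1 * N.1 1 0 with hδ
  have hδ0 : δ ≠ 0 := left_ne_zero_of_mul (hN.det_eq ▸ one_ne_zero)
  -- The action on the line is given by the upper left block of `N`, divided by a square root of
  -- its determinant.
  obtain ⟨c, hc⟩ := IsAlgClosed.exists_pow_nat_eq δ (n := 2) two_pos
  have hc0 : c ≠ 0 := by
    rintro rfl
    exact hδ0 (by rw [← hc]; simp)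
  let B : Matrix.SpecialLinearGroup (Fin 2) ℂ :=
    ⟨!![c⁻¹ * N.1 0 0, c⁻¹ * N.1 0 1; c⁻¹ * N.1 1 0, c⁻¹ * N.1 1 1], by
      rw [Matrix.det_fin_two_of]
      have : c⁻¹ ^ 2 * c ^ 2 = 1 := by field_simp
      rw [hc, hδ] at this
      linear_combination this⟩
  refine ⟨linearAction 1 B, Over.OverMorphism.ext ?_⟩
  change f.left ≫ φ.left = φ.left ≫ (linearMap B).left
  let L := FractionRing TorusRing
  let i : TorusRing →ₐ[ℂ] L := IsScalarTower.toAlgHom ℂ TorusRing L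
  have hi : Function.Injective i := IsFractionRing.injective TorusRing L
  have : IsSchemeTheoreticallyDominant (Spec.map (CommRingCat.ofHom i.toRingHom)) :=
    isSchemeTheoreticallyDominant_SpecMap hi
  refine ext_of_schemeTheoreticallyDominant
    (Spec.map (CommRingCat.ofHom i.toRingHom) ≫ torus) ?_
  have hf' : f.left ≫ π.left = π.left ≫ (linearMap N).left := congrArg CommaMorphism.left hf
  set v : Fin 3 → L := i ∘ ![1, β, γ] with hv
  have hv0 : v 0 = 1 := map_one i
  set w := act N.1 v with hw
  have hw0 : w 0 = algebraMap ℂ L (N.1 0 0) + algebraMap ℂ L (N.1 0 1) * v 1 := by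
    rw [hw, act_fin_three, hN.1, hv0, map_zero, zero_mul, add_zero, mul_one]
  have hw1 : w 1 = algebraMap ℂ L (N.1 1 0) + algebraMap ℂ L (N.1 1 1) * v 1 := by
    rw [hw, act_fin_three, hN.2, hv0, map_zero, zero_mul, add_zero, mul_one]
  have hne : w 0 ≠ 0 ∨ w 1 ≠ 0 := by
    by_contra! h
    refine hδ0 ((map_eq_zero (algebraMap ℂ L)).1 ?_)
    rw [hδ, map_sub, map_mul, map_mul]
    rw [h.1] at hw0
    rw [h.2] at hw1
    linear_combination algebraMap ℂ L (N.1 0 1) * hw1 - algebraMap ℂ L (N.1 1 1) * hw0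
  obtain ⟨k, hk⟩ : ∃ k, IsUnit (w k) :=
    hne.elim (fun h => ⟨0, h.isUnit⟩) fun h => ⟨1, h.isUnit⟩
  obtain ⟨l, hl⟩ : ∃ l, IsUnit ((![w 0, w 1] : Fin 2 → L) l) :=
    hne.elim (fun h => ⟨0, h.isUnit⟩) fun h => ⟨1, h.isUnit⟩
  have hB (j : Fin 2) : (![w 0, w 1] : Fin 2 → L) j =
      algebraMap ℂ L c * act B.1 (i ∘ ![1, β]) j := by
    have hci : algebraMap ℂ L c * algebraMap ℂ L c⁻¹ = 1 := by
      rw [← map_mul, mul_inv_cancel₀ hc0, map_one]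
    have h01 : ∀ j : Fin 2, j = 0 ∨ j = 1 := by omega
    have hi0 : (i ∘ ![1, β] : Fin 2 → L) 0 = 1 := map_one i
    have hi1 : (i ∘ ![1, β] : Fin 2 → L) 1 = v 1 := rfl
    rw [act_fin_two, hi0, hi1]
    obtain rfl | rfl := h01 j
    · change w 0 = algebraMap ℂ L c * (algebraMap ℂ L (c⁻¹ * N.1 0 0) * 1 +
        algebraMap ℂ L (c⁻¹ * N.1 0 1) * v 1)
      rw [hw0, map_mul, map_mul]
      linear_combination -(algebraMap ℂ L (N.1 0 0) + algebraMap ℂ L (N.1 0 1) * v 1) * hci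
    · change w 1 = algebraMap ℂ L c * (algebraMap ℂ L (c⁻¹ * N.1 1 0) * 1 +
        algebraMap ℂ L (c⁻¹ * N.1 1 1) * v 1)
      rw [hw1, map_mul, map_mul]
      linear_combination -(algebraMap ℂ L (N.1 1 0) + algebraMap ℂ L (N.1 1 1) * v 1) * hci
  have hcu : IsUnit (algebraMap ℂ L c) := hc0.isUnit.map _
  have hl' : IsUnit (act B.1 (i ∘ ![1, β]) l) := isUnit_of_mul_isUnit_right (hB l ▸ hl)
  refine (Category.assoc _ _ _).trans ?_
  refine Eq.trans ?_ (Category.assoc _ _ _).symm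
  have key : ((Spec.map (CommRingCat.ofHom i.toRingHom) ≫ torus) ≫ f.left) ≫ φ.left =
      cpt ![w 0, w 1] l hl := by
    refine comp_φ_eq (w := w) (k := k) (hk := hk) ?_ ?_ hne hl
    · rw [Category.assoc, Over.w f, Category.assoc, torus_hom, ← Spec.map_comp,
        ← CommRingCat.ofHom_comp]
      congr 2
    · rw [Category.assoc, hf', Category.assoc, ← Category.assoc torus, torus_π, ← Category.assoc]
      exact (congrArg (· ≫ (linearMap N).left) (SpecMap_cpt i _ _ _)).trans
        (cpt_linearMap N _ _ hk)
  rw [Category.assoc, Category.assoc] at key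
  refine key.trans ?_
  have h1 : Spec.map (CommRingCat.ofHom i.toRingHom) ≫ torus ≫ φ.left =
      cpt (i ∘ ![1, β]) 0 (by simp) := by
    rw [torus_φ]
    exact SpecMap_cpt i _ _ _
  rw [← Category.assoc torus, ← Category.assoc, h1]
  refine Eq.trans ?_ (cpt_linearMap B _ _ hl').symm
  exact (cpt_eq_of_mul _ _ hcu hB).symm

end Scroll

/-! ### Invariant lines of reducible representations -/

/-- A reducible three-dimensional representation of a finite group has an invariant line, since by
Maschke's theorem it is the sum of two proper subrepresentations. -/
lemma exists_eigenvector {G : Subgroup (Matrix.SpecialLinearGroup (Fin 3) ℂ)} [Finite G]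
    (hG : ¬ (natRep G).IsIrreducible) :
    ∃ v : Fin 3 → ℂ, v ≠ 0 ∧ ∀ g ∈ G, ∃ c : ℂ, g.1.mulVec v = c • v := by
  have hss : ComplementedLattice (Subrepresentation (natRep G)) :=
    (inferInstance : (natRep G).IsSemisimpleRepresentation)
  have hnt : Nontrivial (Subrepresentation (natRep G)) := by
    refine ⟨⊥, ⊤, fun h => ?_⟩
    have h1 : (![1, 0, 0] : Fin 3 → ℂ) ∈ (⊥ : Subrepresentation (natRep G)).toSubmodule := by
      rw [h]
      exact Submodule.mem_top
    have h2 : (![1, 0, 0] : Fin 3 → ℂ) = 0 := h1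
    exact one_ne_zero (congrFun h2 0)
  obtain ⟨W, hW0, hW1⟩ : ∃ W : Subrepresentation (natRep G), W ≠ ⊥ ∧ W ≠ ⊤ := by
    by_contra! h
    exact hG ⟨fun W => or_iff_not_imp_left.2 (h W)⟩
  obtain ⟨W', hW'⟩ := exists_isCompl W
  have hd : Disjoint W.toSubmodule W'.toSubmodule := by
    rw [disjoint_iff]
    exact congrArg Subrepresentation.toSubmodule hW'.inf_eq_bot
  have hW'0 : W' ≠ ⊥ := fun h => hW1 (by simpa [h] using hW'.sup_eq_top)
  have hpos : ∀ V : Subrepresentation (natRep G), V ≠ ⊥ →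
      1 ≤ Module.finrank ℂ V.toSubmodule := by
    intro V hV
    rw [Nat.one_le_iff_ne_zero, Ne, Submodule.finrank_eq_zero]
    exact fun h => hV (Subrepresentation.toSubmodule_injective h)
  have hsum := Submodule.finrank_add_finrank_le_of_disjoint hd
  rw [Module.finrank_fin_fun] at hsum
  have h1 := hpos W hW0
  have h2 := hpos W' hW'0
  obtain ⟨V, hV⟩ : ∃ V : Subrepresentation (natRep G), Module.finrank ℂ V.toSubmodule = 1 := by
    by_cases h : Module.finrank ℂ W.toSubmodule = 1
    · exact ⟨W, h⟩
    · exact ⟨W', by omega⟩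
  obtain ⟨v, hv, hv'⟩ := finrank_eq_one_iff'.1 hV
  refine ⟨v, fun h => hv (Subtype.ext h), fun g hg => ?_⟩
  obtain ⟨c, hc⟩ := hv' ⟨_, V.apply_mem_toSubmodule ⟨g, hg⟩ v.2⟩
  refine ⟨c, ?_⟩
  have h3 := congrArg Subtype.val hc
  exact (Matrix.toLin'_apply g.1 v.1).symm.trans h3.symm

/-- Every nonzero vector is the last column of a matrix of determinant one. -/
lemma exists_specialLinearGroup_col {v : Fin 3 → ℂ} (hv : v ≠ 0) :
    ∃ M : Matrix.SpecialLinearGroup (Fin 3) ℂ, ∀ i, M.1 i 2 = v i := by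
  have key (M : Matrix (Fin 3) (Fin 3) ℂ) (hM : M.det = 1) (h : ∀ i, M i 2 = v i) :
      ∃ M : Matrix.SpecialLinearGroup (Fin 3) ℂ, ∀ i, M.1 i 2 = v i := ⟨⟨M, hM⟩, h⟩
  obtain ⟨i, hi⟩ := Function.ne_iff.1 hv
  fin_cases i
  · refine key !![0, 0, v 0; 1, 0, v 1; 0, (v 0)⁻¹, v 2] ?_ fun i => by fin_cases i <;> rfl
    rw [Matrix.det_fin_three]
    simpa using mul_inv_cancel₀ hi
  · refine key !![1, 0, v 0; 0, 0, v 1; 0, -(v 1)⁻¹, v 2] ?_ fun i => by fin_cases i <;> rfl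
    rw [Matrix.det_fin_three]
    simpa using mul_inv_cancel₀ hi
  · refine key !![(v 2)⁻¹, 0, v 0; 0, 1, v 1; 0, 0, v 2] ?_ fun i => by fin_cases i <;> rfl
    rw [Matrix.det_fin_three]
    simpa using inv_mul_cancel₀ hi

/-- A conjugate of a reducible finite group fixes the point `[0 : 0 : 1]`. -/
lemma exists_fixesPoint {G : Subgroup (Matrix.SpecialLinearGroup (Fin 3) ℂ)} [Finite G]
    (hG : ¬ (natRep G).IsIrreducible) :
    ∃ M : Matrix.SpecialLinearGroup (Fin 3) ℂ, ∀ g ∈ G, FixesPoint (M⁻¹ * g * M) := by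
  obtain ⟨v, hv, hv'⟩ := exists_eigenvector hG
  obtain ⟨M, hM⟩ := exists_specialLinearGroup_col hv
  refine ⟨M, fun g hg => ?_⟩
  obtain ⟨c, hc⟩ := hv' g hg
  have h0 : M.1.mulVec (Pi.single 2 1) = v := by
    rw [Matrix.mulVec_single_one]
    exact funext hM
  have h1 : (M⁻¹).1.mulVec v = Pi.single 2 1 := by
    rw [← h0, Matrix.mulVec_mulVec, ← Matrix.SpecialLinearGroup.coe_mul, inv_mul_cancel,
      Matrix.SpecialLinearGroup.coe_one, Matrix.one_mulVec]
  have h2 : (M⁻¹ * g * M).1.mulVec (Pi.single 2 1) = c • Pi.single 2 1 := by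
    rw [Matrix.SpecialLinearGroup.coe_mul, Matrix.SpecialLinearGroup.coe_mul,
      ← Matrix.mulVec_mulVec, ← Matrix.mulVec_mulVec, h0, hc, Matrix.mulVec_smul, h1]
  rw [Matrix.mulVec_single_one] at h2
  refine ⟨(congrFun h2 0).trans ?_, (congrFun h2 1).trans ?_⟩ <;> simp

/-! ### The link -/

namespace Scroll

variable (M : Matrix.SpecialLinearGroup (Fin 3) ℂ)

/-- The image under `M` of the point `[0 : 0 : 1]`, whose coordinates are the last column of `M`. -/
def center : SpecC ⟶ (projSpace 2).left := Plane.point ≫ (linearMap M).left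

/-- The blowup of the point `center M` of the plane. -/
def contraction : surface ⟶ projSpace 2 := π ≫ linearMap M

lemma contraction_left : (contraction M).left = π.left ≫ (linearMap M).left := rfl

lemma isBlowup_contraction : IsBlowup (contraction M).left (center M).ker :=
  isBlowup_π.comp_isIso (linearMap M).left (ker_comp_comap _ _)

instance : IsDominant (contraction M).left :=
  (inferInstance : IsDominant (π.left ≫ (linearMap M).left))

variable {M} {G : Subgroup (Matrix.SpecialLinearGroup (Fin 3) ℂ)}

lemma linearMap_comp_linearMap (g : Matrix.SpecialLinearGroup (Fin 3) ℂ) :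
    linearMap M ≫ linearMap g = linearMap (M⁻¹ * g * M) ≫ linearMap M := by
  rw [← linearMap_mul, ← linearMap_mul]
  congr 1
  group

lemma center_comp {g : Matrix.SpecialLinearGroup (Fin 3) ℂ} (hg : FixesPoint (M⁻¹ * g * M)) :
    center M ≫ (linearMap g).left = center M := by
  have h := congrArg CommaMorphism.left (linearMap_comp_linearMap (M := M) g)
  have h' : (linearMap M).left ≫ (linearMap g).left =
      (linearMap (M⁻¹ * g * M)).left ≫ (linearMap M).left := h
  rw [center, Category.assoc, h', ← Category.assoc, Plane.point_linearMap hg]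

lemma center_comp_bar (hM : ∀ g ∈ G, FixesPoint (M⁻¹ * g * M)) (σ : bar G) :
    center M ≫ σ.1.hom.left = center M := by
  obtain ⟨_, g, hg, rfl⟩ := σ
  exact center_comp (hM g hg)

/-- The group preserves the ideal of the fixed point. -/
lemma comap_ker_center (hM : ∀ g ∈ G, FixesPoint (M⁻¹ * g * M)) (σ : bar G) :
    (center M).ker.comap (((bar G).subtype σ).hom.left) = (center M).ker := by
  have h0 : IsIso σ.1.hom := σ.1.isIso_hom
  have h : IsIso σ.1.hom.left := (inferInstance : IsIso ((Over.forget SpecC).map σ.1.hom))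
  have h1 := ker_comp_comap (center M) σ.1.hom.left
  rwa [center_comp_bar hM σ] at h1

/-- The ruled surface as a blowup of the plane, with the lifted action. -/
def blownUp (hM : ∀ g ∈ G, FixesPoint (M⁻¹ * g * M)) : GVariety (bar G) where
  X := surface
  ρ := blowupAction (π := contraction M) (isBlowup_contraction M) (bar G).subtype
    (comap_ker_center hM)

variable (hM : ∀ g ∈ G, FixesPoint (M⁻¹ * g * M))

lemma blownUp_comp (σ : bar G) :
    ((blownUp hM).ρ σ).hom ≫ contraction M = contraction M ≫ σ.1.hom :=
  blowupAction_comp (isBlowup_contraction M) (bar G).subtype (comap_ker_center hM) σ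

lemma isGSurface_blownUp : IsGSurface (blownUp hM) where
  surface := isSmoothProjectiveSurface_surface
  faithful σ τ h := by
    have h1 : IsIntegral (projSpace 2).left := isSmoothProjectiveSurface_plane.integral
    refine Subtype.ext (Iso.ext (Over.OverMorphism.ext
      (ext_of_isDominant (contraction M).left ?_)))
    have h2 : contraction M ≫ σ.1.hom = contraction M ≫ τ.1.hom := by
      rw [← blownUp_comp hM, ← blownUp_comp hM, h]
    exact congrArg CommaMorphism.left h2

lemma isGConicBundle_blownUp : IsGConicBundle (blownUp hM) φ where
  equivariant σ := by
    obtain ⟨g, hg, hσ⟩ := σ.2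
    have h1 : σ.1.hom = linearMap g := by rw [← hσ]; rfl
    have h2 := blownUp_comp hM σ
    rw [h1] at h2
    refine exists_comp_φ_eq (hM g hg) (f := ((blownUp hM).ρ σ).hom) ?_
    rw [← cancel_mono (linearMap M)]
    refine (Category.assoc _ _ _).trans (h2.trans ?_)
    refine (Category.assoc _ _ _).trans (Eq.trans ?_ (Category.assoc _ _ _).symm)
    exact congrArg (π ≫ ·) (linearMap_comp_linearMap g)
  conic t ht := isConic_fibre ht

instance isDominant_κ (i : Fin 4) : IsDominant (κ i) :=
  ⟨(κ i).opensRange.isOpen.dense ⟨_, ⟨(⊥ : PrimeSpectrum PlaneRing), rfl⟩⟩⟩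

lemma κ_contraction (M : Matrix.SpecialLinearGroup (Fin 3) ℂ) :
    κ 0 ≫ (contraction M).left = Plane.κ 0 ≫ (linearMap M).left := by
  rw [contraction_left, ← Category.assoc, κ_zero_π]

instance (M : Matrix.SpecialLinearGroup (Fin 3) ℂ) :
    IsDominant (Plane.κ 0 ≫ (linearMap M).left) := by
  rw [← κ_contraction]
  infer_instance

/-- The inverse of the blowup, as the identity of the chart `x₀ ≠ 0` of the plane, which does not
contain the point `[0 : 0 : 1]`. -/
def blowupInv (M : Matrix.SpecialLinearGroup (Fin 3) ℂ) : BirMap (projSpace 2) surface :=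
  .ofCharts (Plane.κ 0 ≫ (linearMap M).left) (κ 0) (by
    rw [← κ_contraction, Category.assoc, Over.w])

lemma blowupInv_comp (M : Matrix.SpecialLinearGroup (Fin 3) ℂ) :
    (blowupInv M).toPartialIso.iso.hom ≫ (blowupInv M).toPartialIso.target.ι ≫
      (contraction M).left = (blowupInv M).toPartialIso.source.ι :=
  BirMap.ofCharts_comp _ _ _ (κ_contraction M)

lemma rat_blowupInv_compHom (M : Matrix.SpecialLinearGroup (Fin 3) ℂ) :
    (blowupInv M).rat.compHom (contraction M).left = .id (projSpace 2).left := by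
  change ((blowupInv M).toPartialIso.toPartialMap.compHom (contraction M).left).toRationalMap =
    (Scheme.PartialMap.id (projSpace 2).left).toRationalMap
  rw [Scheme.PartialMap.toRationalMap_eq_iff]
  refine ⟨(blowupInv M).toPartialIso.source, (blowupInv M).toPartialIso.dense_source, le_rfl,
    le_top, ?_⟩
  change (projSpace 2).left.homOfLE _ ≫ ((blowupInv M).toPartialIso.iso.hom ≫
    (blowupInv M).toPartialIso.target.ι) ≫ (contraction M).left =
      (projSpace 2).left.homOfLE _ ≫ (⊤ : (projSpace 2).left.Opens).ι ≫ 𝟙 _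
  rw [Category.assoc, blowupInv_comp, Scheme.homOfLE_ι, Category.comp_id, Scheme.homOfLE_ι]

/-- The inverse of the blowup is equivariant: both compositions lift `σ` along the contraction,
which is a monomorphism over the image of the chart `x₀ ≠ 0`. -/
lemma rat_trans_eq (σ : bar G) :
    ((BirMap.ofIso σ.1).trans (blowupInv M)).rat =
      ((blowupInv M).trans (BirMap.ofIso ((blownUp hM).ρ σ))).rat := by
  have hP : IsIntegral (projSpace 2).left := isSmoothProjectiveSurface_plane.integral
  have h0 : IsIso σ.1.hom := σ.1.isIso_hom
  have hσ : IsIso σ.1.hom.left := (inferInstance : IsIso ((Over.forget SpecC).map σ.1.hom))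
  let U : (projSpace 2).left.Opens := (inv (linearMap M).left) ⁻¹ᵁ
    (Proj.basicOpen (grading 2) (MvPolynomial.X 0) : (Proj (grading 2)).Opens)
  refine toRationalMap_eq_of_comp (π := (contraction M).left) (U := U) ?_ σ.1.hom.left ?_ ?_ ?_
  · intro T g g' hU hg
    have h1 (f : T ⟶ surface.left) :
        f ≫ π.left = (f ≫ (contraction M).left) ≫ inv (linearMap M).left := by
      rw [contraction_left, Category.assoc, Category.assoc, IsIso.hom_inv_id, Category.comp_id]
    refine eq_of_comp_π_zero (fun y => ?_) ?_
    · rw [h1]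
      exact hU y
    · rw [h1, h1, hg]
  · refine (σ.1.hom.left ⁻¹ᵁ U).isOpen.dense ?_
    let z : (projSpace 2).left := Plane.κ 0 (⊥ : PrimeSpectrum PlaneRing)
    have hz : z ∈ Proj.basicOpen (grading 2) (MvPolynomial.X 0) :=
      (Plane.mem_range_κ 0 z).1 ⟨_, rfl⟩
    obtain ⟨x, hx⟩ := (σ.1.hom.left ≫ inv (linearMap M).left).surjective z
    refine ⟨x, ?_⟩
    change (σ.1.hom.left ≫ inv (linearMap M).left) x ∈
      Proj.basicOpen (grading 2) (MvPolynomial.X 0)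
    rwa [hx]
  · exact BirMap.ofIso_trans_comp σ.1 (blowupInv_comp M)
  · exact BirMap.trans_ofIso_comp ((blownUp hM).ρ σ) (π := contraction M) (σ := σ.1)
      (blowupInv_comp M) (blownUp_comp hM σ)

lemma isClosed_center (M : Matrix.SpecialLinearGroup (Fin 3) ℂ) (u : SpecC) :
    IsClosed {center M u} := by
  have : IsClosedImmersion (center M) :=
    (inferInstance : IsClosedImmersion (Plane.point ≫ (linearMap M).left))
  exact isClosed_singleton_of_isClosedImmersion (center M) u

lemma isBlowupOfPoints (M : Matrix.SpecialLinearGroup (Fin 3) ℂ) (u : SpecC) :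
    IsBlowupOfPoints (contraction M).left {center M u} := by
  rw [IsBlowupOfPoints, vanishingIdeal_closure_singleton]
  exact isBlowup_contraction M

lemma apply_center_eq (hM : ∀ g ∈ G, FixesPoint (M⁻¹ * g * M)) (σ : bar G) (u : SpecC) :
    σ.1.hom.left (center M u) = center M u :=
  congrArg (fun f : SpecC ⟶ (projSpace 2).left => f u) (center_comp_bar hM σ)

lemma orbit_center (hM : ∀ g ∈ G, FixesPoint (M⁻¹ * g * M)) (u : SpecC) :
    orbit (plane G) (center M u) = {center M u} := by
  have h : (fun σ : bar G => ((plane G).ρ σ).hom.left (center M u)) = fun _ => center M u :=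
    funext fun σ => apply_center_eq hM σ u
  exact (congrArg Set.range h).trans Set.range_const

/-- The surface is a del Pezzo surface, since a single point is in general position. -/
lemma isDelPezzo_surface : IsDelPezzo surface := by
  let p := center 1 (⊥ : PrimeSpectrum ℂ)
  have h (P : (projSpace 2).left → Prop) : {q ∈ ({p} : Set (projSpace 2).left) | P q}.ncard ≤ 1 :=
    (Set.ncard_le_ncard (Set.sep_subset _ _)).trans (Set.ncard_singleton p).le
  refine .inr ⟨{p}, Set.finite_singleton p, by rw [Set.ncard_singleton]; norm_num, ?_,
    ⟨fun F _ _ => (h _).trans_lt (by norm_num), fun F _ _ => (h _).trans_lt (by norm_num),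
      fun F _ _ _ => (h _).trans_lt (by norm_num)⟩, contraction 1, isBlowupOfPoints 1 _⟩
  rintro _ rfl
  exact isClosed_center 1 _

lemma isGSurface_plane (G : Subgroup (Matrix.SpecialLinearGroup (Fin 3) ℂ)) :
    IsGSurface (plane G) :=
  ⟨isSmoothProjectiveSurface_plane, (bar G).subtype_injective⟩

lemma isRelativelyMinimal_blownUp : IsRelativelyMinimal (blownUp hM) φ :=
  fun _ f _ hS' _ hf hψ => isIso_of_isBirationalMorphism (f := f) hS'.surface hψ hf

/-- The blowup of the fixed point as a link, whose conic bundle is the ruling. -/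
def link (u : SpecC) : TypeILink (plane G) (blownUp hM) where
  center := center M u
  π := contraction M
  φ' := φ
  χ := blowupInv M
  source_surface := isGSurface_plane G
  target_surface := isGSurface_blownUp hM
  isClosed_center := isClosed_center M u
  π_equivariant := ⟨fun σ => ⟨σ, blownUp_comp hM σ⟩, fun σ => ⟨σ, blownUp_comp hM σ⟩⟩
  π_blowup := by
    rw [orbit_center hM u]
    exact isBlowupOfPoints M u
  χ_equivariant := ⟨fun σ => ⟨σ, rat_trans_eq hM σ⟩, fun σ => ⟨σ, rat_trans_eq hM σ⟩⟩
  χ_comp_π := rat_blowupInv_compHom M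
  delPezzo := isDelPezzo_surface
  conicBundle := isGConicBundle_blownUp hM
  relativelyMinimal := isRelativelyMinimal_blownUp hM

end Scroll

end GLink

end

theorem proposition4p1 (G : Subgroup (Matrix.SpecialLinearGroup (Fin 3) ℂ)) [Finite G]
    (hG : ¬ (GLink.natRep G).IsIrreducible) :
    (∃ (p : (GLink.projSpace 2).left), IsClosed {p} ∧
      (∀ σ ∈ GLink.bar G, σ.hom.left p = p) ∧
      ∃ (S' : GLink.GVariety (GLink.bar G)) (L : GLink.TypeILink (GLink.plane G) S'),
        L.center = p ∧ IsEmpty (S'.X ≅ GLink.projSpace 2)) ∧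
    ¬ GLink.IsGRigid (GLink.plane G) := by
  obtain ⟨M, hM⟩ := GLink.exists_fixesPoint hG
  let u : GLink.SpecC := (⊥ : PrimeSpectrum ℂ)
  refine ⟨⟨GLink.Scroll.center M u, GLink.Scroll.isClosed_center M u,
    fun σ hσ => GLink.Scroll.apply_center_eq hM ⟨σ, hσ⟩ u, GLink.Scroll.blownUp hM,
    GLink.Scroll.link hM u, rfl, GLink.Scroll.isEmpty_iso_plane⟩, fun h => ?_⟩
  -- Rigidity would turn the link into an isomorphism of its target with the plane.
  obtain ⟨-, e, -⟩ := h (GLink.Scroll.blownUp hM) (GLink.Scroll.blowupInv M)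
    ⟨GLink.Scroll.isGSurface_blownUp hM, .inr ⟨GLink.Scroll.φ,
      GLink.Scroll.isGConicBundle_blownUp hM, GLink.Scroll.isRelativelyMinimal_blownUp hM⟩⟩
    (GLink.Scroll.link hM u).χ_equivariant
  exact GLink.Scroll.isEmpty_iso_plane.false e.symm
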